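/- Let $\mathbb{K}$ be a field of characteristic zero. A noncrossing partition is a set partition $\pi$ of $[n]=\{1,\dots,n\}$, $n\ge 1$, such that there are no distinct blocks $b\neq b'$ and $x,z\in b$, $y,t\in b'$ with $x<y<z<t$; $|\pi|$ is its number of blocks. Let $\mathbb{K}[\mathcal{NCP}]$ be the free commutative algebra generated by all noncrossing partitions. A nonempty set $Y$ of blocks of $\pi$ is identified with the noncrossing partition $\pi_{\mid Y}$ obtained by relabelling its union increasingly by $1,2,\dots$; moreover $\pi_{\mid\emptyset}=1$. A set $J$ of blocks of $\pi$ is an ideal if every connected component (maximal interval) of $\bigcup_{b\in J} b$ is a union of blocks of $\pi$; then $\pi_{\mid_\cdot J}$ is the product in $\mathbb{K}[\mathcal{NCP}]$, over these components $C$, of the restrictions of $\pi$ to $C$. For an equivalence $\sim$ on the blocks of $\pi$, let $\pi/\!\sim$ be the partition obtained by merging the blocks of each class, let $\pi\mid_\cdot\sim$ be the product over the classes $c$ of $\pi_{\mid c}$, and write $\sim\,\in\mathcal{E}_c[\pi]$ if $\pi/\!\sim$ is noncrossing. Let $\Delta,\delta:\mathbb{K}[\mathcal{NCP}]\to\mathbb{K}[\mathcal{NCP}]\otimes\mathbb{K}[\mathcal{NCP}]$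 be the algebra morphisms with $$\Delta(\pi)=\sum_{J\text{ ideal of }\pi}\pi_{\mid \pi\setminus J}\otimes\pi_{\mid_\cdot J},\qquad \delta(\pi)=\sum_{\sim\in\mathcal{E}_c[\pi]}\pi/\!\sim\;\otimes\;\pi\mid_\cdot\sim,$$ and let their counits be the characters $\varepsilon_\Delta(\pi)=0$ and $\epsilon_\delta(\pi)=1$ if $|\pi|=1$, $\epsilon_\delta(\pi)=0$ otherwise. On $\mathbb{K}[X]$ let $\Delta(X)=X\otimes1+1\otimes X$ and $\delta(X)=X\otimes X$ (multiplicatively), with counits $P\mapsto P(0)$ and $P\mapsto P(1)$. There is a unique algebra morphism $\phi_{\mathcal{NCP}}:\mathbb{K}[\mathcal{NCP}]\to\mathbb{K}[X]$ compatible with both coproducts and both counits. Let $\mu_{\mathcal{NCP}}$ be the character $x\mapsto\phi_{\mathcal{NCP}}(x)(-1)$. Then: 1. $(\mathbb{K}[\mathcal{NCP}],m,\Delta)$ is a Hopf algebra, and its antipode is $S=(\mu_{\mathcal{NCP}}\otimes\mathrm{Id})\circ\delta$; thus, for any noncrossing partition $\pi$, $S(\pi)=\sum_{\sim\in\mathcal{E}_c[\pi]}\mu_{\mathcal{NCP}}(\pi/\!\sim)\,\pi\mid_\cdot\sim$.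 2. Let $\mathrm{Base}(\pi)$ be the set of blocks of $\pi$ that are minimal for the order $b\le_\pi b'\iff b'\subseteq[\min b,\max b]$. Then, for any noncrossing partition $\pi$, $\pi\setminus\mathrm{Base}(\pi)$ is an ideal of $\pi$ and $$\mu_{\mathcal{NCP}}(\pi)=(-1)^{|\mathrm{Base}(\pi)|}\,\mathrm{cat}_{|\mathrm{Base}(\pi)|}\;\mu_{\mathcal{NCP}}\bigl(\pi_{\mid_\cdot\,\pi\setminus\mathrm{Base}(\pi)}\bigr),$$ where $\mathrm{cat}_k=\frac1{k+1}\binom{2k}{k}$. 3. For any noncrossing partition $\pi$, $$\mu_{\mathcal{NCP}}(\pi)=(-1)^{|\pi|}\prod_{X\in\pi/\sim_\pi}\mathrm{cat}_{|X|},$$ where $b\sim_\pi b'$ if there are blocks $b_1,\dots,b_k$ ($k\ge1$) of $\pi$ with $\max(b_i)+1=\min(b_{i+1})$ for $1\le i<k$ and $\{b_1,b_k\}=\{b,b'\}$. -/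

import Mathlib

open scoped TensorProduct Polynomial

namespace NCPart

/-! ## Noncrossing partitions -/

/-- A family of sets of integers is noncrossing if there are no two distinct members `b`, `b'`
with `x < y < z < t`, `x, z ∈ b` and `y, t ∈ b'`. -/
def NonCrossing (B : Finset (Finset ℕ)) : Prop :=
  ∀ b ∈ B, ∀ b' ∈ B, b ≠ b' → ∀ x ∈ b, ∀ z ∈ b, ∀ y ∈ b', ∀ t ∈ b',
    ¬ (x < y ∧ y < z ∧ z < t)

/-- A noncrossing partition of `[n] = {1, …, n}` with `n ≥ 1`. These are the generators of the
algebra below (the empty partition is identified with the unit of the algebra). -/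
structure NCP where
  n : ℕ
  pos : 0 < n
  part : Finpartition (Finset.Icc 1 n)
  nonCrossing : NonCrossing part.parts

/-- The set of blocks of `π`. -/
abbrev NCP.blocks (π : NCP) : Finset (Finset ℕ) := π.part.parts

/-- A finite set of nonempty, pairwise disjoint, mutually noncrossing finite sets of integers:
a noncrossing partition of its union. -/
structure IsNCFamily (B : Finset (Finset ℕ)) : Prop where
  empty_notMem : ∅ ∉ B
  disjoint : ∀ b ∈ B, ∀ b' ∈ B, b ≠ b' → Disjoint b b'
  nonCrossing : NonCrossing B

/-- The union of the members of a family. -/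
def support (B : Finset (Finset ℕ)) : Finset ℕ := B.sup id

/-- On `s`, the function `rank s` is the unique increasing bijection from `s` to `[|s|]`. -/
def rank (s : Finset ℕ) (x : ℕ) : ℕ := (s.filter (· ≤ x)).card

theorem rank_lt {s : Finset ℕ} {x y : ℕ} (hy : y ∈ s) (h : x < y) : rank s x < rank s y := by
  apply Finset.card_lt_card
  rw [Finset.ssubset_iff_of_subset]
  · exact ⟨y, by simp [hy], by simp [h]⟩
  · intro z hz
    simp only [Finset.mem_filter] at hz ⊢
    exact ⟨hz.1, hz.2.trans h.le⟩

theorem lt_of_rank_lt {s : Finset ℕ} {x y : ℕ} (hx : x ∈ s) (h : rank s x < rank s y) :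
    x < y := by
  by_contra hn
  rcases (not_lt.mp hn).lt_or_eq with h' | h'
  · exact absurd (rank_lt hx h') (by omega)
  · subst h'; omega

theorem rank_inj {s : Finset ℕ} {x y : ℕ} (hx : x ∈ s) (hy : y ∈ s) (h : rank s x = rank s y) :
    x = y := by
  rcases lt_trichotomy x y with h' | h' | h'
  · exact absurd (rank_lt hy h') (by omega)
  · exact h'
  · exact absurd (rank_lt hx h') (by omega)

theorem image_rank (s : Finset ℕ) : s.image (rank s) = Finset.Icc 1 s.card := by
  apply Finset.eq_of_subset_of_card_le
  · intro k hk
    obtain ⟨x, hx, rfl⟩ := Finset.mem_image.mp hk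
    rw [Finset.mem_Icc]
    exact ⟨Finset.card_pos.mpr ⟨x, by simp [hx]⟩, Finset.card_le_card (Finset.filter_subset _ _)⟩
  · rw [Finset.card_image_of_injOn (fun x hx y hy h => rank_inj hx hy h)]
    simp

theorem subset_support {B : Finset (Finset ℕ)} {b : Finset ℕ} (hb : b ∈ B) : b ⊆ support B :=
  Finset.le_sup (f := id) hb

/-- The noncrossing partition of `[m]` obtained from a nonempty noncrossing family by relabelling
its union, of cardinality `m`, increasingly by `1, …, m`. -/
def NCP.std (B : Finset (Finset ℕ)) (hB : IsNCFamily B) (hne : B.Nonempty) : NCP where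
  n := (support B).card
  pos := by
    obtain ⟨b, hb⟩ := hne
    have hb' : b.Nonempty := Finset.nonempty_iff_ne_empty.mpr fun h => hB.empty_notMem (h ▸ hb)
    exact Finset.card_pos.mpr (hb'.mono (subset_support hb))
  part :=
    { parts := B.image (Finset.image (rank (support B)))
      supIndep := by
        rw [Finset.supIndep_iff_pairwiseDisjoint]
        intro c hc c' hc' hcc
        obtain ⟨b, hb, rfl⟩ := Finset.mem_image.mp (Finset.mem_coe.mp hc)
        obtain ⟨b', hb', rfl⟩ := Finset.mem_image.mp (Finset.mem_coe.mp hc')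
        have hbb : b ≠ b' := fun h => hcc (by rw [h])
        simp only [Function.onFun, id]
        rw [Finset.disjoint_left]
        intro k hk hk'
        obtain ⟨x, hx, rfl⟩ := Finset.mem_image.mp hk
        obtain ⟨y, hy, hxy⟩ := Finset.mem_image.mp hk'
        have := rank_inj (subset_support hb' hy) (subset_support hb hx) hxy
        subst this
        exact Finset.disjoint_left.mp (hB.disjoint b hb b' hb' hbb) hx hy
      sup_parts := by
        rw [← image_rank]
        ext k
        simp only [Finset.mem_sup, Finset.mem_image, id, support]
        constructor
        · rintro ⟨_, ⟨b, hb, rfl⟩, hk⟩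
          obtain ⟨x, hx, rfl⟩ := Finset.mem_image.mp hk
          exact ⟨x, ⟨b, hb, hx⟩, rfl⟩
        · rintro ⟨x, ⟨b, hb, hx⟩, rfl⟩
          exact ⟨_, ⟨b, hb, rfl⟩, Finset.mem_image_of_mem _ hx⟩
      bot_notMem := by
        intro h
        obtain ⟨b, hb, hb'⟩ := Finset.mem_image.mp h
        rw [Finset.bot_eq_empty, Finset.image_eq_empty] at hb'
        exact hB.empty_notMem (hb' ▸ hb) }
  nonCrossing := by
    intro c hc c' hc' hcc x hx z hz y hy t ht hlt
    obtain ⟨b, hb, rfl⟩ := Finset.mem_image.mp hc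
    obtain ⟨b₂, hb₂, rfl⟩ := Finset.mem_image.mp hc'
    obtain ⟨x', hx', rfl⟩ := Finset.mem_image.mp hx
    obtain ⟨y', hy', rfl⟩ := Finset.mem_image.mp hy
    obtain ⟨z', hz', rfl⟩ := Finset.mem_image.mp hz
    obtain ⟨t', ht', rfl⟩ := Finset.mem_image.mp ht
    exact hB.nonCrossing b hb _ hb₂ (fun h => hcc (by rw [h])) x' hx' z' hz' y' hy' t' ht'
      ⟨lt_of_rank_lt (subset_support hb hx') hlt.1,
        lt_of_rank_lt (subset_support hb₂ hy') hlt.2.1,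
        lt_of_rank_lt (subset_support hb hz') hlt.2.2⟩

/-! ## Nesting order, base, ideals -/

/-- The nesting order on blocks: `b ≤ b'` if `b' ⊆ [min b, max b]`. -/
def Nested (b b' : Finset ℕ) : Prop :=
  ∃ l u, IsLeast (b : Set ℕ) l ∧ IsGreatest (b : Set ℕ) u ∧ b' ⊆ Finset.Icc l u

open Classical in
/-- The set of blocks of `π` that are minimal for the nesting order. -/
noncomputable def base (π : NCP) : Finset (Finset ℕ) :=
  π.blocks.filter fun b => ∀ b' ∈ π.blocks, Nested b' b → b' = b

/-- The connected component of `x` in `s`: all `y ∈ s` such that the whole interval between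
`x` and `y` is contained in `s`. -/
def component (s : Finset ℕ) (x : ℕ) : Finset ℕ := s.filter fun y => Finset.uIcc x y ⊆ s

/-- The connected components (maximal intervals) of a finite set of integers. -/
def components (s : Finset ℕ) : Finset (Finset ℕ) := s.image (component s)

/-- A set `J` of blocks of `π` is an ideal if every connected component of the union of `J` is a
union of blocks of `π`. -/
def IsIdeal (π : NCP) (J : Finset (Finset ℕ)) : Prop :=
  J ⊆ π.blocks ∧ ∀ C ∈ components (support J), ∃ D ⊆ π.blocks, C = support D

/-! ## The algebra of noncrossing partitions and its two coproducts -/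

section Algebra

variable (K : Type*) [Field K]

/-- The free commutative algebra generated by noncrossing partitions. -/
abbrev KNCP := MvPolynomial NCP K

open Classical in
/-- The element of the algebra given by a noncrossing family `B`: the generator of its relabelling
if `B` is nonempty, and the unit if `B` is empty. (It is only used for noncrossing families.) -/
noncomputable def gen (B : Finset (Finset ℕ)) : KNCP K :=
  if h : IsNCFamily B ∧ B.Nonempty then MvPolynomial.X (NCP.std B h.1 h.2) else 1

/-- For an ideal `J` of `π`, the product over the connected components `C` of the union of `J` of
the restrictions of `π` to `C`. -/
noncomputable def restrictDot (π : NCP) (J : Finset (Finset ℕ)) : KNCP K :=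
  ∏ C ∈ components (support J), gen K (π.blocks.filter (· ⊆ C))

open Classical in
/-- The coproduct `Δ`: the algebra morphism sending `π` to the sum over the ideals `J` of `π` of
the restriction of `π` to the complement of `J`, tensored with `restrictDot π J`. -/
noncomputable def sepComul : KNCP K →ₐ[K] KNCP K ⊗[K] KNCP K :=
  MvPolynomial.aeval fun π : NCP =>
    ∑ J ∈ π.blocks.powerset.filter (IsIdeal π), gen K (π.blocks \ J) ⊗ₜ[K] restrictDot K π J

/-- The counit of `Δ`. -/
noncomputable def sepCounit : KNCP K →ₐ[K] K :=
  MvPolynomial.aeval fun _ : NCP => 0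

/-- The blocks of the contraction of `π` along an equivalence `P` on its blocks (given as the
partition of the set of blocks into classes): the unions of the classes. -/
def contract {π : NCP} (P : Finpartition π.blocks) : Finset (Finset ℕ) := P.parts.image support

/-- The extraction: the product over the classes of `P` of the restrictions of `π`. -/
noncomputable def extract {π : NCP} (P : Finpartition π.blocks) : KNCP K :=
  ∏ c ∈ P.parts, gen K c

open Classical in
/-- The equivalences on the blocks of `π` for which the contraction is noncrossing. -/
noncomputable def contractible (π : NCP) : Finset (Finpartition π.blocks) :=
  Finset.univ.filter fun P => NonCrossing (contract P)

/-- The coproduct `δ` of contraction and extraction. -/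
noncomputable def extComul : KNCP K →ₐ[K] KNCP K ⊗[K] KNCP K :=
  MvPolynomial.aeval fun π : NCP =>
    ∑ P ∈ contractible π, gen K (contract P) ⊗ₜ[K] extract K P

/-- The counit of `δ`: it sends `π` to `1` if `π` has exactly one block and to `0` otherwise. -/
noncomputable def extCounit : KNCP K →ₐ[K] K :=
  MvPolynomial.aeval fun π : NCP => if π.blocks.card = 1 then 1 else 0

/-! ## The double bialgebra of polynomials and double bialgebra morphisms -/

/-- The coproduct of `K[X]` with `Δ(X) = X ⊗ 1 + 1 ⊗ X`; its counit is `P ↦ P(0)`. -/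
noncomputable def polyAddComul : K[X] →ₐ[K] K[X] ⊗[K] K[X] :=
  Polynomial.aeval (Polynomial.X ⊗ₜ[K] 1 + 1 ⊗ₜ[K] Polynomial.X)

/-- The coproduct of `K[X]` with `δ(X) = X ⊗ X`; its counit is `P ↦ P(1)`. -/
noncomputable def polyMulComul : K[X] →ₐ[K] K[X] ⊗[K] K[X] :=
  Polynomial.aeval (Polynomial.X ⊗ₜ[K] Polynomial.X)

variable {K}

/-- `φ` is a morphism of double bialgebras to `K[X]`: an algebra morphism compatible with both
coproducts and both counits. -/
structure IsDoubleBialgebraHom (φ : KNCP K →ₐ[K] K[X]) : Prop where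
  sep_comul : (Algebra.TensorProduct.map φ φ).comp (sepComul K) = (polyAddComul K).comp φ
  sep_counit : (Polynomial.aeval (0 : K)).comp φ = sepCounit K
  ext_comul : (Algebra.TensorProduct.map φ φ).comp (extComul K) = (polyMulComul K).comp φ
  ext_counit : (Polynomial.aeval (1 : K)).comp φ = extCounit K

/-- The coproduct `D` and the counit `e` make the algebra `A` a bialgebra, and `S` is its antipode:
together they are a Hopf algebra. -/
structure IsHopfAlgebra {A : Type*} [CommRing A] [Algebra K A] (D : A →ₐ[K] A ⊗[K] A)
    (e : A →ₐ[K] K) (S : A →ₗ[K] A) : Prop where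
  coassoc : (Algebra.TensorProduct.assoc K K K A A A).toAlgHom.comp
      ((Algebra.TensorProduct.map D (.id K A)).comp D) =
    (Algebra.TensorProduct.map (.id K A) D).comp D
  counit_left : (Algebra.TensorProduct.map e (.id K A)).comp D =
    (Algebra.TensorProduct.lid K A).symm
  counit_right : (Algebra.TensorProduct.map (.id K A) e).comp D =
    (Algebra.TensorProduct.rid K K A).symm
  antipode_left : LinearMap.mul' K A ∘ₗ S.rTensor A ∘ₗ D.toLinearMap =
    Algebra.linearMap K A ∘ₗ e.toLinearMap
  antipode_right : LinearMap.mul' K A ∘ₗ S.lTensor A ∘ₗ D.toLinearMap =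
    Algebra.linearMap K A ∘ₗ e.toLinearMap

/-- The character `x ↦ φ(x)(-1)`. -/
noncomputable def mu (φ : KNCP K →ₐ[K] K[X]) : KNCP K →ₐ[K] K :=
  (Polynomial.aeval (-1 : K)).comp φ

/-- The map `(χ ⊗ Id) ∘ δ` for a character `χ`, after the identification `K ⊗ A = A`. -/
noncomputable def act (χ : KNCP K →ₐ[K] K) : KNCP K →ₐ[K] KNCP K :=
  (Algebra.TensorProduct.lid K (KNCP K)).toAlgHom.comp
    ((Algebra.TensorProduct.map χ (.id K (KNCP K))).comp (extComul K))

end Algebra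

/-! ## Chains of adjacent blocks -/

/-- `b'` starts just after the end of `b`: `max b + 1 = min b'`, for blocks `b`, `b'` of `π`. -/
def Adjacent (π : NCP) (b b' : Finset ℕ) : Prop :=
  b ∈ π.blocks ∧ b' ∈ π.blocks ∧
    ∃ m, IsGreatest (b : Set ℕ) m ∧ IsLeast (b' : Set ℕ) (m + 1)

/-- The relation on blocks: one of the two blocks can be reached from the other one by a chain of
blocks, each adjacent to the next one. -/
def Chained (π : NCP) (b b' : Finset ℕ) : Prop :=
  Relation.ReflTransGen (Adjacent π) b b' ∨ Relation.ReflTransGen (Adjacent π) b' b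

open Classical in
/-- The set of equivalence classes of blocks of `π` for the relation `Chained π`. -/
noncomputable def chainClasses (π : NCP) : Finset (Finset (Finset ℕ)) :=
  π.blocks.image fun b => π.blocks.filter (Chained π b)

end NCPart

/-! Blocks are never relabelled while computing. For an arbitrary noncrossing family `B`, possibly
with gaps in its support, ideals are replaced by sets `J` such that every block meeting the hull of
a block of `J` is again in `J` (`IsUpper`), and components by the classes of `Conn`. These notions
compare only the positions of blocks, so they are invariant under increasing maps, and on a
partition of `[n]` they agree with the interval definitions (`NCP.isIdeal_iff`,
`NCP.restrictDot_eq`). The coproducts become two operations on functions of families, `sumSep` and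
`sumExt`. Coassociativity of `Δ` is `sumSep_assoc`; the cointeraction, by which `δ` distributes over
`Δ`, is `sumExt_sumSep`. Both are bijections between index sets.

The morphism to `K[X]` is forced: evaluating it at a natural number `n` must give the `n`-th
convolution power `unitPow K n` of the counit of `δ` along `Δ`. Conversely, these powers are
polynomial in `n` (`exists_polynomial_unitPow`), and compatibility with `Δ` and `δ` reduces to
`unitPow_add` and `unitPow_mul`. The latter uses the cointeraction and the left counit of `δ`, not
its coassociativity.

Evaluation at `-1` is the convolution inverse of evaluation at `1`, the counit of `δ`. By the
cointeraction, the map `χ ↦ (χ ⊗ Id) ∘ δ` respects convolution and sends the counit of `δ` to the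
identity; hence it sends `μ` to the inverse of the identity, which is the antipode (`sepConv_act`).

For the closed formula, the inverse relation reads `μ(B) + ∑ μ(B without b) = 0`, the sum being over
the blocks `b` nested in no other block (`roots`), since the counit of `δ` vanishes on families with
at least two blocks. Call two blocks siblings if they lie in the same gaps of all blocks (`Sib`).
Removing a root splits the sibling class of the roots into those on its left and those on its right
and leaves the other classes alone, so the Catalan recurrence shows that the signed product
`sibWeight` satisfies the same relation. In a partition of `[n]` there are no holes, so siblings are
exactly the blocks joined by adjacent chains (`chained_iff_sib`); setting the class of roots aside
gives the recursion through the base. -/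

namespace NCPart

/-! ### Products over the classes of an equivalence relation on a finite set. -/

section Classes

variable {α : Type*} [DecidableEq α]

/-- `r` restricts to an equivalence relation on the finite set `J`. -/
structure IsEquivOn (J : Finset α) (r : α → α → Prop) : Prop where
  refl : ∀ a ∈ J, r a a
  symm : ∀ a ∈ J, ∀ b ∈ J, r a b → r b a
  trans : ∀ a ∈ J, ∀ b ∈ J, ∀ c ∈ J, r a b → r b c → r a c

open Classical in
/-- The classes of the relation `r` on `J`. -/
noncomputable def classes (J : Finset α) (r : α → α → Prop) : Finset (Finset α) :=
  J.image fun a => J.filter (r a)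

/-- `P` is the set of classes of an equivalence relation on `B`. -/
structure IsPart (B : Finset α) (P : Finset (Finset α)) : Prop where
  nonempty : ∀ c ∈ P, c.Nonempty
  sub : ∀ c ∈ P, c ⊆ B
  eq_of_mem : ∀ c ∈ P, ∀ c' ∈ P, ∀ b, b ∈ c → b ∈ c' → c = c'
  exists_mem : ∀ b ∈ B, ∃ c ∈ P, b ∈ c

theorem IsEquivOn.mono {α : Type*} {I J : Finset α} {r : α → α → Prop} (h : IsEquivOn J r)
    (hI : I ⊆ J) : IsEquivOn I r :=
  ⟨fun a ha => h.refl a (hI ha), fun a ha b hb => h.symm a (hI ha) b (hI hb),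
    fun a ha b hb c hc => h.trans a (hI ha) b (hI hb) c (hI hc)⟩

theorem mem_classes_iff {J : Finset α} {r : α → α → Prop} {c : Finset α} :
    c ∈ classes J r ↔ ∃ a ∈ J, ∀ b, b ∈ c ↔ b ∈ J ∧ r a b := by
  classical
  simp only [classes, Finset.mem_image]
  constructor
  · rintro ⟨a, ha, rfl⟩
    exact ⟨a, ha, fun b => by simp⟩
  · rintro ⟨a, ha, h⟩
    exact ⟨a, ha, by ext b; simp [h b]⟩

theorem IsEquivOn.mem_iff {J : Finset α} {r : α → α → Prop} (h : IsEquivOn J r) {c : Finset α}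
    (hc : c ∈ classes J r) {a : α} (ha : a ∈ c) (b : α) : b ∈ c ↔ b ∈ J ∧ r a b := by
  obtain ⟨a', ha', hc⟩ := mem_classes_iff.mp hc
  obtain ⟨haJ, haa⟩ := (hc a).mp ha
  rw [hc]
  refine and_congr_right fun hb => ⟨fun hr => ?_, fun hr => ?_⟩
  · exact h.trans a haJ a' ha' b hb (h.symm a' ha' a haJ haa) hr
  · exact h.trans a' ha' a haJ b hb haa hr

theorem IsEquivOn.isPart {J : Finset α} {r : α → α → Prop} (h : IsEquivOn J r) :
    IsPart J (classes J r) where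
  nonempty c hc := by
    obtain ⟨a, ha, hc⟩ := mem_classes_iff.mp hc
    exact ⟨a, (hc a).mpr ⟨ha, h.refl a ha⟩⟩
  sub c hc b hb := by
    obtain ⟨a, ha, hc⟩ := mem_classes_iff.mp hc
    exact ((hc b).mp hb).1
  eq_of_mem c hc c' hc' b hb hb' := by
    ext x
    rw [h.mem_iff hc hb, h.mem_iff hc' hb']
  exists_mem b hb := by
    classical
    exact ⟨J.filter (r b), Finset.mem_image_of_mem _ hb, by simp [hb, h.refl b hb]⟩

theorem classes_congr {J : Finset α} {r s : α → α → Prop}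
    (h : ∀ a ∈ J, ∀ b ∈ J, r a b ↔ s a b) : classes J r = classes J s := by
  ext c
  rw [mem_classes_iff, mem_classes_iff]
  refine exists_congr fun a => and_congr_right fun ha => forall_congr' fun b => ?_
  rw [and_congr_right fun hb => h a ha b hb]

theorem classes_empty (r : α → α → Prop) : classes (∅ : Finset α) r = ∅ := by
  simp [classes]

theorem classes_eq_singleton {J : Finset α} {r : α → α → Prop} (hJ : J.Nonempty)
    (h : ∀ a ∈ J, ∀ b ∈ J, r a b) : classes J r = {J} := by
  ext c
  rw [mem_classes_iff, Finset.mem_singleton]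
  constructor
  · rintro ⟨a, ha, hc⟩
    ext b
    rw [hc]
    exact ⟨fun h => h.1, fun hb => ⟨hb, h a ha b hb⟩⟩
  · rintro rfl
    obtain ⟨a, ha⟩ := hJ
    exact ⟨a, ha, fun b => ⟨fun hb => ⟨hb, h a ha b hb⟩, fun h => h.1⟩⟩

variable {R : Type*} [CommSemiring R]

/-- The product over the classes of a relation on `I` may be grouped along the classes of a
coarser relation on a larger set. -/
theorem prod_classes_refine {I J : Finset α} {r s : α → α → Prop} (hIJ : I ⊆ J)
    (hr : IsEquivOn I r) (hs : IsEquivOn J s) (hrs : ∀ a ∈ I, ∀ b ∈ I, r a b → s a b)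
    (f : Finset α → R) :
    ∏ c ∈ classes I r, f c = ∏ C ∈ classes J s, ∏ c ∈ classes (I ∩ C) r, f c := by
  rw [← Finset.prod_biUnion]
  · congr 1
    ext c
    rw [Finset.mem_biUnion]
    constructor
    · intro hc
      obtain ⟨a, ha⟩ := hr.isPart.nonempty c hc
      have haI := hr.isPart.sub c hc ha
      obtain ⟨C, hC, haC⟩ := hs.isPart.exists_mem a (hIJ haI)
      refine ⟨C, hC, mem_classes_iff.mpr ⟨a, Finset.mem_inter.mpr ⟨haI, haC⟩, fun b => ?_⟩⟩
      rw [hr.mem_iff hc ha, Finset.mem_inter, hs.mem_iff hC haC]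
      exact ⟨fun h => ⟨⟨h.1, hIJ h.1, hrs a haI b h.1 h.2⟩, h.2⟩, fun h => ⟨h.1.1, h.2⟩⟩
    · rintro ⟨C, hC, hc⟩
      obtain ⟨a, ha, hc⟩ := mem_classes_iff.mp hc
      obtain ⟨haI, haC⟩ := Finset.mem_inter.mp ha
      refine mem_classes_iff.mpr ⟨a, haI, fun b => ?_⟩
      rw [hc, Finset.mem_inter, hs.mem_iff hC haC]
      exact ⟨fun h => ⟨h.1.1, h.2⟩, fun h => ⟨⟨h.1, hIJ h.1, hrs a haI b h.1 h.2⟩, h.2⟩⟩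
  · intro C hC C' hC' hne
    simp only [Function.onFun]
    rw [Finset.disjoint_left]
    intro c hc hc'
    have h1 := (hr.mono (Finset.inter_subset_left (s₂ := C))).isPart
    have h2 := (hr.mono (Finset.inter_subset_left (s₂ := C'))).isPart
    obtain ⟨a, ha⟩ := h1.nonempty c hc
    exact hne (hs.isPart.eq_of_mem C hC C' hC' a (Finset.mem_inter.mp (h1.sub c hc ha)).2
      (Finset.mem_inter.mp (h2.sub c hc' ha)).2)

/-- The classes on `I` are the nonempty traces of the classes on `J`; the empty traces contribute `f
∅ = 1`. -/
theorem prod_classes_inter {I J : Finset α} {s : α → α → Prop} (hIJ : I ⊆ J)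
    (hs : IsEquivOn J s) (f : Finset α → R) (hf : f ∅ = 1) :
    ∏ c ∈ classes I s, f c = ∏ C ∈ classes J s, f (I ∩ C) := by
  rw [prod_classes_refine hIJ (hs.mono hIJ) hs (fun _ _ _ _ h => h)]
  refine Finset.prod_congr rfl fun C hC => ?_
  rcases (I ∩ C).eq_empty_or_nonempty with h | h
  · rw [h, classes_empty, Finset.prod_empty, hf]
  · rw [classes_eq_singleton h, Finset.prod_singleton]
    intro a ha b hb
    exact ((hs.mem_iff hC (Finset.mem_inter.mp ha).2 b).mp (Finset.mem_inter.mp hb).2).2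

/-- A product of sums is the sum over any set of global choices that is in bijection with the
families of local choices. -/
theorem prod_sum_eq_sum_prod {ι β γ : Type*} [DecidableEq ι] {s : Finset ι} {t : ι → Finset β}
    {T : Finset γ} (r : ι → γ → β) (w : ι → β → R)
    (hr : ∀ q ∈ T, ∀ i ∈ s, r i q ∈ t i)
    (hinj : ∀ q ∈ T, ∀ q' ∈ T, (∀ i ∈ s, r i q = r i q') → q = q')
    (hsurj : ∀ p : ∀ i ∈ s, β, (∀ i hi, p i hi ∈ t i) → ∃ q ∈ T, ∀ i hi, r i q = p i hi) :
    ∏ i ∈ s, ∑ b ∈ t i, w i b = ∑ q ∈ T, ∏ i ∈ s, w i (r i q) := by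
  rw [Finset.prod_sum]
  symm
  refine Finset.sum_bij (fun q _ i _ => r i q) ?_ ?_ ?_ ?_
  · intro q hq
    exact Finset.mem_pi.mpr fun i hi => hr q hq i hi
  · intro q hq q' hq' h
    exact hinj q hq q' hq' fun i hi => congrFun (congrFun h i) hi
  · intro p hp
    obtain ⟨q, hq, h⟩ := hsurj p (Finset.mem_pi.mp hp)
    exact ⟨q, hq, funext fun i => funext fun hi => h i hi⟩
  · intro q hq
    rw [← Finset.prod_attach]

end Classes

/-! ## Ideals and their components for families of blocks -/

/-- All the members of `B` that meet the interval spanned by `b ∪ b'` belong to `J`. -/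
def Conn (B J : Finset (Finset ℕ)) (b b' : Finset ℕ) : Prop :=
  ∀ x ∈ b ∪ b', ∀ z ∈ b ∪ b', ∀ d ∈ B, ∀ y ∈ d, x ≤ y → y ≤ z → d ∈ J

/-- `J` is an upper set of `B` for the nesting order. -/
structure IsUpper (B J : Finset (Finset ℕ)) : Prop where
  sub : J ⊆ B
  conn : ∀ b ∈ J, Conn B J b b

open Classical in
noncomputable def uppers (B : Finset (Finset ℕ)) : Finset (Finset (Finset ℕ)) :=
  B.powerset.filter (IsUpper B)

/-- The connected components of `J` in `B`. -/
noncomputable def comps (B J : Finset (Finset ℕ)) : Finset (Finset (Finset ℕ)) :=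
  classes J (Conn B J)

open Classical in
/-- The equivalences on `B` whose contraction is noncrossing. -/
noncomputable def ncParts (B : Finset (Finset ℕ)) : Finset (Finset (Finset (Finset ℕ))) :=
  B.powerset.powerset.filter fun P => IsPart B P ∧ NonCrossing (P.image support)

theorem mem_uppers {B J : Finset (Finset ℕ)} : J ∈ uppers B ↔ IsUpper B J := by
  simp only [uppers, Finset.mem_filter, Finset.mem_powerset, and_iff_right_iff_imp]
  exact fun h => h.sub

theorem mem_ncParts {B : Finset (Finset ℕ)} {P : Finset (Finset (Finset ℕ))} :
    P ∈ ncParts B ↔ IsPart B P ∧ NonCrossing (P.image support) := by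
  simp only [ncParts, Finset.mem_filter, Finset.mem_powerset, and_iff_right_iff_imp]
  exact fun h c hc => Finset.mem_powerset.mpr (h.1.sub c hc)

theorem mem_support {B : Finset (Finset ℕ)} {x : ℕ} : x ∈ support B ↔ ∃ b ∈ B, x ∈ b := by
  simp [support, Finset.mem_sup]

theorem IsNCFamily.mono {B B' : Finset (Finset ℕ)} (h : IsNCFamily B) (hB : B' ⊆ B) :
    IsNCFamily B' :=
  ⟨fun h' => h.empty_notMem (hB h'), fun b hb b' hb' => h.disjoint b (hB hb) b' (hB hb'),
    fun b hb b' hb' => h.nonCrossing b (hB hb) b' (hB hb')⟩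

theorem IsNCFamily.nonempty {B : Finset (Finset ℕ)} (h : IsNCFamily B) {b : Finset ℕ}
    (hb : b ∈ B) : b.Nonempty :=
  Finset.nonempty_iff_ne_empty.mpr fun h' => h.empty_notMem (h' ▸ hb)

theorem IsNCFamily.eq_of_mem {B : Finset (Finset ℕ)} (h : IsNCFamily B) {b b' : Finset ℕ}
    (hb : b ∈ B) (hb' : b' ∈ B) {x : ℕ} (hx : x ∈ b) (hx' : x ∈ b') : b = b' := by
  by_contra hne
  exact Finset.disjoint_left.mp (h.disjoint b hb b' hb' hne) hx hx'

/-! ### Connectedness of blocks through the hull of their union. -/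

section Conn

variable {B J : Finset (Finset ℕ)}

theorem Conn.symm {b b' : Finset ℕ} (h : Conn B J b b') : Conn B J b' b := by
  unfold Conn at *
  rwa [Finset.union_comm]

/-- The hulls of `b ∪ b'` and `b' ∪ b''` share a point `w` of `b'`, so together they cover the hull
of `b ∪ b''`. -/
theorem Conn.trans (hB : IsNCFamily B) {b b' b'' : Finset ℕ} (hb' : b' ∈ B)
    (h : Conn B J b b') (h' : Conn B J b' b'') : Conn B J b b'' := by
  obtain ⟨w, hw⟩ := hB.nonempty hb'
  intro x hx z hz d hd y hy hxy hyz
  rw [Finset.mem_union] at hx hz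
  have hw1 : w ∈ b ∪ b' := Finset.mem_union_right _ hw
  have hw2 : w ∈ b' ∪ b'' := Finset.mem_union_left _ hw
  rcases le_total w y with hwy | hwy
  · rcases hz with hz | hz
    · exact h w hw1 z (Finset.mem_union_left _ hz) d hd y hy hwy hyz
    · exact h' w hw2 z (Finset.mem_union_right _ hz) d hd y hy hwy hyz
  · rcases hx with hx | hx
    · exact h x (Finset.mem_union_left _ hx) w hw1 d hd y hy hxy hwy
    · exact h' x (Finset.mem_union_right _ hx) w hw2 d hd y hy hxy hwy

theorem Conn.mono {J' : Finset (Finset ℕ)} (h : J ⊆ J') {b b' : Finset ℕ} (hc : Conn B J b b') :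
    Conn B J' b b' :=
  fun x hx z hz d hd y hy hxy hyz => h (hc x hx z hz d hd y hy hxy hyz)

theorem IsUpper.isEquivOn (hB : IsNCFamily B) (h : IsUpper B J) : IsEquivOn J (Conn B J) where
  refl := h.conn
  symm _ _ _ _ := Conn.symm
  trans _ _ _ hb _ _ := Conn.trans hB (h.sub hb)

/-- A block that meets the interval spanned by `b ∪ b'` is connected to `b` if `b'` is. -/
theorem Conn.of_between (h : IsUpper B J) {b b' d : Finset ℕ} (hc : Conn B J b b') (hd : d ∈ B)
    {x y z : ℕ} (hx : x ∈ b ∪ b') (hz : z ∈ b ∪ b') (hy : y ∈ d) (hxy : x ≤ y) (hyz : y ≤ z) :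
    Conn B J b d := by
  have hdJ := hc x hx z hz d hd y hy hxy hyz
  intro u hu v hv e he w hw huw hwv
  rw [Finset.mem_union] at hu hv
  have hd' := h.conn d hdJ
  rw [Conn, Finset.union_self] at hd'
  rcases le_total w y with hwy | hwy
  · rcases hu with hu | hu
    · exact hc u (Finset.mem_union_left _ hu) z hz e he w hw huw (hwy.trans hyz)
    · exact hd' u hu y hy e he w hw huw hwy
  · rcases hv with hv | hv
    · exact hc x hx v (Finset.mem_union_left _ hv) e he w hw (hxy.trans hwy) hwv
    · exact hd' y hy v hv e he w hw hwy hwv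

theorem IsUpper.univ (B : Finset (Finset ℕ)) : IsUpper B B :=
  ⟨subset_rfl, fun _ _ _ _ _ _ _ hd _ _ _ _ => hd⟩

theorem IsUpper.empty (B : Finset (Finset ℕ)) : IsUpper B ∅ :=
  ⟨Finset.empty_subset _, by simp⟩

end Conn

variable {R : Type*} [CommSemiring R]

/-- The convolution of two functions on families of blocks along `Δ`. -/
noncomputable def sumSep (f g : Finset (Finset ℕ) → R) (B : Finset (Finset ℕ)) : R :=
  ∑ J ∈ uppers B, f (B \ J) * ∏ c ∈ comps B J, g c

/-! ### Coassociativity of `Δ` on families of blocks. -/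

section Assoc

variable {B I J : Finset (Finset ℕ)}

/-- The blocks removed from the ambient family belong to `I`, hence to `J`, so they impose no
condition on `J`; the hulls of blocks of `I` are controlled by `hI`. -/
theorem isUpper_sdiff_iff (hI : IsUpper B I) (hIJ : I ⊆ J) (hJ : J ⊆ B) :
    IsUpper (B \ I) (J \ I) ↔ IsUpper B J := by
  constructor
  · intro h
    refine ⟨hJ, fun b hb => ?_⟩
    by_cases hbI : b ∈ I
    · exact (hI.conn b hbI).mono hIJ
    · intro x hx z hz d hd y hy hxy hyz
      by_cases hdI : d ∈ I
      · exact hIJ hdI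
      · exact (Finset.mem_sdiff.mp (h.conn b (Finset.mem_sdiff.mpr ⟨hb, hbI⟩) x hx z hz d
          (Finset.mem_sdiff.mpr ⟨hd, hdI⟩) y hy hxy hyz)).1
  · intro h
    refine ⟨Finset.sdiff_subset_sdiff hJ subset_rfl, fun b hb => ?_⟩
    intro x hx z hz d hd y hy hxy hyz
    rw [Finset.mem_sdiff] at hd hb ⊢
    exact ⟨h.conn b hb.1 x hx z hz d hd.1 y hy hxy hyz, hd.2⟩

/-- Removing blocks of `J` from both families does not change connectedness, as only blocks outside
`J` obstruct it. Components contained in `I` disappear, which is why `g ∅ = 1` is needed. -/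
theorem prod_comps_sdiff (hB : IsNCFamily B) (hJ : IsUpper B J) (hIJ : I ⊆ J)
    (g : Finset (Finset ℕ) → R) (hg : g ∅ = 1) :
    ∏ c ∈ comps (B \ I) (J \ I), g c = ∏ C ∈ comps B J, g (C \ I) := by
  have h1 : comps (B \ I) (J \ I) = classes (J \ I) (Conn B J) := by
    refine classes_congr fun b hb b' hb' => ⟨fun h => ?_, fun h => ?_⟩
    · intro x hx z hz d hd y hy hxy hyz
      by_cases hdI : d ∈ I
      · exact hIJ hdI
      · exact (Finset.mem_sdiff.mp (h x hx z hz d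
          (Finset.mem_sdiff.mpr ⟨hd, hdI⟩) y hy hxy hyz)).1
    · intro x hx z hz d hd y hy hxy hyz
      rw [Finset.mem_sdiff] at hd ⊢
      exact ⟨h x hx z hz d hd.1 y hy hxy hyz, hd.2⟩
  rw [h1, prod_classes_inter Finset.sdiff_subset (hJ.isEquivOn hB) g hg]
  refine Finset.prod_congr rfl fun C hC => ?_
  congr 1
  ext b
  have hCJ := (hJ.isEquivOn hB).isPart.sub C hC
  have := @hCJ b
  simp only [Finset.mem_inter, Finset.mem_sdiff]
  tauto

theorem IsUpper.isPart (hB : IsNCFamily B) (h : IsUpper B J) : IsPart J (comps B J) :=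
  (h.isEquivOn hB).isPart

theorem IsUpper.mem_comps (hB : IsNCFamily B) (h : IsUpper B J) {C : Finset (Finset ℕ)}
    (hC : C ∈ comps B J) {b : Finset ℕ} (hb : b ∈ C) (d : Finset ℕ) :
    d ∈ C ↔ d ∈ J ∧ Conn B J b d :=
  (h.isEquivOn hB).mem_iff hC hb d

/-- A block that meets the interval spanned by two blocks of a component is in the component. -/
theorem IsUpper.mem_comp_of_between (hB : IsNCFamily B) (h : IsUpper B J)
    {C : Finset (Finset ℕ)} (hC : C ∈ comps B J) {b b' d : Finset ℕ} (hb : b ∈ C) (hb' : b' ∈ C)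
    (hd : d ∈ B) {x y z : ℕ} (hx : x ∈ b ∪ b') (hz : z ∈ b ∪ b') (hy : y ∈ d) (hxy : x ≤ y)
    (hyz : y ≤ z) : d ∈ C := by
  have hc := ((h.mem_comps hB hC hb b').mp hb').2
  exact (h.mem_comps hB hC hb d).mpr
    ⟨hc x hx z hz d hd y hy hxy hyz, hc.of_between h hd hx hz hy hxy hyz⟩

/-- The hull of a block of `J` meets only blocks of its own component, so being an upper set is a
condition on each component separately. -/
theorem isUpper_iff_forall_comps (hB : IsNCFamily B) (hJ : IsUpper B J) (hIJ : I ⊆ J) :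
    IsUpper B I ↔ ∀ C ∈ comps B J, IsUpper C (I ∩ C) := by
  constructor
  · intro h C hC
    refine ⟨Finset.inter_subset_right, fun b hb x hx z hz d hd y hy hxy hyz => ?_⟩
    rw [Finset.mem_inter] at hb ⊢
    have hdB := hJ.sub ((hJ.isPart hB).sub C hC hd)
    exact ⟨h.conn b hb.1 x hx z hz d hdB y hy hxy hyz, hd⟩
  · intro h
    refine ⟨hIJ.trans hJ.sub, fun b hb x hx z hz d hd y hy hxy hyz => ?_⟩
    obtain ⟨C, hC, hbC⟩ := (hJ.isPart hB).exists_mem b (hIJ hb)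
    exact (Finset.mem_inter.mp ((h C hC).conn b (Finset.mem_inter.mpr ⟨hb, hbC⟩) x hx z hz d
      (hJ.mem_comp_of_between hB hC hbC hbC hd hx hz hy hxy hyz) y hy hxy hyz)).1

/-- Connectedness in `I` implies connectedness in `J`, and the hull of two blocks of a component `C`
meets only `C`; so components of `I` may be computed inside each `C`. -/
theorem prod_comps_comps (hB : IsNCFamily B) (hI : IsUpper B I) (hJ : IsUpper B J) (hIJ : I ⊆ J)
    (h : Finset (Finset ℕ) → R) :
    ∏ c ∈ comps B I, h c = ∏ C ∈ comps B J, ∏ c ∈ comps C (I ∩ C), h c := by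
  rw [comps, prod_classes_refine hIJ (hI.isEquivOn hB) (hJ.isEquivOn hB)
    (fun b _ b' _ hc => hc.mono hIJ)]
  refine Finset.prod_congr rfl fun C hC => ?_
  congr 1
  refine classes_congr fun b hb b' hb' => ⟨fun hc => ?_, fun hc => ?_⟩
  · intro x hx z hz d hd y hy hxy hyz
    have hdB := hJ.sub ((hJ.isPart hB).sub C hC hd)
    exact Finset.mem_inter.mpr ⟨hc x hx z hz d hdB y hy hxy hyz, hd⟩
  · intro x hx z hz d hd y hy hxy hyz
    rw [Finset.mem_inter] at hb hb'
    exact (Finset.mem_inter.mp (hc x hx z hz d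
      (hJ.mem_comp_of_between hB hC hb.2 hb'.2 hd hx hz hy hxy hyz) y hy hxy hyz)).1

theorem prod_comps_sumSep (hB : IsNCFamily B) (hJ : IsUpper B J)
    (g h : Finset (Finset ℕ) → R) (hg : g ∅ = 1) :
    ∏ C ∈ comps B J, sumSep g h C = ∑ I ∈ uppers B with I ⊆ J,
      (∏ c ∈ comps (B \ I) (J \ I), g c) * ∏ c ∈ comps B I, h c := by
  classical
  unfold sumSep
  rw [prod_sum_eq_sum_prod (T := (uppers B).filter (· ⊆ J)) (fun C I => I ∩ C)
    (fun C I => g (C \ I) * ∏ c ∈ comps C I, h c)]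
  · refine Finset.sum_congr rfl fun I hI => ?_
    rw [Finset.mem_filter, mem_uppers] at hI
    rw [Finset.prod_mul_distrib, prod_comps_comps hB hI.1 hJ hI.2, prod_comps_sdiff hB hJ hI.2 g hg]
    simp
  · intro I hI C hC
    rw [Finset.mem_filter, mem_uppers] at hI
    exact mem_uppers.mpr ((isUpper_iff_forall_comps hB hJ hI.2).mp hI.1 C hC)
  · intro I hI I' hI' heq
    rw [Finset.mem_filter] at hI hI'
    ext b
    by_cases hb : b ∈ J
    · obtain ⟨C, hC, hbC⟩ := (hJ.isPart hB).exists_mem b hb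
      have := congrArg (b ∈ ·) (heq C hC)
      simpa [hbC] using this
    · exact ⟨fun h => absurd (hI.2 h) hb, fun h => absurd (hI'.2 h) hb⟩
  · intro p hp
    -- The union of the local choices restricts back to each of them because the components are
    -- disjoint.
    have key : ∀ C hC, (J.filter fun b => ∃ C hC, b ∈ p C hC) ∩ C = p C hC := by
      intro C hC
      have hpC := (mem_uppers.mp (hp C hC)).sub
      ext b
      simp only [Finset.mem_inter, Finset.mem_filter]
      constructor
      · rintro ⟨⟨hbJ, C', hC', hb'⟩, hbC⟩
        have := (hJ.isPart hB).eq_of_mem C' hC' C hC b ((mem_uppers.mp (hp C' hC')).sub hb') hbC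
        subst this
        exact hb'
      · intro hb
        exact ⟨⟨(hJ.isPart hB).sub C hC (hpC hb), C, hC, hb⟩, hpC hb⟩
    refine ⟨J.filter fun b => ∃ C hC, b ∈ p C hC, ?_, key⟩
    rw [Finset.mem_filter, mem_uppers]
    refine ⟨?_, Finset.filter_subset _ _⟩
    rw [isUpper_iff_forall_comps hB hJ (Finset.filter_subset _ _)]
    intro C hC
    rw [key C hC]
    exact mem_uppers.mp (hp C hC)

/-- Both sides run over nested pairs `I ⊆ J` of upper sets of `B`, with `f` on `B \ J`, `g` on the
components of `J \ I` and `h` on those of `I`. On the left, `I` is chosen first and then the upper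
set `J \ I` of `B \ I`. -/
theorem sumSep_assoc (hB : IsNCFamily B) (f g h : Finset (Finset ℕ) → R) (hg : g ∅ = 1) :
    sumSep (sumSep f g) h B = sumSep f (sumSep g h) B := by
  classical
  have h1 : sumSep f (sumSep g h) B = ∑ J ∈ uppers B, ∑ I ∈ uppers B with I ⊆ J,
      f (B \ J) * ((∏ c ∈ comps (B \ I) (J \ I), g c) * ∏ c ∈ comps B I, h c) := by
    rw [sumSep]
    refine Finset.sum_congr rfl fun J hJ => ?_
    rw [prod_comps_sumSep hB (mem_uppers.mp hJ) g h hg, Finset.mul_sum]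
  rw [h1, Finset.sum_comm' (t' := uppers B) (s' := fun I => (uppers B).filter (I ⊆ ·))
    (by intro I J; simp only [Finset.mem_filter]; tauto), sumSep]
  refine Finset.sum_congr rfl fun I hI => ?_
  rw [mem_uppers] at hI
  rw [sumSep, Finset.sum_mul]
  refine Finset.sum_bij' (fun J _ => J ∪ I) (fun J _ => J \ I) ?_ ?_ ?_ ?_ ?_
  · intro J hJ
    rw [mem_uppers] at hJ
    have hd : (J ∪ I) \ I = J := by
      ext b
      have hsub := hJ.sub
      have := @hsub b
      simp only [Finset.mem_sdiff, Finset.mem_union] at this ⊢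
      tauto
    rw [Finset.mem_filter, mem_uppers]
    refine ⟨?_, Finset.subset_union_right⟩
    rw [← isUpper_sdiff_iff hI Finset.subset_union_right, hd]
    · exact hJ
    · exact Finset.union_subset (hJ.sub.trans Finset.sdiff_subset) hI.sub
  · intro J hJ
    rw [Finset.mem_filter, mem_uppers] at hJ
    exact mem_uppers.mpr ((isUpper_sdiff_iff hI hJ.2 hJ.1.sub).mpr hJ.1)
  · intro J hJ
    have := (mem_uppers.mp hJ).sub
    ext b
    have := @this b
    simp only [Finset.mem_sdiff, Finset.mem_union] at this ⊢
    tauto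
  · intro J hJ
    rw [Finset.mem_filter] at hJ
    exact Finset.sdiff_union_of_subset hJ.2
  · intro J hJ
    have hd : (J ∪ I) \ I = J := by
      have := (mem_uppers.mp hJ).sub
      ext b
      have := @this b
      simp only [Finset.mem_sdiff, Finset.mem_union] at this ⊢
      tauto
    rw [hd, mul_assoc, sdiff_sdiff, Finset.sup_eq_union, Finset.union_comm I J]

end Assoc

/-- The action of a function on families of blocks on another one along `δ`. -/
noncomputable def sumExt (f h : Finset (Finset ℕ) → R) (B : Finset (Finset ℕ)) : R :=
  ∑ P ∈ ncParts B, f (P.image support) * ∏ c ∈ P, h c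

/-! ### Splitting and gluing partitions of a set of blocks. -/

section Part

variable {α : Type*} [DecidableEq α] {B J : Finset α} {P Q : Finset (Finset α)}

theorem IsPart.of_subset (hP : IsPart B P) (hQ : Q ⊆ P) : IsPart (Q.biUnion id) Q where
  nonempty c hc := hP.nonempty c (hQ hc)
  sub c hc _ hb := Finset.mem_biUnion.mpr ⟨c, hc, hb⟩
  eq_of_mem c hc c' hc' := hP.eq_of_mem c (hQ hc) c' (hQ hc')
  exists_mem _ hb := Finset.mem_biUnion.mp hb

theorem IsPart.sdiff (hP : IsPart B P) (hQ : Q ⊆ P) : IsPart (B \ Q.biUnion id) (P \ Q) where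
  nonempty c hc := hP.nonempty c (Finset.mem_sdiff.mp hc).1
  sub c hc b hb := by
    rw [Finset.mem_sdiff] at hc ⊢
    refine ⟨hP.sub c hc.1 hb, fun h => ?_⟩
    obtain ⟨c', hc', hb'⟩ := Finset.mem_biUnion.mp h
    exact hc.2 (hP.eq_of_mem c hc.1 c' (hQ hc') b hb hb' ▸ hc')
  eq_of_mem c hc c' hc' :=
    hP.eq_of_mem c (Finset.mem_sdiff.mp hc).1 c' (Finset.mem_sdiff.mp hc').1
  exists_mem b hb := by
    rw [Finset.mem_sdiff] at hb
    obtain ⟨c, hc, hbc⟩ := hP.exists_mem b hb.1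
    exact ⟨c, Finset.mem_sdiff.mpr ⟨hc, fun h => hb.2 (Finset.mem_biUnion.mpr ⟨c, h, hbc⟩)⟩, hbc⟩

theorem IsPart.biUnion_eq (hQ : IsPart J Q) : Q.biUnion id = J := by
  ext b
  rw [Finset.mem_biUnion]
  exact ⟨fun ⟨c, hc, hb⟩ => hQ.sub c hc hb, hQ.exists_mem b⟩

theorem IsPart.disjoint_sdiff (hP : IsPart (B \ J) P) (hQ : IsPart J Q) : Disjoint P Q := by
  rw [Finset.disjoint_left]
  intro c hc hc'
  obtain ⟨b, hb⟩ := hP.nonempty c hc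
  exact (Finset.mem_sdiff.mp (hP.sub c hc hb)).2 (hQ.sub c hc' hb)

theorem IsPart.union (hJ : J ⊆ B) (hP : IsPart (B \ J) P) (hQ : IsPart J Q) :
    IsPart B (P ∪ Q) where
  nonempty c hc := (Finset.mem_union.mp hc).elim (hP.nonempty c) (hQ.nonempty c)
  sub c hc := (Finset.mem_union.mp hc).elim
    (fun h => (hP.sub c h).trans Finset.sdiff_subset) (fun h => (hQ.sub c h).trans hJ)
  eq_of_mem c hc c' hc' b hb hb' := by
    rcases Finset.mem_union.mp hc with h | h <;> rcases Finset.mem_union.mp hc' with h' | h'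
    · exact hP.eq_of_mem c h c' h' b hb hb'
    · exact absurd (hQ.sub c' h' hb') (Finset.mem_sdiff.mp (hP.sub c h hb)).2
    · exact absurd (hQ.sub c h hb) (Finset.mem_sdiff.mp (hP.sub c' h' hb')).2
    · exact hQ.eq_of_mem c h c' h' b hb hb'
  exists_mem b hb := by
    by_cases hbJ : b ∈ J
    · obtain ⟨c, hc, h⟩ := hQ.exists_mem b hbJ
      exact ⟨c, Finset.mem_union_right _ hc, h⟩
    · obtain ⟨c, hc, h⟩ := hP.exists_mem b (Finset.mem_sdiff.mpr ⟨hb, hbJ⟩)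
      exact ⟨c, Finset.mem_union_left _ hc, h⟩

end Part

/-! ### Cointeraction of `Δ` and `δ` on families of blocks. -/

section Cointeraction

variable {B J : Finset (Finset ℕ)} {P Q : Finset (Finset (Finset ℕ))}

theorem NonCrossing.mono {B B' : Finset (Finset ℕ)} (h : NonCrossing B) (hB : B' ⊆ B) :
    NonCrossing B' :=
  fun b hb b' hb' => h b (hB hb) b' (hB hb')

theorem IsPart.eq_of_mem_support (hB : IsNCFamily B) (hP : IsPart B P) {c c' : Finset (Finset ℕ)}
    (hc : c ∈ P) (hc' : c' ∈ P) {x : ℕ} (hx : x ∈ support c) (hx' : x ∈ support c') : c = c' := by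
  obtain ⟨b, hb, hxb⟩ := mem_support.mp hx
  obtain ⟨b', hb', hxb'⟩ := mem_support.mp hx'
  have := hB.eq_of_mem (hP.sub c hc hb) (hP.sub c' hc' hb') hxb hxb'
  subst this
  exact hP.eq_of_mem c hc c' hc' b hb hb'

theorem IsPart.support_nonempty (hB : IsNCFamily B) (hP : IsPart B P) {c : Finset (Finset ℕ)}
    (hc : c ∈ P) : (support c).Nonempty := by
  obtain ⟨b, hb⟩ := hP.nonempty c hc
  exact (hB.nonempty (hP.sub c hc hb)).mono (subset_support hb)

theorem IsPart.support_injOn (hB : IsNCFamily B) (hP : IsPart B P) {c c' : Finset (Finset ℕ)}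
    (hc : c ∈ P) (hc' : c' ∈ P) (h : support c = support c') : c = c' := by
  obtain ⟨x, hx⟩ := hP.support_nonempty hB hc
  exact hP.eq_of_mem_support hB hc hc' hx (h ▸ hx)

theorem IsPart.support_mem_image (hB : IsNCFamily B) (hP : IsPart B P) (hQ : Q ⊆ P)
    {c : Finset (Finset ℕ)} (hc : c ∈ P) : support c ∈ Q.image support ↔ c ∈ Q := by
  rw [Finset.mem_image]
  constructor
  · rintro ⟨c', hc', h⟩
    exact hP.support_injOn hB (hQ hc') hc h ▸ hc'
  · exact fun h => ⟨c, h, rfl⟩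

theorem IsPart.isNCFamily (hB : IsNCFamily B) (hP : IsPart B P)
    (hnc : NonCrossing (P.image support)) : IsNCFamily (P.image support) where
  empty_notMem h := by
    obtain ⟨c, hc, h⟩ := Finset.mem_image.mp h
    exact (hP.support_nonempty hB hc).ne_empty h
  disjoint b hb b' hb' hne := by
    obtain ⟨c, hc, rfl⟩ := Finset.mem_image.mp hb
    obtain ⟨c', hc', rfl⟩ := Finset.mem_image.mp hb'
    rw [Finset.disjoint_left]
    intro x hx hx'
    exact hne (congrArg support (hP.eq_of_mem_support hB hc hc' hx hx'))
  nonCrossing := hnc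

theorem IsPart.image_sdiff (hB : IsNCFamily B) (hP : IsPart B P) (hQ : Q ⊆ P) :
    P.image support \ Q.image support = (P \ Q).image support := by
  ext b
  simp only [Finset.mem_sdiff, Finset.mem_image]
  constructor
  · rintro ⟨⟨c, hc, rfl⟩, h⟩
    exact ⟨c, ⟨hc, fun h' => h ⟨c, h', rfl⟩⟩, rfl⟩
  · rintro ⟨c, ⟨hc, h⟩, rfl⟩
    refine ⟨⟨c, hc, rfl⟩, fun ⟨c', hc', h'⟩ => h ?_⟩
    exact hP.support_injOn hB (hQ hc') hc h' ▸ hc'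

theorem IsPart.conn_of_conn_support (hB : IsNCFamily B) (hP : IsPart B P) (hQ : Q ⊆ P)
    {c c' : Finset (Finset ℕ)} {b b' : Finset ℕ} (hb : b ∈ c) (hb' : b' ∈ c')
    (h : Conn (P.image support) (Q.image support) (support c) (support c')) :
    Conn B (Q.biUnion id) b b' := by
  have hsub : b ∪ b' ⊆ support c ∪ support c' :=
    Finset.union_subset_union (subset_support hb) (subset_support hb')
  intro x hx z hz d hd y hy hxy hyz
  obtain ⟨e, he, hde⟩ := hP.exists_mem d hd
  have := h x (hsub hx) z (hsub hz) (support e) (Finset.mem_image_of_mem _ he) y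
    (subset_support hde hy) hxy hyz
  rw [hP.support_mem_image hB hQ he] at this
  exact Finset.mem_biUnion.mpr ⟨e, this, hde⟩

/-- A hull in the contraction is spanned by elements of arbitrary blocks of `c` and `c'`. By `hQc`
all these blocks are connected to `b`, so a class meeting the hull has a block in the union of `Q`.
-/
theorem IsPart.conn_support (hB : IsNCFamily B) (hP : IsPart B P) (hQ : Q ⊆ P)
    (hQc : ∀ c ∈ Q, ∀ b ∈ c, ∀ b' ∈ c, Conn B (Q.biUnion id) b b')
    {c c' : Finset (Finset ℕ)} (hc : c ∈ Q) (hc' : c' ∈ Q) {b b' : Finset ℕ} (hb : b ∈ c)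
    (hb' : b' ∈ c') (h : Conn B (Q.biUnion id) b b') :
    Conn (P.image support) (Q.image support) (support c) (support c') := by
  have hall : ∀ x ∈ support c ∪ support c', ∃ e, e ∈ B ∧ x ∈ e ∧ Conn B (Q.biUnion id) b e := by
    intro x hx
    rcases Finset.mem_union.mp hx with hx | hx
    · obtain ⟨e, he, hxe⟩ := mem_support.mp hx
      exact ⟨e, hP.sub c (hQ hc) he, hxe, hQc c hc b hb e he⟩
    · obtain ⟨e, he, hxe⟩ := mem_support.mp hx
      exact ⟨e, hP.sub c' (hQ hc') he, hxe,
        h.trans hB (hP.sub c' (hQ hc') hb') (hQc c' hc' b' hb' e he)⟩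
  intro x hx z hz d hd y hy hxy hyz
  obtain ⟨e, he, rfl⟩ := Finset.mem_image.mp hd
  obtain ⟨u, huB, hxu, hu⟩ := hall x hx
  obtain ⟨v, hvB, hzv, hv⟩ := hall z hz
  obtain ⟨w, hw, hyw⟩ := mem_support.mp hy
  have huv : Conn B (Q.biUnion id) u v :=
    hu.symm.trans hB (hP.sub c (hQ hc) hb) hv
  have hwJ := huv x (Finset.mem_union_left _ hxu) z (Finset.mem_union_right _ hzv) w
    (hP.sub e he hw) y hyw hxy hyz
  obtain ⟨e', he', hwe'⟩ := Finset.mem_biUnion.mp hwJ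
  exact Finset.mem_image_of_mem _ (hP.eq_of_mem e he e' (hQ he') w hw hwe' ▸ he')

/-- An ideal of the contraction amounts to an ideal of `B` together with a partition of it whose
classes each stay inside one component. -/
theorem IsPart.isUpper_image_iff (hB : IsNCFamily B) (hP : IsPart B P) (hQ : Q ⊆ P) :
    IsUpper (P.image support) (Q.image support) ↔ IsUpper B (Q.biUnion id) ∧
      ∀ c ∈ Q, ∀ b ∈ c, ∀ b' ∈ c, Conn B (Q.biUnion id) b b' := by
  constructor
  · intro h
    have hQc : ∀ c ∈ Q, ∀ b ∈ c, ∀ b' ∈ c, Conn B (Q.biUnion id) b b' := fun c hc b hb b' hb' =>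
      hP.conn_of_conn_support hB hQ hb hb' (h.conn _ (Finset.mem_image_of_mem _ hc))
    refine ⟨⟨?_, fun b hb => ?_⟩, hQc⟩
    · exact Finset.biUnion_subset.mpr fun c hc => hP.sub c (hQ hc)
    · obtain ⟨c, hc, hbc⟩ := Finset.mem_biUnion.mp hb
      exact hQc c hc b hbc b hbc
  · rintro ⟨_, hQc⟩
    refine ⟨Finset.image_subset_image hQ, fun D hD => ?_⟩
    obtain ⟨c, hc, rfl⟩ := Finset.mem_image.mp hD
    obtain ⟨b, hb⟩ := hP.nonempty c (hQ hc)
    exact hP.conn_support hB hQ hQc hc hc hb hb (hQc c hc b hb b hb)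

theorem IsPart.subset_comp_iff (hB : IsNCFamily B) (hP : IsPart B P) (hQ : Q ⊆ P)
    (hJ : IsUpper B (Q.biUnion id))
    (hQc : ∀ c ∈ Q, ∀ b ∈ c, ∀ b' ∈ c, Conn B (Q.biUnion id) b b')
    {C : Finset (Finset ℕ)} (hC : C ∈ comps B (Q.biUnion id)) {c c' : Finset (Finset ℕ)}
    (hc : c ∈ Q) (hc' : c' ∈ Q) (hcC : c ⊆ C) :
    c' ⊆ C ↔ Conn (P.image support) (Q.image support) (support c) (support c') := by
  obtain ⟨b, hb⟩ := hP.nonempty c (hQ hc)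
  constructor
  · intro h
    obtain ⟨b', hb'⟩ := hP.nonempty c' (hQ hc')
    exact hP.conn_support hB hQ hQc hc hc' hb hb' ((hJ.mem_comps hB hC (hcC hb) b').mp (h hb')).2
  · intro h b' hb'
    exact (hJ.mem_comps hB hC (hcC hb) b').mpr
      ⟨Finset.mem_biUnion.mpr ⟨c', hc', hb'⟩, hP.conn_of_conn_support hB hQ hb hb' h⟩

/-- A class with connected elements that meets a component is contained in it. -/
theorem subset_comp_of_mem (hB : IsNCFamily B) (hJ : IsUpper B J) (hQ : IsPart J Q)
    (hQc : ∀ c ∈ Q, ∀ b ∈ c, ∀ b' ∈ c, Conn B J b b') {C : Finset (Finset ℕ)}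
    (hC : C ∈ comps B J) {c : Finset (Finset ℕ)} (hc : c ∈ Q) {b : Finset ℕ} (hb : b ∈ c)
    (hbC : b ∈ C) : c ⊆ C := fun b' hb' =>
  (hJ.mem_comps hB hC hbC b').mpr ⟨hQ.sub c hc hb', hQc c hc b hb b' hb'⟩

/-- Contraction preserves components: `C` corresponds to the set of merged blocks whose classes lie
in `C`. -/
theorem IsPart.prod_comps_image (hB : IsNCFamily B) (hP : IsPart B P)
    (hnc : NonCrossing (P.image support)) (hQ : Q ⊆ P)
    (hU : IsUpper (P.image support) (Q.image support)) (g : Finset (Finset ℕ) → R) :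
    ∏ D ∈ comps (P.image support) (Q.image support), g D =
      ∏ C ∈ comps B (Q.biUnion id), g ((Q.filter (· ⊆ C)).image support) := by
  obtain ⟨hJ, hQc⟩ := (hP.isUpper_image_iff hB hQ).mp hU
  have hQJ := hP.of_subset hQ
  have hcls : ∀ C ∈ comps B (Q.biUnion id), ∀ c ∈ Q, c ⊆ C →
      (Q.filter (· ⊆ C)).image support ∈ comps (P.image support) (Q.image support) := by
    intro C hC c hc hcC
    refine mem_classes_iff.mpr ⟨support c, Finset.mem_image_of_mem _ hc, fun D => ?_⟩
    simp only [Finset.mem_image, Finset.mem_filter]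
    constructor
    · rintro ⟨c', ⟨hc', h⟩, rfl⟩
      exact ⟨⟨c', hc', rfl⟩, (hP.subset_comp_iff hB hQ hJ hQc hC hc hc' hcC).mp h⟩
    · rintro ⟨⟨c', hc', rfl⟩, h⟩
      exact ⟨c', ⟨hc', (hP.subset_comp_iff hB hQ hJ hQc hC hc hc' hcC).mpr h⟩, rfl⟩
  have hex : ∀ C ∈ comps B (Q.biUnion id), ∃ c ∈ Q, c ⊆ C := by
    intro C hC
    obtain ⟨b, hb⟩ := (hJ.isPart hB).nonempty C hC
    obtain ⟨c, hc, hbc⟩ := hQJ.exists_mem b ((hJ.isPart hB).sub C hC hb)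
    exact ⟨c, hc, subset_comp_of_mem hB hJ hQJ hQc hC hc hbc hb⟩
  symm
  refine Finset.prod_bij (fun C _ => (Q.filter (· ⊆ C)).image support) ?_ ?_ ?_ ?_
  · intro C hC
    obtain ⟨c, hc, hcC⟩ := hex C hC
    exact hcls C hC c hc hcC
  · intro C hC C' hC' h
    obtain ⟨c, hc, hcC⟩ := hex C hC
    have hmem : support c ∈ (Q.filter (· ⊆ C)).image support :=
      Finset.mem_image_of_mem _ (Finset.mem_filter.mpr ⟨hc, hcC⟩)
    rw [h, hP.support_mem_image hB ((Finset.filter_subset _ _).trans hQ) (hQ hc),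
      Finset.mem_filter] at hmem
    obtain ⟨b, hb⟩ := hP.nonempty c (hQ hc)
    exact (hJ.isPart hB).eq_of_mem C hC C' hC' b (hcC hb) (hmem.2 hb)
  · intro D hD
    have hNP := hP.isNCFamily hB hnc
    obtain ⟨s, hs⟩ := (hU.isPart hNP).nonempty D hD
    obtain ⟨c, hc, rfl⟩ := Finset.mem_image.mp ((hU.isPart hNP).sub D hD hs)
    obtain ⟨b, hb⟩ := hP.nonempty c (hQ hc)
    obtain ⟨C, hC, hbC⟩ := (hJ.isPart hB).exists_mem b (Finset.mem_biUnion.mpr ⟨c, hc, hb⟩)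
    have hcC := subset_comp_of_mem hB hJ hQJ hQc hC hc hb hbC
    exact ⟨C, hC, (hU.isPart hNP).eq_of_mem _ (hcls C hC c hc hcC) D hD (support c)
      (Finset.mem_image_of_mem _ (Finset.mem_filter.mpr ⟨hc, hcC⟩)) hs⟩
  · intro C _
    rfl

open Classical in
/-- The partitions of `J` into classes that are contained in the components of `J`, with
noncrossing contraction in each component. -/
noncomputable def localParts (B J : Finset (Finset ℕ)) : Finset (Finset (Finset (Finset ℕ))) :=
  J.powerset.powerset.filter fun Q => IsPart J Q ∧ (∀ c ∈ Q, ∃ C ∈ comps B J, c ⊆ C) ∧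
    ∀ C ∈ comps B J, NonCrossing ((Q.filter (· ⊆ C)).image support)

theorem mem_localParts : Q ∈ localParts B J ↔ IsPart J Q ∧ (∀ c ∈ Q, ∃ C ∈ comps B J, c ⊆ C) ∧
    ∀ C ∈ comps B J, NonCrossing ((Q.filter (· ⊆ C)).image support) := by
  simp only [localParts, Finset.mem_filter, Finset.mem_powerset, and_iff_right_iff_imp]
  exact fun h c hc => Finset.mem_powerset.mpr (h.1.sub c hc)

/-- Choosing a contractible partition of every component is choosing one element of `localParts B
J`, by taking the union of the choices. -/
theorem prod_comps_sumExt (hB : IsNCFamily B) (hJ : IsUpper B J) (g h : Finset (Finset ℕ) → R) :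
    ∏ C ∈ comps B J, sumExt g h C = ∑ Q ∈ localParts B J,
      (∏ C ∈ comps B J, g ((Q.filter (· ⊆ C)).image support)) * ∏ c ∈ Q, h c := by
  classical
  have hpart := hJ.isPart hB
  unfold sumExt
  rw [prod_sum_eq_sum_prod (T := localParts B J) (fun C Q => Q.filter (· ⊆ C))
    (fun C Q => g (Q.image support) * ∏ c ∈ Q, h c)]
  · refine Finset.sum_congr rfl fun Q hQ => ?_
    rw [mem_localParts] at hQ
    rw [Finset.prod_mul_distrib, ← Finset.prod_biUnion]
    · congr 1
      refine Finset.prod_congr ?_ fun _ _ => rfl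
      ext c
      simp only [Finset.mem_biUnion, Finset.mem_filter]
      constructor
      · rintro ⟨C, _, hc, _⟩
        exact hc
      · intro hc
        obtain ⟨C, hC, hcC⟩ := hQ.2.1 c hc
        exact ⟨C, hC, hc, hcC⟩
    · intro C hC C' hC' hne
      simp only [Function.onFun]
      rw [Finset.disjoint_left]
      intro c hc hc'
      rw [Finset.mem_filter] at hc hc'
      obtain ⟨b, hb⟩ := hQ.1.nonempty c hc.1
      exact hne (hpart.eq_of_mem C hC C' hC' b (hc.2 hb) (hc'.2 hb))
  · intro Q hQ C hC
    rw [mem_localParts] at hQ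
    refine mem_ncParts.mpr ⟨⟨?_, ?_, ?_, ?_⟩, hQ.2.2 C hC⟩
    · exact fun c hc => hQ.1.nonempty c (Finset.mem_filter.mp hc).1
    · exact fun c hc => (Finset.mem_filter.mp hc).2
    · exact fun c hc c' hc' => hQ.1.eq_of_mem c (Finset.mem_filter.mp hc).1 c'
        (Finset.mem_filter.mp hc').1
    · intro b hb
      obtain ⟨c, hc, hbc⟩ := hQ.1.exists_mem b (hpart.sub C hC hb)
      obtain ⟨C', hC', hcC'⟩ := hQ.2.1 c hc
      have := hpart.eq_of_mem C hC C' hC' b hb (hcC' hbc)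
      subst this
      exact ⟨c, Finset.mem_filter.mpr ⟨hc, hcC'⟩, hbc⟩
  · have key : ∀ Q ∈ localParts B J, ∀ Q' ∈ localParts B J,
        (∀ C ∈ comps B J, Q.filter (· ⊆ C) = Q'.filter (· ⊆ C)) → Q ⊆ Q' := by
      intro Q hQ Q' _ heq c hc
      rw [mem_localParts] at hQ
      obtain ⟨C, hC, hcC⟩ := hQ.2.1 c hc
      have : c ∈ Q.filter (· ⊆ C) := Finset.mem_filter.mpr ⟨hc, hcC⟩
      rw [heq C hC] at this
      exact (Finset.mem_filter.mp this).1
    intro Q hQ Q' hQ' heq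
    exact (key Q hQ Q' hQ' heq).antisymm (key Q' hQ' Q hQ fun C hC => (heq C hC).symm)
  · intro p hp
    have hp' := fun C hC => mem_ncParts.mp (hp C hC)
    set Q : Finset (Finset (Finset ℕ)) := J.powerset.filter fun c => ∃ C hC, c ∈ p C hC with hQ
    have hmem : ∀ c, c ∈ Q ↔ ∃ C hC, c ∈ p C hC := by
      intro c
      rw [hQ, Finset.mem_filter, Finset.mem_powerset, and_iff_right_iff_imp]
      rintro ⟨C, hC, hc⟩
      exact ((hp' C hC).1.sub c hc).trans (hpart.sub C hC)
    have key : ∀ C hC, Q.filter (· ⊆ C) = p C hC := by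
      intro C hC
      ext c
      rw [Finset.mem_filter, hmem]
      constructor
      · rintro ⟨⟨C', hC', hc⟩, hcC⟩
        obtain ⟨b, hb⟩ := (hp' C' hC').1.nonempty c hc
        have := hpart.eq_of_mem C' hC' C hC b ((hp' C' hC').1.sub c hc hb) (hcC hb)
        subst this
        exact hc
      · intro hc
        exact ⟨⟨C, hC, hc⟩, (hp' C hC).1.sub c hc⟩
    refine ⟨Q, mem_localParts.mpr ⟨⟨?_, ?_, ?_, ?_⟩, ?_, ?_⟩, key⟩
    · intro c hc
      obtain ⟨C, hC, hc⟩ := (hmem c).mp hc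
      exact (hp' C hC).1.nonempty c hc
    · intro c hc
      obtain ⟨C, hC, hc⟩ := (hmem c).mp hc
      exact ((hp' C hC).1.sub c hc).trans (hpart.sub C hC)
    · intro c hc c' hc' b hb hb'
      obtain ⟨C, hC, hc⟩ := (hmem c).mp hc
      obtain ⟨C', hC', hc'⟩ := (hmem c').mp hc'
      have := hpart.eq_of_mem C hC C' hC' b ((hp' C hC).1.sub c hc hb)
        ((hp' C' hC').1.sub c' hc' hb')
      subst this
      exact (hp' C hC).1.eq_of_mem c hc c' hc' b hb hb'
    · intro b hb
      obtain ⟨C, hC, hbC⟩ := hpart.exists_mem b hb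
      obtain ⟨c, hc, hbc⟩ := (hp' C hC).1.exists_mem b hbC
      exact ⟨c, (hmem c).mpr ⟨C, hC, hc⟩, hbc⟩
    · intro c hc
      obtain ⟨C, hC, hc⟩ := (hmem c).mp hc
      exact ⟨C, hC, (hp' C hC).1.sub c hc⟩
    · intro C hC
      rw [key C hC]
      exact (hp' C hC).2

/-- In a crossing, each class has an element inside the hull of the other. If one class is in `Q`,
its hull meets only blocks of its component, so the other class lies in the same component;
otherwise both classes are in `P`. Either case is excluded by hypothesis. -/
theorem nonCrossing_image_union (hB : IsNCFamily B) (hJ : IsUpper B J) (hP : IsPart (B \ J) P)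
    (hPn : NonCrossing (P.image support)) (hQ : Q ∈ localParts B J) :
    NonCrossing ((P ∪ Q).image support) := by
  obtain ⟨hQJ, hQC, hQn⟩ := mem_localParts.mp hQ
  have hU := IsPart.union hJ.sub hP hQJ
  have hpart := hJ.isPart hB
  have key : ∀ c ∈ Q, ∀ c' ∈ P ∪ Q, ∀ x ∈ support c, ∀ z ∈ support c, ∀ y ∈ support c',
      x ≤ y → y ≤ z → c' ∈ Q ∧ ∃ C ∈ comps B J, c ⊆ C ∧ c' ⊆ C := by
    intro c hc c' hc' x hx z hz y hy hxy hyz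
    obtain ⟨C, hC, hcC⟩ := hQC c hc
    obtain ⟨b, hb, hxb⟩ := mem_support.mp hx
    obtain ⟨b', hb', hzb⟩ := mem_support.mp hz
    obtain ⟨d, hd, hyd⟩ := mem_support.mp hy
    have hdC := hJ.mem_comp_of_between hB hC (hcC hb) (hcC hb') (hU.sub c' hc' hd)
      (Finset.mem_union_left _ hxb) (Finset.mem_union_right _ hzb) hyd hxy hyz
    obtain ⟨e, he, hde⟩ := hQJ.exists_mem d (hpart.sub C hC hdC)
    have := hU.eq_of_mem c' hc' e (Finset.mem_union_right _ he) d hd hde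
    subst this
    obtain ⟨C', hC', hcC'⟩ := hQC c' he
    have := hpart.eq_of_mem C hC C' hC' d hdC (hcC' hd)
    subst this
    exact ⟨he, C, hC, hcC, hcC'⟩
  intro s hs s' hs' hne x hx z hz y hy t ht hlt
  obtain ⟨c, hc, rfl⟩ := Finset.mem_image.mp hs
  obtain ⟨c', hc', rfl⟩ := Finset.mem_image.mp hs'
  have hfin : ∀ C ∈ comps B J, c ∈ Q → c' ∈ Q → c ⊆ C → c' ⊆ C → False := by
    intro C hC hcQ hcQ' hcC hcC'
    exact hQn C hC (support c) (Finset.mem_image_of_mem _ (Finset.mem_filter.mpr ⟨hcQ, hcC⟩))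
      (support c') (Finset.mem_image_of_mem _ (Finset.mem_filter.mpr ⟨hcQ', hcC'⟩)) hne x hx z hz
      y hy t ht hlt
  by_cases h1 : c ∈ Q
  · obtain ⟨h2, C, hC, h3, h4⟩ := key c h1 c' hc' x hx z hz y hy hlt.1.le hlt.2.1.le
    exact hfin C hC h1 h2 h3 h4
  by_cases h2 : c' ∈ Q
  · obtain ⟨h1, C, hC, h3, h4⟩ := key c' h2 c hc y hy t ht z hz hlt.2.1.le hlt.2.2.le
    exact hfin C hC h1 h2 h4 h3
  · exact hPn _ (Finset.mem_image_of_mem _ ((Finset.mem_union.mp hc).resolve_right h1)) _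
      (Finset.mem_image_of_mem _ ((Finset.mem_union.mp hc').resolve_right h2)) hne x hx z hz
      y hy t ht hlt

/-- Distinct classes have distinct unions, so an upper set of the contraction comes from a unique
set `Q` of classes. -/
theorem sumSep_image_support (hB : IsNCFamily B) (hP : IsPart B P)
    (hnc : NonCrossing (P.image support)) (f g : Finset (Finset ℕ) → R) :
    sumSep f g (P.image support) =
      ∑ Q ∈ P.powerset with Q.image support ∈ uppers (P.image support),
        f ((P \ Q).image support) *
          ∏ C ∈ comps B (Q.biUnion id), g ((Q.filter (· ⊆ C)).image support) := by
  rw [sumSep]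
  symm
  refine Finset.sum_bij (fun Q _ => Q.image support) ?_ ?_ ?_ ?_
  · intro Q hQ
    exact (Finset.mem_filter.mp hQ).2
  · intro Q hQ Q' hQ' h
    rw [Finset.mem_filter, Finset.mem_powerset] at hQ hQ'
    ext c
    constructor
    · intro hc
      rw [← hP.support_mem_image hB hQ'.1 (hQ.1 hc), ← h]
      exact Finset.mem_image_of_mem _ hc
    · intro hc
      rw [← hP.support_mem_image hB hQ.1 (hQ'.1 hc), h]
      exact Finset.mem_image_of_mem _ hc
  · intro I hI
    obtain ⟨Q, hQ, rfl⟩ := Finset.subset_image_iff.mp (mem_uppers.mp hI).sub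
    exact ⟨Q, Finset.mem_filter.mpr ⟨Finset.mem_powerset.mpr hQ, hI⟩, rfl⟩
  · intro Q hQ
    rw [Finset.mem_filter, Finset.mem_powerset, mem_uppers] at hQ
    rw [hP.image_sdiff hB hQ.1, hP.prod_comps_image hB hnc hQ.1 hQ.2]

/-- On the left one contracts by `P` and then picks a set `Q` of classes forming an ideal; on the
right one picks the ideal `J` and then partitions its complement and its components. The
correspondence takes `J` to be the union of `Q` and splits `P` into `P \ Q` and `Q`. -/
theorem sumExt_sumSep (hB : IsNCFamily B) (f g h : Finset (Finset ℕ) → R) :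
    sumExt (sumSep f g) h B = sumSep (sumExt f h) (sumExt g h) B := by
  have h1 : sumExt (sumSep f g) h B = ∑ P ∈ ncParts B,
      ∑ Q ∈ P.powerset with Q.image support ∈ uppers (P.image support),
        f ((P \ Q).image support) *
          (∏ C ∈ comps B (Q.biUnion id), g ((Q.filter (· ⊆ C)).image support)) * ∏ c ∈ P, h c := by
    rw [sumExt]
    refine Finset.sum_congr rfl fun P hP => ?_
    rw [mem_ncParts] at hP
    rw [sumSep_image_support hB hP.1 hP.2, Finset.sum_mul]
  have h2 : sumSep (sumExt f h) (sumExt g h) B = ∑ J ∈ uppers B, ∑ p ∈ ncParts (B \ J) ×ˢ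
      localParts B J, (f (p.1.image support) * ∏ c ∈ p.1, h c) *
        ((∏ C ∈ comps B J, g ((p.2.filter (· ⊆ C)).image support)) * ∏ c ∈ p.2, h c) := by
    rw [sumSep]
    refine Finset.sum_congr rfl fun J hJ => ?_
    rw [prod_comps_sumExt hB (mem_uppers.mp hJ), sumExt, Finset.sum_mul_sum, Finset.sum_product]
  rw [h1, h2, Finset.sum_sigma', Finset.sum_sigma']
  refine Finset.sum_bij' (fun x _ => ⟨x.2.biUnion id, (x.1 \ x.2, x.2)⟩)
    (fun x _ => ⟨x.2.1 ∪ x.2.2, x.2.2⟩) ?_ ?_ ?_ ?_ ?_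
  · rintro ⟨P, Q⟩ hx
    simp only [Finset.mem_sigma, Finset.mem_filter, Finset.mem_powerset, mem_uppers, mem_ncParts,
      Finset.mem_product, mem_localParts] at hx ⊢
    obtain ⟨⟨hP, hnc⟩, hQ, hU⟩ := hx
    obtain ⟨hJ, hQc⟩ := (hP.isUpper_image_iff hB hQ).mp hU
    refine ⟨hJ, ⟨hP.sdiff hQ, hnc.mono (Finset.image_subset_image Finset.sdiff_subset)⟩,
      hP.of_subset hQ, fun c hc => ?_, fun C _ =>
        hnc.mono (Finset.image_subset_image ((Finset.filter_subset _ _).trans hQ))⟩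
    obtain ⟨b, hb⟩ := hP.nonempty c (hQ hc)
    obtain ⟨C, hC, hbC⟩ := (hJ.isPart hB).exists_mem b (Finset.mem_biUnion.mpr ⟨c, hc, hb⟩)
    exact ⟨C, hC, subset_comp_of_mem hB hJ (hP.of_subset hQ) hQc hC hc hb hbC⟩
  · rintro ⟨J, P, Q⟩ hx
    simp only [Finset.mem_sigma, Finset.mem_filter, Finset.mem_powerset, mem_uppers, mem_ncParts,
      Finset.mem_product] at hx ⊢
    obtain ⟨hJ, ⟨hP, hPn⟩, hQ⟩ := hx
    have hQ' := mem_localParts.mp hQ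
    have hU := IsPart.union hJ.sub hP hQ'.1
    refine ⟨⟨hU, nonCrossing_image_union hB hJ hP hPn hQ⟩, Finset.subset_union_right, ?_⟩
    rw [hU.isUpper_image_iff hB Finset.subset_union_right, hQ'.1.biUnion_eq]
    refine ⟨hJ, fun c hc b hb b' hb' => ?_⟩
    obtain ⟨C, hC, hcC⟩ := hQ'.2.1 c hc
    exact ((hJ.mem_comps hB hC (hcC hb) b').mp (hcC hb')).2
  · rintro ⟨P, Q⟩ hx
    simp only [Finset.mem_sigma, Finset.mem_filter, Finset.mem_powerset] at hx
    simp only [Finset.sdiff_union_of_subset hx.2.1]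
  · rintro ⟨J, P, Q⟩ hx
    simp only [Finset.mem_sigma, mem_ncParts, Finset.mem_product, mem_localParts] at hx
    obtain ⟨hJ, ⟨hP, hPn⟩, hQ, -⟩ := hx
    simp only [hQ.biUnion_eq, Finset.union_sdiff_cancel_right (hP.disjoint_sdiff hQ)]
  · rintro ⟨P, Q⟩ hx
    simp only [Finset.mem_sigma, Finset.mem_filter, Finset.mem_powerset] at hx
    simp only
    rw [← Finset.prod_sdiff hx.2.1]
    ring

end Cointeraction

/-! ## Relabelling -/

/-- The map on blocks induced by an increasing map. -/
def blockMap (e : ℕ ↪o ℕ) : Finset ℕ ↪ Finset ℕ := (Finset.mapEmbedding e.toEmbedding).toEmbedding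

/-- The map on families of blocks induced by an increasing map. -/
def famMap (e : ℕ ↪o ℕ) : Finset (Finset ℕ) ↪ Finset (Finset ℕ) :=
  (Finset.mapEmbedding (blockMap e)).toEmbedding

/-- The map on families of classes induced by an increasing map. -/
def clsMap (e : ℕ ↪o ℕ) : Finset (Finset (Finset ℕ)) ↪ Finset (Finset (Finset ℕ)) :=
  (Finset.mapEmbedding (famMap e)).toEmbedding

theorem blockMap_apply (e : ℕ ↪o ℕ) (b : Finset ℕ) : blockMap e b = b.map e.toEmbedding := rfl

theorem famMap_apply (e : ℕ ↪o ℕ) (B : Finset (Finset ℕ)) : famMap e B = B.map (blockMap e) := rfl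

theorem clsMap_apply (e : ℕ ↪o ℕ) (P : Finset (Finset (Finset ℕ))) :
    clsMap e P = P.map (famMap e) := rfl

theorem mem_blockMap {e : ℕ ↪o ℕ} {b : Finset ℕ} {y : ℕ} :
    y ∈ blockMap e b ↔ ∃ x ∈ b, e x = y := by
  rw [blockMap_apply, Finset.mem_map]
  rfl

theorem mem_famMap {e : ℕ ↪o ℕ} {B : Finset (Finset ℕ)} {c : Finset ℕ} :
    c ∈ famMap e B ↔ ∃ b ∈ B, blockMap e b = c := Finset.mem_map

theorem mem_clsMap {e : ℕ ↪o ℕ} {P : Finset (Finset (Finset ℕ))} {C : Finset (Finset ℕ)} :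
    C ∈ clsMap e P ↔ ∃ c ∈ P, famMap e c = C := Finset.mem_map

theorem classes_map {α β : Type*} [DecidableEq α] [DecidableEq β] (f : α ↪ β) {J : Finset α}
    {r : α → α → Prop} {r' : β → β → Prop} (h : ∀ a ∈ J, ∀ b ∈ J, r' (f a) (f b) ↔ r a b) :
    classes (J.map f) r' = (classes J r).map (Finset.mapEmbedding f).toEmbedding := by
  ext c
  rw [mem_classes_iff, Finset.mem_map]
  constructor
  · rintro ⟨x, hx, hc⟩
    obtain ⟨a, ha, rfl⟩ := Finset.mem_map.mp hx
    classical
    refine ⟨J.filter (r a), mem_classes_iff.mpr ⟨a, ha, fun b => by simp⟩, ?_⟩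
    ext y
    change y ∈ (J.filter (r a)).map f ↔ _
    rw [hc, Finset.mem_map, Finset.mem_map]
    constructor
    · rintro ⟨b, hb, rfl⟩
      rw [Finset.mem_filter] at hb
      exact ⟨⟨b, hb.1, rfl⟩, (h a ha b hb.1).mpr hb.2⟩
    · rintro ⟨⟨b, hb, rfl⟩, hr⟩
      exact ⟨b, Finset.mem_filter.mpr ⟨hb, (h a ha b hb).mp hr⟩, rfl⟩
  · rintro ⟨C, hC, rfl⟩
    obtain ⟨a, ha, hC⟩ := mem_classes_iff.mp hC
    refine ⟨f a, Finset.mem_map_of_mem f ha, fun y => ?_⟩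
    change y ∈ C.map f ↔ _
    rw [Finset.mem_map, Finset.mem_map]
    constructor
    · rintro ⟨b, hb, rfl⟩
      rw [hC] at hb
      exact ⟨⟨b, hb.1, rfl⟩, (h a ha b hb.1).mpr hb.2⟩
    · rintro ⟨⟨b, hb, rfl⟩, hr⟩
      exact ⟨b, (hC b).mpr ⟨hb, (h a ha b hb).mp hr⟩, rfl⟩

section Relabel

variable (e : ℕ ↪o ℕ) {B J : Finset (Finset ℕ)} {P : Finset (Finset (Finset ℕ))}

theorem conn_famMap {b b' : Finset ℕ} :
    Conn (famMap e B) (famMap e J) (blockMap e b) (blockMap e b') ↔ Conn B J b b' := by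
  have hu : ∀ y, y ∈ blockMap e b ∪ blockMap e b' ↔ ∃ x ∈ b ∪ b', e x = y := by
    intro y
    simp only [Finset.mem_union, mem_blockMap, or_and_right, exists_or]
  constructor
  · intro h x hx z hz d hd y hy hxy hyz
    have := h (e x) ((hu _).mpr ⟨x, hx, rfl⟩) (e z) ((hu _).mpr ⟨z, hz, rfl⟩) (blockMap e d)
      (mem_famMap.mpr ⟨d, hd, rfl⟩) (e y) (mem_blockMap.mpr ⟨y, hy, rfl⟩) (e.le_iff_le.mpr hxy)
      (e.le_iff_le.mpr hyz)
    exact (Finset.mem_map' _).mp this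
  · intro h x hx z hz d hd y hy hxy hyz
    obtain ⟨x, hx', rfl⟩ := (hu _).mp hx
    obtain ⟨z, hz', rfl⟩ := (hu _).mp hz
    obtain ⟨d, hd', rfl⟩ := mem_famMap.mp hd
    obtain ⟨y, hy', rfl⟩ := mem_blockMap.mp hy
    exact Finset.mem_map_of_mem _
      (h x hx' z hz' d hd' y hy' (e.le_iff_le.mp hxy) (e.le_iff_le.mp hyz))

theorem isUpper_famMap : IsUpper (famMap e B) (famMap e J) ↔ IsUpper B J := by
  constructor
  · intro h
    refine ⟨Finset.map_subset_map.mp h.sub, fun b hb => ?_⟩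
    exact (conn_famMap e).mp (h.conn _ (Finset.mem_map_of_mem _ hb))
  · intro h
    refine ⟨Finset.map_subset_map.mpr h.sub, fun b hb => ?_⟩
    obtain ⟨b, hb', rfl⟩ := mem_famMap.mp hb
    exact (conn_famMap e).mpr (h.conn b hb')

theorem uppers_famMap : uppers (famMap e B) = (uppers B).map (famMap e) := by
  ext I
  rw [mem_uppers, Finset.mem_map]
  constructor
  · intro h
    obtain ⟨J, hJ, rfl⟩ := Finset.subset_map_iff.mp h.sub
    exact ⟨J, mem_uppers.mpr ((isUpper_famMap e).mp h), rfl⟩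
  · rintro ⟨J, hJ, rfl⟩
    exact (isUpper_famMap e).mpr (mem_uppers.mp hJ)

theorem comps_famMap : comps (famMap e B) (famMap e J) = (comps B J).map (famMap e) :=
  classes_map (blockMap e) fun _ _ _ _ => conn_famMap e

theorem support_famMap : support (famMap e B) = blockMap e (support B) := by
  ext y
  simp only [mem_support, mem_famMap, mem_blockMap]
  constructor
  · rintro ⟨_, ⟨b, hb, rfl⟩, hy⟩
    obtain ⟨x, hx, rfl⟩ := mem_blockMap.mp hy
    exact ⟨x, ⟨b, hb, hx⟩, rfl⟩
  · rintro ⟨x, ⟨b, hb, hx⟩, rfl⟩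
    exact ⟨_, ⟨b, hb, rfl⟩, mem_blockMap.mpr ⟨x, hx, rfl⟩⟩

theorem nonCrossing_famMap : NonCrossing (famMap e B) ↔ NonCrossing B := by
  constructor
  · intro h b hb b' hb' hne x hx z hz y hy t ht hlt
    refine h _ (Finset.mem_map_of_mem _ hb) _ (Finset.mem_map_of_mem _ hb')
      (fun h => hne ((blockMap e).injective h)) (e x) (mem_blockMap.mpr ⟨x, hx, rfl⟩) (e z)
      (mem_blockMap.mpr ⟨z, hz, rfl⟩) (e y) (mem_blockMap.mpr ⟨y, hy, rfl⟩) (e t)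
      (mem_blockMap.mpr ⟨t, ht, rfl⟩) ?_
    simpa only [e.lt_iff_lt] using hlt
  · intro h c hc c' hc' hne x hx z hz y hy t ht hlt
    obtain ⟨b, hb, rfl⟩ := mem_famMap.mp hc
    obtain ⟨b', hb', rfl⟩ := mem_famMap.mp hc'
    obtain ⟨x, hx', rfl⟩ := mem_blockMap.mp hx
    obtain ⟨z, hz', rfl⟩ := mem_blockMap.mp hz
    obtain ⟨y, hy', rfl⟩ := mem_blockMap.mp hy
    obtain ⟨t, ht', rfl⟩ := mem_blockMap.mp ht
    simp only [e.lt_iff_lt] at hlt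
    exact h b hb b' hb' (fun h => hne (congrArg _ h)) x hx' z hz' y hy' t ht' hlt

theorem isNCFamily_famMap : IsNCFamily (famMap e B) ↔ IsNCFamily B := by
  have hmem : ∅ ∈ famMap e B ↔ ∅ ∈ B := by
    rw [mem_famMap]
    simp [blockMap_apply, Finset.map_eq_empty]
  constructor
  · intro h
    refine ⟨fun h' => h.empty_notMem (hmem.mpr h'), fun b hb b' hb' hne => ?_,
      (nonCrossing_famMap e).mp h.nonCrossing⟩
    have := h.disjoint _ (Finset.mem_map_of_mem _ hb) _ (Finset.mem_map_of_mem _ hb')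
      (fun h => hne ((blockMap e).injective h))
    exact (Finset.disjoint_map e.toEmbedding).mp this
  · intro h
    refine ⟨fun h' => h.empty_notMem (hmem.mp h'), fun c hc c' hc' hne => ?_,
      (nonCrossing_famMap e).mpr h.nonCrossing⟩
    obtain ⟨b, hb, rfl⟩ := mem_famMap.mp hc
    obtain ⟨b', hb', rfl⟩ := mem_famMap.mp hc'
    exact (Finset.disjoint_map e.toEmbedding).mpr
      (h.disjoint b hb b' hb' fun h => hne (congrArg _ h))

theorem image_support_clsMap : (clsMap e P).image support = famMap e (P.image support) := by
  ext c
  simp only [Finset.mem_image, mem_clsMap, mem_famMap]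
  constructor
  · rintro ⟨_, ⟨C, hC, rfl⟩, rfl⟩
    exact ⟨_, ⟨C, hC, rfl⟩, (support_famMap e).symm⟩
  · rintro ⟨_, ⟨C, hC, rfl⟩, rfl⟩
    exact ⟨_, ⟨C, hC, rfl⟩, support_famMap e⟩

theorem isPart_clsMap : IsPart (famMap e B) (clsMap e P) ↔ IsPart B P := by
  have hm : ∀ {b : Finset ℕ} {C : Finset (Finset ℕ)}, blockMap e b ∈ famMap e C ↔ b ∈ C :=
    Finset.mem_map' _
  have hc : ∀ {C : Finset (Finset ℕ)}, C ∈ P → famMap e C ∈ clsMap e P :=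
    Finset.mem_map_of_mem _
  constructor
  · intro h
    refine ⟨fun C hC => Finset.map_nonempty.mp (h.nonempty _ (hc hC)),
      fun C hC => Finset.map_subset_map.mp (h.sub _ (hc hC)), fun C hC C' hC' b hb hb' => ?_,
      fun b hb => ?_⟩
    · exact (famMap e).injective (h.eq_of_mem _ (hc hC) _ (hc hC') _ (hm.mpr hb) (hm.mpr hb'))
    · obtain ⟨D, hD, hbD⟩ := h.exists_mem _ (hm.mpr hb)
      obtain ⟨C, hC, rfl⟩ := mem_clsMap.mp hD
      exact ⟨C, hC, hm.mp hbD⟩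
  · intro h
    refine ⟨fun D hD => ?_, fun D hD => ?_, fun D hD D' hD' d hd hd' => ?_, fun d hd => ?_⟩
    · obtain ⟨C, hC, rfl⟩ := mem_clsMap.mp hD
      exact (h.nonempty C hC).map
    · obtain ⟨C, hC, rfl⟩ := mem_clsMap.mp hD
      exact Finset.map_subset_map.mpr (h.sub C hC)
    · obtain ⟨C, hC, rfl⟩ := mem_clsMap.mp hD
      obtain ⟨C', hC', rfl⟩ := mem_clsMap.mp hD'
      obtain ⟨b, hb, rfl⟩ := mem_famMap.mp hd
      exact congrArg _ (h.eq_of_mem C hC C' hC' b hb (hm.mp hd'))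
    · obtain ⟨b, hb, rfl⟩ := mem_famMap.mp hd
      obtain ⟨C, hC, hbC⟩ := h.exists_mem b hb
      exact ⟨_, hc hC, hm.mpr hbC⟩

theorem ncParts_famMap : ncParts (famMap e B) = (ncParts B).map (clsMap e) := by
  ext Q
  rw [mem_ncParts, Finset.mem_map]
  constructor
  · rintro ⟨h, hn⟩
    -- Every class of `Q` consists of image blocks, so `Q` itself is an image.
    have : ∃ P, clsMap e P = Q := by
      have hsub : Q ⊆ B.powerset.map (famMap e) := by
        intro c hc
        obtain ⟨C, hC, rfl⟩ := Finset.subset_map_iff.mp (h.sub c hc)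
        exact Finset.mem_map.mpr ⟨C, Finset.mem_powerset.mpr hC, rfl⟩
      obtain ⟨P, _, rfl⟩ := Finset.subset_map_iff.mp hsub
      exact ⟨P, rfl⟩
    obtain ⟨P, rfl⟩ := this
    rw [image_support_clsMap, nonCrossing_famMap] at hn
    exact ⟨P, mem_ncParts.mpr ⟨(isPart_clsMap e).mp h, hn⟩, rfl⟩
  · rintro ⟨P, hP, rfl⟩
    rw [mem_ncParts] at hP
    rw [image_support_clsMap, nonCrossing_famMap]
    exact ⟨(isPart_clsMap e).mpr hP.1, hP.2⟩

theorem sumSep_famMap {R : Type*} [CommSemiring R] {f g : Finset (Finset ℕ) → R}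
    (hf : ∀ B, f (famMap e B) = f B) (hg : ∀ B, g (famMap e B) = g B) :
    sumSep f g (famMap e B) = sumSep f g B := by
  rw [sumSep, uppers_famMap, Finset.sum_map]
  refine Finset.sum_congr rfl fun J _ => ?_
  rw [comps_famMap, Finset.prod_map]
  have : famMap e B \ famMap e J = famMap e (B \ J) := (Finset.map_sdiff _ _).symm
  rw [this, hf]
  simp only [hg]

theorem sumExt_famMap {R : Type*} [CommSemiring R] {f g : Finset (Finset ℕ) → R}
    (hf : ∀ B, f (famMap e B) = f B) (hg : ∀ B, g (famMap e B) = g B) :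
    sumExt f g (famMap e B) = sumExt f g B := by
  rw [sumExt, ncParts_famMap, Finset.sum_map]
  refine Finset.sum_congr rfl fun P _ => ?_
  rw [image_support_clsMap, hf, clsMap_apply, Finset.prod_map]
  simp only [hg]

theorem rank_blockMap (s : Finset ℕ) (x : ℕ) : rank (blockMap e s) (e x) = rank s x := by
  unfold rank
  rw [blockMap_apply, Finset.filter_map, Finset.card_map]
  congr 1
  ext y
  simp

end Relabel

theorem NCP.ext_blocks {π π' : NCP} (hn : π.n = π'.n) (h : π.blocks = π'.blocks) : π = π' := by
  obtain ⟨n, _, p, _⟩ := π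
  obtain ⟨n', _, p', _⟩ := π'
  obtain rfl : n = n' := hn
  obtain rfl : p = p' := Finpartition.ext h
  rfl

theorem NCP.support_blocks (π : NCP) : support π.blocks = Finset.Icc 1 π.n := π.part.sup_parts

theorem NCP.isNCFamily (π : NCP) : IsNCFamily π.blocks where
  empty_notMem := π.part.bot_notMem
  disjoint _ hb _ hb' hne := π.part.disjoint hb hb' hne
  nonCrossing := π.nonCrossing

theorem NCP.blocks_nonempty (π : NCP) : π.blocks.Nonempty := by
  have : 1 ∈ support π.blocks := by
    rw [π.support_blocks, Finset.mem_Icc]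
    exact ⟨le_rfl, π.pos⟩
  obtain ⟨b, hb, _⟩ := mem_support.mp this
  exact ⟨b, hb⟩

theorem NCP.blocks_std {B : Finset (Finset ℕ)} (hB : IsNCFamily B) (hne : B.Nonempty) :
    (NCP.std B hB hne).blocks = B.image (Finset.image (rank (support B))) := rfl

/-! ### Invariance of generators under relabelling. -/

section Gen

variable (K : Type*) [Field K]

theorem gen_empty : gen K ∅ = 1 := by
  simp [gen]

theorem gen_of_nonempty {B : Finset (Finset ℕ)} (hB : IsNCFamily B) (hne : B.Nonempty) :
    gen K B = MvPolynomial.X (NCP.std B hB hne) :=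
  dif_pos ⟨hB, hne⟩

/-- Standardizing a partition of `[n]` changes nothing, as the rank function of `[n]` is the
identity there. -/
theorem gen_blocks (π : NCP) : gen K π.blocks = MvPolynomial.X π := by
  rw [gen_of_nonempty K π.isNCFamily π.blocks_nonempty]
  congr 1
  have hr : ∀ x ∈ Finset.Icc 1 π.n, rank (Finset.Icc 1 π.n) x = x := by
    intro x hx
    rw [Finset.mem_Icc] at hx
    have : (Finset.Icc 1 π.n).filter (· ≤ x) = Finset.Icc 1 x := by
      ext y
      simp only [Finset.mem_filter, Finset.mem_Icc]
      omega
    rw [rank, this]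
    simp
  refine NCP.ext_blocks ?_ ?_
  · change (support π.blocks).card = _
    simp [π.support_blocks]
  · rw [NCP.blocks_std, π.support_blocks]
    conv_rhs => rw [← Finset.image_id (s := π.blocks)]
    refine Finset.image_congr fun b hb => ?_
    rw [id]
    conv_rhs => rw [← Finset.image_id (s := b)]
    refine Finset.image_congr fun x hx => hr x ?_
    rw [← π.support_blocks]
    exact subset_support hb hx

theorem gen_famMap (e : ℕ ↪o ℕ) (B : Finset (Finset ℕ)) : gen K (famMap e B) = gen K B := by
  by_cases h : IsNCFamily B ∧ B.Nonempty
  · have h' : IsNCFamily (famMap e B) ∧ (famMap e B).Nonempty :=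
      ⟨(isNCFamily_famMap e).mpr h.1, h.2.map⟩
    rw [gen_of_nonempty K h.1 h.2, gen_of_nonempty K h'.1 h'.2]
    congr 1
    refine NCP.ext_blocks ?_ ?_
    · change (support _).card = (support _).card
      rw [support_famMap, blockMap_apply, Finset.card_map]
    · rw [NCP.blocks_std, NCP.blocks_std, support_famMap, famMap_apply, Finset.map_eq_image,
        Finset.image_image]
      refine Finset.image_congr fun b _ => ?_
      simp only [Function.comp]
      rw [blockMap_apply e b, Finset.map_eq_image, Finset.image_image]
      refine Finset.image_congr fun x _ => ?_
      exact rank_blockMap e _ x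
  · have h' : ¬(IsNCFamily (famMap e B) ∧ (famMap e B).Nonempty) := by
      rwa [isNCFamily_famMap, famMap_apply, Finset.map_nonempty]
    rw [gen, dif_neg h', gen, dif_neg h]

end Gen

/-- The shift of the integers by one. -/
def shift : ℕ ↪o ℕ := OrderEmbedding.ofStrictMono (· + 1) fun _ _ h => Nat.succ_lt_succ h

/-- After a shift by one, every finite set of integers is the image of an initial interval
under an increasing map that inverts its rank function. -/
theorem exists_orderEmbedding_rank (s : Finset ℕ) :
    ∃ e : ℕ ↪o ℕ, ∀ x ∈ s, e (rank s x) = x + 1 := by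
  classical
  -- The embedding enumerates the set of numbers satisfying `p`. It contains `0` because ranks start
  -- at `1` while enumeration starts at index `0`; this forces the shift of `s` by one. All large
  -- numbers are added to make the set infinite.
  let p : ℕ → Prop := fun y => y = 0 ∨ y - 1 ∈ s ∨ s.sup id + 1 < y
  have hinf : (Set.ofPred p).Infinite :=
    (Set.Ioi_infinite (s.sup id + 1)).mono fun y hy => Or.inr (Or.inr hy)
  refine ⟨OrderEmbedding.ofStrictMono _ (Nat.nth_strictMono hinf), fun x hx => ?_⟩
  have hle : x ≤ s.sup id := Finset.le_sup (f := id) hx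
  have hcount : Nat.count p (x + 1) = rank s x := by
    have hr : s.filter (· ≤ x) = insert x (s.filter (· < x)) := by
      ext y
      simp only [Finset.mem_filter, Finset.mem_insert, le_iff_lt_or_eq]
      constructor
      · tauto
      · rintro (rfl | h)
        · exact ⟨hx, Or.inr rfl⟩
        · exact ⟨h.1, Or.inl h.2⟩
    rw [Nat.count_succ', if_pos (Or.inl rfl), Nat.count_eq_card_filter_range, rank, hr,
      Finset.card_insert_of_notMem (by simp)]
    congr 2
    ext y
    simp only [Finset.mem_filter, Finset.mem_range, p, Nat.add_sub_cancel]
    constructor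
    · rintro ⟨h1, h2 | h2 | h2⟩
      · omega
      · exact ⟨h2, h1⟩
      · omega
    · rintro ⟨h1, h2⟩
      exact ⟨h2, Or.inr (Or.inl h1)⟩
  change Nat.nth p (rank s x) = x + 1
  rw [← hcount]
  exact Nat.nth_count (Or.inr (Or.inl (by simpa using hx)))

/-- A property of noncrossing families that is invariant under relabelling holds as soon as it
holds for noncrossing partitions. -/
theorem IsNCFamily.induction_blocks {p : Finset (Finset ℕ) → Prop}
    (hp : ∀ (e : ℕ ↪o ℕ) B, p (famMap e B) ↔ p B) (h : ∀ π : NCP, p π.blocks)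
    {B : Finset (Finset ℕ)} (hB : IsNCFamily B) (hne : B.Nonempty) : p B := by
  obtain ⟨e, he⟩ := exists_orderEmbedding_rank (support B)
  -- Two increasing maps, one from the standardization and one from `B`, reach the same family;
  -- invariance is then used along both.
  have heq : famMap e (NCP.std B hB hne).blocks = famMap shift B := by
    rw [NCP.blocks_std, famMap_apply, famMap_apply, Finset.map_eq_image, Finset.map_eq_image,
      Finset.image_image]
    refine Finset.image_congr fun b hb => ?_
    simp only [Function.comp]
    rw [blockMap_apply, blockMap_apply, Finset.map_eq_image, Finset.map_eq_image,
      Finset.image_image]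
    refine Finset.image_congr fun x hx => ?_
    exact he x (subset_support hb hx)
  rw [← hp shift, ← heq, hp]
  exact h _

/-! ## The coproducts on families of blocks -/

section Bridge

variable {π : NCP} {J : Finset (Finset ℕ)}

theorem NCP.mem_support_of_between {b b' : Finset ℕ} (hb : b ∈ π.blocks) (hb' : b' ∈ π.blocks)
    {x y w : ℕ} (hx : x ∈ b) (hy : y ∈ b') (hw : w ∈ Finset.uIcc x y) :
    w ∈ support π.blocks := by
  have h1 := subset_support hb hx
  have h2 := subset_support hb' hy
  rw [π.support_blocks, Finset.mem_Icc] at *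
  rw [Finset.mem_uIcc'] at hw
  omega

/-- The hull of `b ∪ b'` is covered by the hulls of `b` and `b'`, which are harmless because `J` is
an upper set, and the interval between `x` and `y`. The converse uses that the blocks of `π` leave
no integer of the interval uncovered. -/
theorem NCP.uIcc_subset_support_iff (h : IsUpper π.blocks J) {b b' : Finset ℕ} (hb : b ∈ J)
    (hb' : b' ∈ J) {x y : ℕ} (hx : x ∈ b) (hy : y ∈ b') :
    Finset.uIcc x y ⊆ support J ↔ Conn π.blocks J b b' := by
  constructor
  · intro hsub u hu v hv d hd w hw huw hwv
    have hbc := h.conn b hb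
    have hbc' := h.conn b' hb'
    rw [Conn, Finset.union_self] at hbc hbc'
    have hmid : w ∈ Finset.uIcc x y → d ∈ J := by
      intro hw'
      obtain ⟨d', hd', hwd'⟩ := mem_support.mp (hsub hw')
      exact π.isNCFamily.eq_of_mem hd (h.sub hd') hw hwd' ▸ hd'
    rw [Finset.mem_uIcc'] at hmid
    rcases Finset.mem_union.mp hu with hu | hu <;> rcases Finset.mem_union.mp hv with hv | hv
    · exact hbc u hu v hv d hd w hw huw hwv
    · rcases le_or_gt w x with h1 | h1
      · exact hbc u hu x hx d hd w hw huw h1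
      rcases le_or_gt y w with h2 | h2
      · exact hbc' y hy v hv d hd w hw h2 hwv
      · exact hmid (Or.inl ⟨h1.le, h2.le⟩)
    · rcases le_or_gt w y with h1 | h1
      · exact hbc' u hu y hy d hd w hw huw h1
      rcases le_or_gt x w with h2 | h2
      · exact hbc x hx v hv d hd w hw h2 hwv
      · exact hmid (Or.inr ⟨h1.le, h2.le⟩)
    · exact hbc' u hu v hv d hd w hw huw hwv
  · intro hc w hw
    obtain ⟨d, hd, hwd⟩ := mem_support.mp (π.mem_support_of_between (h.sub hb) (h.sub hb') hx hy hw)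
    have hx' : x ∈ b ∪ b' := Finset.mem_union_left _ hx
    have hy' : y ∈ b ∪ b' := Finset.mem_union_right _ hy
    refine subset_support ?_ hwd
    rcases Finset.mem_uIcc'.mp hw with hw | hw
    · exact hc x hx' y hy' d hd w hwd hw.1 hw.2
    · exact hc y hy' x hx' d hd w hwd hw.1 hw.2

theorem NCP.component_eq (h : IsUpper π.blocks J) {c : Finset (Finset ℕ)}
    (hc : c ∈ comps π.blocks J) {b : Finset ℕ} (hb : b ∈ c) {x : ℕ} (hx : x ∈ b) :
    component (support J) x = support c := by
  have hpart := h.isPart π.isNCFamily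
  have hbJ := hpart.sub c hc hb
  ext y
  rw [component, Finset.mem_filter, mem_support, mem_support]
  constructor
  · rintro ⟨⟨b', hb', hy⟩, hsub⟩
    exact ⟨b', (h.mem_comps π.isNCFamily hc hb b').mpr
      ⟨hb', (π.uIcc_subset_support_iff h hbJ hb' hx hy).mp hsub⟩, hy⟩
  · rintro ⟨b', hb', hy⟩
    obtain ⟨hbJ', hconn⟩ := (h.mem_comps π.isNCFamily hc hb b').mp hb'
    exact ⟨⟨b', hbJ', hy⟩, (π.uIcc_subset_support_iff h hbJ hbJ' hx hy).mpr hconn⟩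

theorem NCP.components_eq (h : IsUpper π.blocks J) :
    components (support J) = (comps π.blocks J).image support := by
  have hpart := h.isPart π.isNCFamily
  ext C
  rw [components, Finset.mem_image, Finset.mem_image]
  constructor
  · rintro ⟨x, hx, rfl⟩
    obtain ⟨b, hb, hxb⟩ := mem_support.mp hx
    obtain ⟨c, hc, hbc⟩ := hpart.exists_mem b hb
    exact ⟨c, hc, (π.component_eq h hc hbc hxb).symm⟩
  · rintro ⟨c, hc, rfl⟩
    obtain ⟨b, hb⟩ := hpart.nonempty c hc
    have hbJ := hpart.sub c hc hb
    obtain ⟨x, hx⟩ := π.isNCFamily.nonempty (h.sub hbJ)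
    exact ⟨x, subset_support hbJ hx, π.component_eq h hc hb hx⟩

/-- A component of the support of an ideal that meets a block contains all of it, hence its hull.
Conversely, the components are the supports of the classes of `Conn`. -/
theorem NCP.isIdeal_iff : IsIdeal π J ↔ IsUpper π.blocks J := by
  constructor
  · rintro ⟨hJ, h⟩
    refine ⟨hJ, fun b hb u hu v hv d hd w hw huw hwv => ?_⟩
    rw [Finset.union_self] at hu hv
    have huJ := subset_support hb hu
    obtain ⟨D, hD, hCD⟩ := h _ (Finset.mem_image_of_mem (component (support J)) huJ)
    have huC : u ∈ component (support J) u := by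
      simp [component, huJ]
    rw [hCD, mem_support] at huC
    obtain ⟨b', hb', hub'⟩ := huC
    have := π.isNCFamily.eq_of_mem (hJ hb) (hD hb') hu hub'
    subst this
    have hvC := subset_support hb' hv
    rw [← hCD, component, Finset.mem_filter] at hvC
    obtain ⟨d', hd', hwd'⟩ := mem_support.mp (hvC.2 (Finset.mem_uIcc'.mpr (Or.inl ⟨huw, hwv⟩)))
    exact π.isNCFamily.eq_of_mem hd (hJ hd') hw hwd' ▸ hd'
  · intro h
    refine ⟨h.sub, fun C hC => ?_⟩
    rw [π.components_eq h] at hC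
    obtain ⟨c, hc, rfl⟩ := Finset.mem_image.mp hC
    exact ⟨c, ((h.isPart π.isNCFamily).sub c hc).trans h.sub, rfl⟩

theorem NCP.restrictDot_eq (K : Type*) [Field K] (h : IsUpper π.blocks J) :
    restrictDot K π J = ∏ c ∈ comps π.blocks J, gen K c := by
  have hpart := h.isPart π.isNCFamily
  rw [restrictDot, π.components_eq h, Finset.prod_image]
  · refine Finset.prod_congr rfl fun c hc => ?_
    congr 1
    ext b
    rw [Finset.mem_filter]
    constructor
    · rintro ⟨hb, hsub⟩
      obtain ⟨x, hx⟩ := π.isNCFamily.nonempty hb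
      obtain ⟨b', hb', hx'⟩ := mem_support.mp (hsub hx)
      exact π.isNCFamily.eq_of_mem hb (h.sub (hpart.sub c hc hb')) hx hx' ▸ hb'
    · intro hb
      exact ⟨h.sub (hpart.sub c hc hb), subset_support hb⟩
  · intro c hc c' hc' heq
    exact hpart.support_injOn (π.isNCFamily.mono h.sub) hc hc' heq

theorem isPart_parts {B : Finset (Finset ℕ)} (P : Finpartition B) : IsPart B P.parts where
  nonempty _ hc := P.nonempty_of_mem_parts hc
  sub _ hc := P.le hc
  eq_of_mem _ hc _ hc' _ hb hb' := P.eq_of_mem_parts hc hc' hb hb'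
  exists_mem _ hb := P.exists_mem hb

theorem IsPart.exists_finpartition {B : Finset (Finset ℕ)} {P : Finset (Finset (Finset ℕ))}
    (hP : IsPart B P) : ∃ F : Finpartition B, F.parts = P := by
  refine ⟨⟨P, ?_, ?_, ?_⟩, rfl⟩
  · rw [Finset.supIndep_iff_pairwiseDisjoint]
    intro c hc c' hc' hne
    simp only [Function.onFun, id]
    rw [Finset.disjoint_left]
    exact fun b hb hb' => hne (hP.eq_of_mem c hc c' hc' b hb hb')
  · rw [← hP.biUnion_eq, Finset.sup_eq_biUnion]
  · exact fun h => (hP.nonempty _ h).ne_empty rfl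

theorem NCP.sum_contractible {M : Type*} [AddCommMonoid M] (π : NCP)
    (t : Finset (Finset (Finset ℕ)) → M) :
    ∑ P ∈ contractible π, t P.parts = ∑ P ∈ ncParts π.blocks, t P := by
  classical
  refine Finset.sum_bij (fun P _ => P.parts) ?_ ?_ ?_ ?_
  · intro P hP
    exact mem_ncParts.mpr ⟨isPart_parts P, (Finset.mem_filter.mp hP).2⟩
  · intro P _ P' _ h
    exact Finpartition.ext h
  · intro P hP
    rw [mem_ncParts] at hP
    obtain ⟨F, rfl⟩ := hP.1.exists_finpartition
    exact ⟨F, Finset.mem_filter.mpr ⟨Finset.mem_univ _, hP.2⟩, rfl⟩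
  · intro P _
    rfl

end Bridge

/-! ### Convolution of algebra morphisms along the two coproducts. -/

section Convolution

variable {K : Type*} [Field K] {A : Type*} [CommRing A] [Algebra K A]

/-- The convolution product along `Δ` of two algebra morphisms to a commutative algebra. -/
noncomputable def sepConv (F G : KNCP K →ₐ[K] A) : KNCP K →ₐ[K] A :=
  (Algebra.TensorProduct.productMap F G).comp (sepComul K)

/-- The convolution product along `δ` of two algebra morphisms to a commutative algebra. -/
noncomputable def extConv (F G : KNCP K →ₐ[K] A) : KNCP K →ₐ[K] A :=
  (Algebra.TensorProduct.productMap F G).comp (extComul K)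

theorem sumSep_empty {f g : Finset (Finset ℕ) → A} : sumSep f g ∅ = f ∅ := by
  have : uppers ∅ = {∅} := by
    ext J
    rw [mem_uppers, Finset.mem_singleton]
    exact ⟨fun h => Finset.subset_empty.mp h.sub, by rintro rfl; exact IsUpper.empty ∅⟩
  rw [sumSep, this, Finset.sum_singleton, comps, classes_empty]
  simp

theorem sumExt_empty {f g : Finset (Finset ℕ) → A} : sumExt f g ∅ = f ∅ := by
  have : ncParts ∅ = {∅} := by
    ext P
    rw [mem_ncParts, Finset.mem_singleton]
    constructor
    · intro h
      rw [Finset.eq_empty_iff_forall_notMem]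
      intro c hc
      exact (h.1.nonempty c hc).ne_empty (Finset.subset_empty.mp (h.1.sub c hc))
    · rintro rfl
      refine ⟨⟨by simp, by simp, by simp, by simp⟩, ?_⟩
      simp [NonCrossing]
  rw [sumExt, this, Finset.sum_singleton]
  simp

theorem sepComul_X (π : NCP) : sepComul K (MvPolynomial.X π) =
    ∑ J ∈ uppers π.blocks, gen K (π.blocks \ J) ⊗ₜ[K] ∏ c ∈ comps π.blocks J, gen K c := by
  classical
  rw [sepComul, MvPolynomial.aeval_X]
  refine Finset.sum_congr ?_ fun J hJ => ?_
  · ext J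
    rw [Finset.mem_filter, Finset.mem_powerset, mem_uppers, π.isIdeal_iff]
    exact ⟨fun h => h.2, fun h => ⟨h.sub, h⟩⟩
  · rw [π.restrictDot_eq K (mem_uppers.mp hJ)]

theorem extComul_X (π : NCP) : extComul K (MvPolynomial.X π) =
    ∑ P ∈ ncParts π.blocks, gen K (P.image support) ⊗ₜ[K] ∏ c ∈ P, gen K c := by
  rw [extComul, MvPolynomial.aeval_X, ← π.sum_contractible
    (fun P => gen K (P.image support) ⊗ₜ[K] ∏ c ∈ P, gen K c)]
  rfl

/-- On the blocks of a partition this unfolds the coproduct; relabelling invariance extends it to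
every noncrossing family, so that convolutions can be iterated without standardizing. -/
theorem sepConv_gen (F G : KNCP K →ₐ[K] A) {B : Finset (Finset ℕ)} (hB : IsNCFamily B) :
    sepConv F G (gen K B) = sumSep (fun B => F (gen K B)) (fun B => G (gen K B)) B := by
  rcases B.eq_empty_or_nonempty with rfl | hne
  · rw [sumSep_empty, gen_empty, map_one, map_one]
  · refine hB.induction_blocks (p := fun B => sepConv F G (gen K B) =
      sumSep (fun B => F (gen K B)) (fun B => G (gen K B)) B) (fun e B => ?_) (fun π => ?_) hne
    · rw [gen_famMap, sumSep_famMap e] <;> simp only [gen_famMap, implies_true]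
    · rw [gen_blocks, sepConv, AlgHom.comp_apply, sepComul_X, map_sum, sumSep]
      simp only [Algebra.TensorProduct.productMap_apply_tmul, map_prod]

theorem extConv_gen (F G : KNCP K →ₐ[K] A) {B : Finset (Finset ℕ)} (hB : IsNCFamily B) :
    extConv F G (gen K B) = sumExt (fun B => F (gen K B)) (fun B => G (gen K B)) B := by
  rcases B.eq_empty_or_nonempty with rfl | hne
  · rw [sumExt_empty, gen_empty, map_one, map_one]
  · refine hB.induction_blocks (p := fun B => extConv F G (gen K B) =
      sumExt (fun B => F (gen K B)) (fun B => G (gen K B)) B) (fun e B => ?_) (fun π => ?_) hne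
    · rw [gen_famMap, sumExt_famMap e] <;> simp only [gen_famMap, implies_true]
    · rw [gen_blocks, extConv, AlgHom.comp_apply, extComul_X, map_sum, sumExt]
      simp only [Algebra.TensorProduct.productMap_apply_tmul, map_prod]

theorem algHom_ext_gen {F G : KNCP K →ₐ[K] A}
    (h : ∀ π : NCP, F (gen K π.blocks) = G (gen K π.blocks)) : F = G := by
  refine MvPolynomial.algHom_ext fun π => ?_
  rw [← gen_blocks]
  exact h π

theorem sumSep_congr {B : Finset (Finset ℕ)} (hB : IsNCFamily B)
    {f f' g g' : Finset (Finset ℕ) → A} (hf : ∀ C, IsNCFamily C → f C = f' C)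
    (hg : ∀ C, IsNCFamily C → g C = g' C) : sumSep f g B = sumSep f' g' B := by
  refine Finset.sum_congr rfl fun J hJ => ?_
  have hJ := mem_uppers.mp hJ
  rw [hf _ (hB.mono Finset.sdiff_subset)]
  congr 1
  exact Finset.prod_congr rfl fun c hc => hg c (hB.mono (((hJ.isPart hB).sub c hc).trans hJ.sub))

theorem sumExt_congr {B : Finset (Finset ℕ)} (hB : IsNCFamily B)
    {f f' g g' : Finset (Finset ℕ) → A} (hf : ∀ C, IsNCFamily C → f C = f' C)
    (hg : ∀ C, IsNCFamily C → g C = g' C) : sumExt f g B = sumExt f' g' B := by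
  refine Finset.sum_congr rfl fun P hP => ?_
  have hP := mem_ncParts.mp hP
  rw [hf _ (hP.1.isNCFamily hB hP.2)]
  congr 1
  exact Finset.prod_congr rfl fun c hc => hg c (hB.mono (hP.1.sub c hc))

theorem sepConv_assoc (F G H : KNCP K →ₐ[K] A) :
    sepConv (sepConv F G) H = sepConv F (sepConv G H) := by
  refine algHom_ext_gen fun π => ?_
  have hB := π.isNCFamily
  rw [sepConv_gen _ _ hB, sepConv_gen _ _ hB,
    sumSep_congr hB (fun C hC => sepConv_gen F G hC) (fun _ _ => rfl),
    sumSep_congr (f := fun B => F (gen K B)) hB (fun _ _ => rfl)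
      (fun C hC => sepConv_gen G H hC), sumSep_assoc hB]
  rw [gen_empty, map_one]

/-- The cointeraction of `Δ` and `δ`. -/
theorem extConv_sepConv (F G H : KNCP K →ₐ[K] A) :
    extConv (sepConv F G) H = sepConv (extConv F H) (extConv G H) := by
  refine algHom_ext_gen fun π => ?_
  have hB := π.isNCFamily
  rw [extConv_gen _ _ hB, sepConv_gen _ _ hB,
    sumExt_congr hB (fun C hC => sepConv_gen F G hC) (fun _ _ => rfl),
    sumSep_congr hB (fun C hC => extConv_gen F H hC) (fun C hC => extConv_gen G H hC),
    sumExt_sumSep hB]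

theorem comp_sepConv {A' : Type*} [CommRing A'] [Algebra K A'] (u : A →ₐ[K] A')
    (F G : KNCP K →ₐ[K] A) : u.comp (sepConv F G) = sepConv (u.comp F) (u.comp G) := by
  rw [sepConv, sepConv, ← AlgHom.comp_assoc]
  congr 1
  ext <;> simp

/-- The unit of convolution along `Δ`. -/
noncomputable def sepUnit (K A : Type*) [Field K] [CommRing A] [Algebra K A] : KNCP K →ₐ[K] A :=
  (Algebra.ofId K A).comp (sepCounit K)

theorem sepUnit_gen {B : Finset (Finset ℕ)} (hB : IsNCFamily B) :
    sepUnit K A (gen K B) = if B = ∅ then 1 else 0 := by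
  split_ifs with h
  · rw [h, gen_empty, map_one]
  · rw [gen_of_nonempty K hB (Finset.nonempty_iff_ne_empty.mpr h), sepUnit, sepCounit]
    simp

/-- A nonempty `J` has a component, on which the counit of `Δ` vanishes; only `J = ∅` remains. -/
theorem sepConv_unit (F : KNCP K →ₐ[K] A) : sepConv F (sepUnit K A) = F := by
  refine algHom_ext_gen fun π => ?_
  have hB := π.isNCFamily
  rw [sepConv_gen _ _ hB, sumSep, Finset.sum_eq_single ∅]
  · rw [comps, classes_empty, Finset.sdiff_empty, Finset.prod_empty, mul_one]
  · intro J hJ hne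
    have hJ := mem_uppers.mp hJ
    obtain ⟨b, hb⟩ := Finset.nonempty_iff_ne_empty.mpr hne
    obtain ⟨c, hc, _⟩ := (hJ.isPart hB).exists_mem b hb
    rw [Finset.prod_eq_zero hc, mul_zero]
    rw [sepUnit_gen (hB.mono (((hJ.isPart hB).sub c hc).trans hJ.sub)),
      if_neg ((hJ.isPart hB).nonempty c hc).ne_empty]
  · exact fun h => absurd (mem_uppers.mpr (IsUpper.empty _)) h

theorem comps_self {B : Finset (Finset ℕ)} (hne : B.Nonempty) : comps B B = {B} :=
  classes_eq_singleton hne fun _ _ _ _ _ _ _ _ _ hd _ _ _ _ => hd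

theorem unit_sepConv (F : KNCP K →ₐ[K] A) : sepConv (sepUnit K A) F = F := by
  refine algHom_ext_gen fun π => ?_
  have hB := π.isNCFamily
  rw [sepConv_gen _ _ hB, sumSep, Finset.sum_eq_single π.blocks]
  · rw [comps_self π.blocks_nonempty, Finset.sdiff_self, gen_empty, map_one,
      Finset.prod_singleton, one_mul]
  · intro J hJ hne
    have hJ := mem_uppers.mp hJ
    rw [sepUnit_gen (hB.mono Finset.sdiff_subset), if_neg, zero_mul]
    exact fun h => hne (hJ.sub.antisymm (Finset.sdiff_eq_empty_iff_subset.mp h))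
  · exact fun h => absurd (mem_uppers.mpr (IsUpper.univ _)) h

/-- A contraction of a nonempty family is nonempty, so the counit of `Δ` kills every term. -/
theorem unit_extConv (F : KNCP K →ₐ[K] A) : extConv (sepUnit K A) F = sepUnit K A := by
  refine algHom_ext_gen fun π => ?_
  have hB := π.isNCFamily
  rw [extConv_gen _ _ hB, sepUnit_gen hB, if_neg π.blocks_nonempty.ne_empty, sumExt]
  refine Finset.sum_eq_zero fun P hP => ?_
  have hP := mem_ncParts.mp hP
  rw [sepUnit_gen (hP.1.isNCFamily hB hP.2), if_neg, zero_mul]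
  intro h
  obtain ⟨b, hb⟩ := π.blocks_nonempty
  obtain ⟨c, hc, _⟩ := hP.1.exists_mem b hb
  rw [Finset.image_eq_empty] at h
  simp [h] at hc

/-- The counit of `δ` with values in an algebra. -/
noncomputable def extUnit (K A : Type*) [Field K] [CommRing A] [Algebra K A] : KNCP K →ₐ[K] A :=
  (Algebra.ofId K A).comp (extCounit K)

theorem extUnit_gen {B : Finset (Finset ℕ)} (hB : IsNCFamily B) :
    extUnit K A (gen K B) = if B.card ≤ 1 then 1 else 0 := by
  rcases B.eq_empty_or_nonempty with rfl | hne
  · simp [gen_empty]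
  · have hcard : (NCP.std B hB hne).blocks.card = B.card := by
      rw [NCP.blocks_std]
      refine Finset.card_image_of_injOn fun b hb b' hb' h => ?_
      obtain ⟨x, hx⟩ := hB.nonempty hb
      have hx' := Finset.mem_image_of_mem (rank (support B)) hx
      have h' : b.image (rank (support B)) = b'.image (rank (support B)) := h
      rw [h'] at hx'
      obtain ⟨y, hy, hxy⟩ := Finset.mem_image.mp hx'
      have := rank_inj (subset_support hb' hy) (subset_support hb hx) hxy
      subst this
      exact hB.eq_of_mem hb hb' hx hy
    have hiff : B.card = 1 ↔ B.card ≤ 1 := by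
      have := hne.card_pos
      omega
    rw [gen_of_nonempty K hB hne, extUnit, extCounit, AlgHom.comp_apply, MvPolynomial.aeval_X,
      hcard]
    simp only [hiff]
    split_ifs <;> simp

/-- The contraction has one block only when all blocks of `π` are merged into a single class, and
then the extraction is `π` itself. -/
theorem extUnit_extConv (F : KNCP K →ₐ[K] A) : extConv (extUnit K A) F = F := by
  refine algHom_ext_gen fun π => ?_
  have hB := π.isNCFamily
  have hpart : IsPart π.blocks {π.blocks} := by
    refine ⟨?_, ?_, ?_, ?_⟩ <;> simp [π.blocks_nonempty]
  have hnc : NonCrossing (({π.blocks} : Finset (Finset (Finset ℕ))).image support) := by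
    intro b hb b' hb' hne
    simp only [Finset.image_singleton, Finset.mem_singleton] at hb hb'
    exact absurd (hb.trans hb'.symm) hne
  rw [extConv_gen _ _ hB, sumExt, Finset.sum_eq_single {π.blocks}]
  · rw [extUnit_gen (hpart.isNCFamily hB hnc), Finset.prod_singleton]
    simp
  · intro P hP hne
    have hP := mem_ncParts.mp hP
    rw [extUnit_gen (hP.1.isNCFamily hB hP.2), if_neg, zero_mul]
    intro h
    rw [Finset.card_image_of_injOn fun c hc c' hc' h => hP.1.support_injOn hB hc hc' h] at h
    apply hne
    obtain ⟨b, hb⟩ := π.blocks_nonempty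
    obtain ⟨c, hc, _⟩ := hP.1.exists_mem b hb
    have hPc : P = {c} := Finset.eq_singleton_iff_unique_mem.mpr
      ⟨hc, fun c' hc' => Finset.card_le_one.mp h c' hc' c hc⟩
    have := hP.1.biUnion_eq
    rw [hPc, Finset.singleton_biUnion, id] at this
    rw [hPc, this]
  · exact fun h => absurd (mem_ncParts.mpr ⟨hpart, hnc⟩) h

end Convolution

/-! ### Polynomials determined by their values at natural numbers. -/

section Polynomials

variable {K : Type*} [Field K] [CharZero K]

/-- For a monomial of degree `k`, the Bernoulli polynomial `B_{k+1}` has difference `(k + 1) X ^ k`;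
divide by `k + 1` and subtract the value at `0`. -/
theorem exists_discrete_antiderivative (Q : K[X]) :
    ∃ P : K[X], P.eval 0 = 0 ∧
      ∀ n : ℕ, P.eval ((n + 1 : ℕ) : K) = P.eval (n : K) + Q.eval (n : K) := by
  induction Q using Polynomial.induction_on' with
  | add p q hp hq =>
    obtain ⟨P, h0, h⟩ := hp
    obtain ⟨P', h0', h'⟩ := hq
    refine ⟨P + P', by simp [h0, h0'], fun n => ?_⟩
    rw [Polynomial.eval_add, h, h', Polynomial.eval_add, Polynomial.eval_add]
    ring
  | monomial k a =>
    let b : K[X] := (Polynomial.bernoulli (k + 1)).map (algebraMap ℚ K)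
    have hb : ∀ n : ℕ, b.eval (n : K) =
        algebraMap ℚ K ((Polynomial.bernoulli (k + 1)).eval (n : ℚ)) := fun n =>
      Polynomial.eval_natCast_map _ _ _
    have hk : (k : K) + 1 ≠ 0 := by exact_mod_cast Nat.succ_ne_zero k
    refine ⟨Polynomial.C (a / (k + 1)) * (b - Polynomial.C (b.eval 0)), by simp, fun n => ?_⟩
    simp only [Polynomial.eval_mul, Polynomial.eval_C, Polynomial.eval_sub,
      Polynomial.eval_monomial]
    have : b.eval ((n + 1 : ℕ) : K) = b.eval (n : K) + (k + 1) * n ^ k := by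
      rw [hb, hb, Nat.cast_add, Nat.cast_one, add_comm (n : ℚ) 1,
        Polynomial.bernoulli_eval_one_add]
      simp
    rw [this]
    field_simp
    ring

theorem polynomial_eq_of_eval_natCast {p q : K[X]} (h : ∀ n : ℕ, p.eval (n : K) = q.eval (n : K)) :
    p = q := by
  refine Polynomial.eq_of_infinite_eval_eq p q (Set.Infinite.mono ?_
    (Set.infinite_range_of_injective (Nat.cast_injective (R := K))))
  rintro _ ⟨n, rfl⟩
  exact h n

/-- An element of `K[X] ⊗ K[X]` is determined by its values at pairs of natural numbers. -/
theorem polynomial_tensor_ext {z w : K[X] ⊗[K] K[X]}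
    (h : ∀ m n : ℕ, Algebra.TensorProduct.productMap (Polynomial.aeval (m : K))
      (Polynomial.aeval (n : K)) z = Algebra.TensorProduct.productMap (Polynomial.aeval (m : K))
      (Polynomial.aeval (n : K)) w) : z = w := by
  -- Viewing `K[X] ⊗ K[X]` as polynomials in two variables, the product of the two evaluations is
  -- evaluation at a pair.
  have hev : ∀ (m n : ℕ) (p : K[X][X]), Algebra.TensorProduct.productMap
      (Polynomial.aeval (R := K) (m : K)) (Polynomial.aeval (n : K)) (polyEquivTensor K K[X] p) =
        (p.eval (n : K[X])).eval (m : K) := by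
    intro m n p
    induction p using Polynomial.induction_on' with
    | add p q hp hq => simp only [map_add, hp, hq, Polynomial.eval_add]
    | monomial k a =>
      rw [polyEquivTensor_apply, Polynomial.eval₂_monomial]
      simp [Polynomial.aeval_def, Polynomial.eval₂_eq_eval_map]
  obtain ⟨p, rfl⟩ := (polyEquivTensor K K[X]).surjective z
  obtain ⟨q, rfl⟩ := (polyEquivTensor K K[X]).surjective w
  congr 1
  refine Polynomial.eq_of_infinite_eval_eq p q (Set.Infinite.mono ?_
    (Set.infinite_range_of_injective (Nat.cast_injective (R := K[X]))))
  rintro _ ⟨n, rfl⟩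
  refine polynomial_eq_of_eval_natCast fun m => ?_
  rw [← hev, ← hev]
  exact h m n

end Polynomials

/-! ### Existence and uniqueness of the double bialgebra morphism. -/

section Morphism

variable {K : Type*} [Field K]

theorem aeval_add_eq (a b : K) : (Polynomial.aeval (a + b) : K[X] →ₐ[K] K) =
    (Algebra.TensorProduct.productMap (Polynomial.aeval a) (Polynomial.aeval b)).comp
      (polyAddComul K) := by
  ext
  simp [polyAddComul]

theorem aeval_mul_eq (a b : K) : (Polynomial.aeval (a * b) : K[X] →ₐ[K] K) =
    (Algebra.TensorProduct.productMap (Polynomial.aeval a) (Polynomial.aeval b)).comp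
      (polyMulComul K) := by
  ext
  simp [polyMulComul]

theorem productMap_comp_map {A B C : Type*} [CommRing A] [CommRing B] [CommRing C] [Algebra K A]
    [Algebra K B] [Algebra K C] (f g : B →ₐ[K] C) (u v : A →ₐ[K] B) :
    (Algebra.TensorProduct.productMap f g).comp (Algebra.TensorProduct.map u v) =
      Algebra.TensorProduct.productMap (f.comp u) (g.comp v) := by
  ext <;> simp

theorem IsDoubleBialgebraHom.aeval_add {φ : KNCP K →ₐ[K] K[X]} (h : IsDoubleBialgebraHom φ)
    (a b : K) : (Polynomial.aeval (a + b)).comp φ =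
      sepConv ((Polynomial.aeval a).comp φ) ((Polynomial.aeval b).comp φ) := by
  rw [aeval_add_eq, AlgHom.comp_assoc, ← h.sep_comul, ← AlgHom.comp_assoc, productMap_comp_map]
  rfl

theorem sepUnit_self : sepUnit K K = sepCounit K := by
  ext
  simp [sepUnit]

theorem extUnit_self : extUnit K K = extCounit K := by
  ext
  simp [extUnit]

/-- The convolution powers of the counit of `δ` along `Δ`. -/
noncomputable def unitPow (K : Type*) [Field K] : ℕ → (KNCP K →ₐ[K] K)
  | 0 => sepUnit K K
  | n + 1 => sepConv (unitPow K n) (extUnit K K)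

theorem unitPow_add (m n : ℕ) : unitPow K (m + n) = sepConv (unitPow K m) (unitPow K n) := by
  induction n with
  | zero => rw [add_zero, unitPow, sepConv_unit]
  | succ n ih => rw [← add_assoc, unitPow, ih, sepConv_assoc, unitPow]

theorem unitPow_one : unitPow K 1 = extUnit K K := unit_sepConv _

/-- By induction on `m`: the cointeraction distributes `extConv` over the last factor of the power,
and the counit of `δ` is a left unit. -/
theorem unitPow_mul (m n : ℕ) : unitPow K (m * n) = extConv (unitPow K m) (unitPow K n) := by
  induction m with
  | zero => rw [Nat.zero_mul, unitPow, unit_extConv]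
  | succ m ih => rw [Nat.succ_mul, unitPow_add, ih, unitPow, extConv_sepConv, extUnit_extConv]

theorem IsDoubleBialgebraHom.aeval_natCast {φ : KNCP K →ₐ[K] K[X]} (h : IsDoubleBialgebraHom φ)
    (n : ℕ) : (Polynomial.aeval (n : K)).comp φ = unitPow K n := by
  induction n with
  | zero => rw [Nat.cast_zero, h.sep_counit, unitPow, sepUnit_self]
  | succ n ih =>
    rw [Nat.cast_add, Nat.cast_one, h.aeval_add, ih, h.ext_counit, unitPow, extUnit_self]

variable [CharZero K]

/-- By induction on the number of blocks. Passing from `n` to `n + 1` adds a sum over nonempty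
ideals `J` of values at `B \ J`, which are polynomial in `n`; a discrete antiderivative of that sum
is the required polynomial. -/
theorem exists_polynomial_unitPow {B : Finset (Finset ℕ)} (hB : IsNCFamily B) :
    ∃ P : K[X], ∀ n : ℕ, P.eval (n : K) = unitPow K n (gen K B) := by
  induction hc : B.card using Nat.strong_induction_on generalizing B with
  | _ k ih =>
  rcases B.eq_empty_or_nonempty with rfl | hne
  · exact ⟨1, fun n => by simp [gen_empty]⟩
  · have hsub : ∀ J ∈ (uppers B).erase ∅,
        ∃ P : K[X], ∀ n : ℕ, P.eval (n : K) = unitPow K n (gen K (B \ J)) := by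
      intro J hJ
      rw [Finset.mem_erase, mem_uppers] at hJ
      refine ih (B \ J).card ?_ (hB.mono Finset.sdiff_subset) rfl
      rw [← hc]
      refine Finset.card_lt_card (Finset.sdiff_ssubset hJ.2.sub ?_)
      exact Finset.nonempty_iff_ne_empty.mpr hJ.1
    choose! P hP using hsub
    obtain ⟨Q, hQ0, hQ⟩ := exists_discrete_antiderivative (∑ J ∈ (uppers B).erase ∅,
      P J * Polynomial.C (∏ c ∈ comps B J, extUnit K K (gen K c)))
    refine ⟨Q, fun n => ?_⟩
    induction n with
    | zero =>
      rw [Nat.cast_zero, hQ0, unitPow, sepUnit_gen hB, if_neg hne.ne_empty]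
    | succ n ihn =>
      rw [hQ, ihn, unitPow, sepConv_gen _ _ hB, sumSep,
        ← Finset.add_sum_erase _ _ (mem_uppers.mpr (IsUpper.empty B))]
      congr 1
      · rw [comps, classes_empty, Finset.sdiff_empty, Finset.prod_empty, mul_one]
      · rw [Polynomial.eval_finsetSum]
        refine Finset.sum_congr rfl fun J hJ => ?_
        rw [Polynomial.eval_mul, Polynomial.eval_C, hP J hJ]

theorem exists_isDoubleBialgebraHom : ∃ φ : KNCP K →ₐ[K] K[X], IsDoubleBialgebraHom φ := by
  choose P hP using fun π : NCP => exists_polynomial_unitPow (K := K) π.isNCFamily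
  let φ : KNCP K →ₐ[K] K[X] := MvPolynomial.aeval P
  have hφ : ∀ n : ℕ, (Polynomial.aeval (n : K)).comp φ = unitPow K n := by
    intro n
    refine algHom_ext_gen fun π => ?_
    rw [← hP, gen_blocks, AlgHom.comp_apply, MvPolynomial.aeval_X, Polynomial.coe_aeval_eq_eval]
  refine ⟨φ, ⟨?_, ?_, ?_, ?_⟩⟩
  -- At a pair `(m, n)` the two sides become `unitPow K m * unitPow K n` for convolution along `Δ`
  -- and `unitPow K (m + n)`.
  · refine AlgHom.ext fun x => polynomial_tensor_ext fun m n => ?_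
    rw [← AlgHom.comp_apply, ← AlgHom.comp_assoc, productMap_comp_map, hφ, hφ, ← AlgHom.comp_apply,
      ← AlgHom.comp_assoc, ← aeval_add_eq, ← Nat.cast_add, hφ, unitPow_add]
    rfl
  · rw [← Nat.cast_zero, hφ, unitPow, sepUnit_self]
  · refine AlgHom.ext fun x => polynomial_tensor_ext fun m n => ?_
    rw [← AlgHom.comp_apply, ← AlgHom.comp_assoc, productMap_comp_map, hφ, hφ, ← AlgHom.comp_apply,
      ← AlgHom.comp_assoc, ← aeval_mul_eq, ← Nat.cast_mul, hφ, unitPow_mul]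
    rfl
  · rw [← Nat.cast_one, hφ, unitPow_one, extUnit_self]

theorem existsUnique_isDoubleBialgebraHom :
    ∃! φ : KNCP K →ₐ[K] K[X], IsDoubleBialgebraHom φ := by
  obtain ⟨φ, hφ⟩ := exists_isDoubleBialgebraHom (K := K)
  refine ⟨φ, hφ, fun ψ hψ => AlgHom.ext fun x => polynomial_eq_of_eval_natCast fun n => ?_⟩
  have h := (hψ.aeval_natCast n).trans (hφ.aeval_natCast n).symm
  have := DFunLike.congr_fun h x
  rwa [AlgHom.comp_apply, AlgHom.comp_apply, Polynomial.coe_aeval_eq_eval] at this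

end Morphism

/-! ### The Hopf algebra structure and its antipode. -/

section Hopf

variable {K : Type*} [Field K]

theorem act_eq_extConv (χ : KNCP K →ₐ[K] K) :
    act χ = extConv ((Algebra.ofId K (KNCP K)).comp χ) (.id K _) := by
  rw [act, extConv, ← AlgHom.comp_assoc]
  congr 1
  apply Algebra.TensorProduct.ext'
  intro a b
  simp [Algebra.ofId_apply, Algebra.smul_def]

theorem act_X (χ : KNCP K →ₐ[K] K) (π : NCP) : act χ (MvPolynomial.X π) =
    ∑ P ∈ contractible π, χ (gen K (contract P)) • extract K P := by
  rw [act, AlgHom.comp_apply, AlgHom.comp_apply, extComul, MvPolynomial.aeval_X, map_sum, map_sum]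
  refine Finset.sum_congr rfl fun P _ => ?_
  simp

/-- By the cointeraction, `act` turns convolution of characters into convolution of endomorphisms,
so it carries inverse characters to inverse endomorphisms. -/
theorem sepConv_act {χ ψ : KNCP K →ₐ[K] K} (h : sepConv χ ψ = sepCounit K) :
    sepConv (act χ) (act ψ) = sepUnit K (KNCP K) := by
  rw [act_eq_extConv, act_eq_extConv, ← extConv_sepConv, ← comp_sepConv, h]
  exact unit_extConv _

theorem act_extCounit : act (extCounit K) = .id K _ := by
  rw [act_eq_extConv]
  exact extUnit_extConv _

/-- Coassociativity may be checked on the associativity of convolution in `A ⊗ A ⊗ A`. -/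
theorem coassoc_of_productMap {A : Type*} [CommRing A] [Algebra K A] (D : A →ₐ[K] A ⊗[K] A)
    (h : ∀ i₁ i₂ i₃ : A →ₐ[K] A ⊗[K] (A ⊗[K] A),
      (Algebra.TensorProduct.productMap
        ((Algebra.TensorProduct.productMap i₁ i₂).comp D) i₃).comp D =
      (Algebra.TensorProduct.productMap i₁
        ((Algebra.TensorProduct.productMap i₂ i₃).comp D)).comp D) :
    (Algebra.TensorProduct.assoc K K K A A A).toAlgHom.comp
      ((Algebra.TensorProduct.map D (.id K A)).comp D) =
    (Algebra.TensorProduct.map (.id K A) D).comp D := by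
  let i₁ : A →ₐ[K] A ⊗[K] (A ⊗[K] A) := Algebra.TensorProduct.includeLeft
  let i₂ : A →ₐ[K] A ⊗[K] (A ⊗[K] A) :=
    Algebra.TensorProduct.includeRight.comp Algebra.TensorProduct.includeLeft
  let i₃ : A →ₐ[K] A ⊗[K] (A ⊗[K] A) :=
    Algebra.TensorProduct.includeRight.comp Algebra.TensorProduct.includeRight
  have h12 : ∀ x : A ⊗[K] A,
      Algebra.TensorProduct.assoc K K K A A A (x ⊗ₜ[K] 1) =
      Algebra.TensorProduct.productMap i₁ i₂ x := by
    intro x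
    induction x using TensorProduct.induction_on with
    | zero => simp
    | add x y hx hy => rw [TensorProduct.add_tmul, map_add, hx, hy, map_add]
    | tmul a b => simp [i₁, i₂]
  have h23 : ∀ x : A ⊗[K] A, (1 ⊗ₜ[K] x : A ⊗[K] (A ⊗[K] A)) =
      Algebra.TensorProduct.productMap i₂ i₃ x := by
    intro x
    induction x using TensorProduct.induction_on with
    | zero => simp
    | add x y hx hy => rw [TensorProduct.tmul_add, hx, hy, map_add]
    | tmul a b => simp [i₂, i₃]
  have hl : ∀ x : A ⊗[K] A,
      Algebra.TensorProduct.assoc K K K A A A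
        (Algebra.TensorProduct.map D (.id K A) x) =
      Algebra.TensorProduct.productMap ((Algebra.TensorProduct.productMap i₁ i₂).comp D) i₃ x := by
    intro x
    induction x using TensorProduct.induction_on with
    | zero => simp
    | add x y hx hy => rw [map_add, map_add, hx, hy, map_add]
    | tmul a b =>
      have h2 : (D a ⊗ₜ[K] b : (A ⊗[K] A) ⊗[K] A) =
          D a ⊗ₜ 1 * 1 ⊗ₜ b := by simp
      rw [Algebra.TensorProduct.map_tmul, AlgHom.id_apply, h2, map_mul, h12,
        Algebra.TensorProduct.productMap_apply_tmul]
      rfl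
  have hr : ∀ x : A ⊗[K] A,
      Algebra.TensorProduct.map (.id K A) D x =
      Algebra.TensorProduct.productMap i₁ ((Algebra.TensorProduct.productMap i₂ i₃).comp D) x := by
    intro x
    induction x using TensorProduct.induction_on with
    | zero => simp
    | add x y hx hy => rw [map_add, hx, hy, map_add]
    | tmul a b =>
      rw [Algebra.TensorProduct.map_tmul, AlgHom.id_apply,
        Algebra.TensorProduct.productMap_apply_tmul, AlgHom.comp_apply, ← h23]
      simp [i₁]
  exact AlgHom.ext fun x => (hl _).trans ((DFunLike.congr_fun (h i₁ i₂ i₃) x).trans (hr _).symm)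

theorem sepComul_coassoc :
    (Algebra.TensorProduct.assoc K K K (KNCP K) (KNCP K) (KNCP K)).toAlgHom.comp
      ((Algebra.TensorProduct.map (sepComul K) (.id K (KNCP K))).comp (sepComul K)) =
    (Algebra.TensorProduct.map (.id K (KNCP K)) (sepComul K)).comp (sepComul K) :=
  coassoc_of_productMap _ fun i₁ i₂ i₃ => sepConv_assoc i₁ i₂ i₃

theorem IsDoubleBialgebraHom.isHopfAlgebra {φ : KNCP K →ₐ[K] K[X]} (h : IsDoubleBialgebraHom φ) :
    IsHopfAlgebra (sepComul K) (sepCounit K) (act (mu φ)).toLinearMap where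
  coassoc := sepComul_coassoc
  counit_left := by
    have h1 : (Algebra.TensorProduct.lid K (KNCP K)).toAlgHom.comp
        (Algebra.TensorProduct.map (sepCounit K) (.id K (KNCP K))) =
        Algebra.TensorProduct.productMap (sepUnit K (KNCP K)) (.id K _) := by
      apply Algebra.TensorProduct.ext'
      intro a b
      simp [sepUnit, Algebra.ofId_apply, Algebra.smul_def]
    have h2 := unit_sepConv (AlgHom.id K (KNCP K))
    rw [sepConv, ← h1] at h2
    refine AlgHom.ext fun x => (Algebra.TensorProduct.lid K (KNCP K)).injective ?_
    refine (DFunLike.congr_fun h2 x).trans ?_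
    simp
  counit_right := by
    have h1 : (Algebra.TensorProduct.rid K K (KNCP K)).toAlgHom.comp
        (Algebra.TensorProduct.map (.id K (KNCP K)) (sepCounit K)) =
        Algebra.TensorProduct.productMap (.id K _) (sepUnit K (KNCP K)) := by
      apply Algebra.TensorProduct.ext'
      intro a b
      simp [sepUnit, Algebra.ofId_apply, Algebra.smul_def, mul_comm]
    have h2 := sepConv_unit (AlgHom.id K (KNCP K))
    rw [sepConv, ← h1] at h2
    refine AlgHom.ext fun x => (Algebra.TensorProduct.rid K K (KNCP K)).injective ?_
    refine (DFunLike.congr_fun h2 x).trans ?_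
    simp
  antipode_left := by
    have h1 : LinearMap.mul' K (KNCP K) ∘ₗ (act (mu φ)).toLinearMap.rTensor (KNCP K) =
        (Algebra.TensorProduct.productMap (act (mu φ)) (.id K _)).toLinearMap := by
      apply TensorProduct.ext'
      intro a b
      simp
    have h2 : sepConv (act (mu φ)) (.id K _) = sepUnit K (KNCP K) := by
      rw [← act_extCounit]
      refine sepConv_act ?_
      -- The product of the evaluations at `-1` and at `1` is evaluation at `0`, which is the counit
      -- of `Δ`.
      rw [mu, ← h.ext_counit, ← h.aeval_add, neg_add_cancel, h.sep_counit]
    rw [← LinearMap.comp_assoc, h1]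
    exact congrArg AlgHom.toLinearMap h2
  antipode_right := by
    have h1 : LinearMap.mul' K (KNCP K) ∘ₗ (act (mu φ)).toLinearMap.lTensor (KNCP K) =
        (Algebra.TensorProduct.productMap (.id K _) (act (mu φ))).toLinearMap := by
      apply TensorProduct.ext'
      intro a b
      simp
    have h2 : sepConv (.id K _) (act (mu φ)) = sepUnit K (KNCP K) := by
      rw [← act_extCounit]
      refine sepConv_act ?_
      rw [mu, ← h.ext_counit, ← h.aeval_add, add_neg_cancel, h.sep_counit]
    rw [← LinearMap.comp_assoc, h1]
    exact congrArg AlgHom.toLinearMap h2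

end Hopf

/-! ## Siblings and roots -/

/-- `b` lies strictly between `x` and `z`. -/
def Within (b : Finset ℕ) (x z : ℕ) : Prop := ∀ y ∈ b, x < y ∧ y < z

/-- `b` and `b'` lie in the same gaps of the members of `B`. -/
def Sib (B : Finset (Finset ℕ)) (b b' : Finset ℕ) : Prop :=
  ∀ d ∈ B, ∀ x ∈ d, ∀ z ∈ d, Within b x z ↔ Within b' x z

/-- `b` lies in no gap of a member of `B`. -/
def Root (B : Finset (Finset ℕ)) (b : Finset ℕ) : Prop :=
  ∀ d ∈ B, ∀ x ∈ d, ∀ z ∈ d, ¬ Within b x z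

open Classical in
noncomputable def roots (B : Finset (Finset ℕ)) : Finset (Finset ℕ) := B.filter (Root B)

theorem mem_roots {B : Finset (Finset ℕ)} {b : Finset ℕ} : b ∈ roots B ↔ b ∈ B ∧ Root B b := by
  simp [roots]

theorem roots_subset (B : Finset (Finset ℕ)) : roots B ⊆ B := fun _ hb => (mem_roots.mp hb).1

section Sib

variable {B J : Finset (Finset ℕ)} {b b' b'' c c' d : Finset ℕ}

theorem Sib.refl (B : Finset (Finset ℕ)) (b : Finset ℕ) : Sib B b b := fun _ _ _ _ _ _ => Iff.rfl

theorem Sib.symm (h : Sib B b b') : Sib B b' b := fun d hd x hx z hz => (h d hd x hx z hz).symm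

theorem Sib.trans (h : Sib B b b') (h' : Sib B b' b'') : Sib B b b'' := fun d hd x hx z hz =>
  (h d hd x hx z hz).trans (h' d hd x hx z hz)

theorem Sib.root (h : Sib B b b') (hb : Root B b) : Root B b' := fun d hd x hx z hz hw =>
  hb d hd x hx z hz ((h d hd x hx z hz).mpr hw)

theorem Root.sib (hb : Root B b) (hb' : Root B b') : Sib B b b' := fun d hd x hx z hz =>
  ⟨fun h => absurd h (hb d hd x hx z hz), fun h => absurd h (hb' d hd x hx z hz)⟩

theorem isEquivOn_sib (B J : Finset (Finset ℕ)) : IsEquivOn J (Sib B) :=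
  ⟨fun _ _ => Sib.refl _ _, fun _ _ _ _ => Sib.symm, fun _ _ _ _ _ _ => Sib.trans⟩

/-- In a noncrossing family, a block with an element between two elements of another block
is contained in a gap of that block. -/
theorem IsNCFamily.within (hB : IsNCFamily B) (hb : b ∈ B) (hc : c ∈ B) (hne : b ≠ c)
    {x y z : ℕ} (hx : x ∈ c) (hz : z ∈ c) (hy : y ∈ b) (hxy : x ≤ y) (hyz : y ≤ z) :
    Within b x z := by
  have hd : ∀ u ∈ b, ∀ v ∈ c, u ≠ v := by
    rintro u hu v hv rfl
    exact hne (hB.eq_of_mem hb hc hu hv)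
  have h1 := hd y hy x hx
  have h2 := hd y hy z hz
  intro w hw
  have h3 := hd w hw x hx
  have h4 := hd w hw z hz
  constructor
  · by_contra h
    exact hB.nonCrossing b hb c hc hne w hw y hy x hx z hz ⟨by omega, by omega, by omega⟩
  · by_contra h
    exact hB.nonCrossing c hc b hb hne.symm x hx z hz y hy w hw ⟨by omega, by omega, by omega⟩

theorem IsNCFamily.separated_or_within (hB : IsNCFamily B) (hb : b ∈ B) (hb' : b' ∈ B)
    (hne : b ≠ b') : (∀ x ∈ b, ∀ y ∈ b', x < y) ∨ (∀ x ∈ b, ∀ y ∈ b', y < x) ∨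
      (∃ x ∈ b, ∃ z ∈ b, Within b' x z) ∨ ∃ x ∈ b', ∃ z ∈ b', Within b x z := by
  by_cases h1 : ∀ x ∈ b, ∀ y ∈ b', x < y
  · exact Or.inl h1
  by_cases h2 : ∀ x ∈ b, ∀ y ∈ b', y < x
  · exact Or.inr (Or.inl h2)
  push Not at h1 h2
  obtain ⟨x, hx, y, hy, hyx⟩ := h1
  obtain ⟨x', hx', y', hy', hxy'⟩ := h2
  rcases le_total y x' with h | h
  · exact Or.inr (Or.inr (Or.inr ⟨y, hy, y', hy', hB.within hb hb' hne hy hy' hx' h hxy'⟩))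
  · exact Or.inr (Or.inr (Or.inl ⟨x', hx', x, hx, hB.within hb' hb hne.symm hx' hx hy h hyx⟩))

theorem Sib.not_within (h : Sib B b b') (hb : b ∈ B) {x z : ℕ} (hx : x ∈ b) (hz : z ∈ b) :
    ¬ Within b' x z := fun hw =>
  lt_irrefl x (((h b hb x hx z hz).mpr hw) x hx).1

/-- Distinct siblings are separated. -/
theorem Sib.separated (hB : IsNCFamily B) (hb : b ∈ B) (hb' : b' ∈ B) (hne : b ≠ b')
    (h : Sib B b b') : (∀ x ∈ b, ∀ y ∈ b', x < y) ∨ ∀ x ∈ b, ∀ y ∈ b', y < x := by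
  rcases hB.separated_or_within hb hb' hne with h1 | h1 | ⟨x, hx, z, hz, hw⟩ | ⟨x, hx, z, hz, hw⟩
  · exact Or.inl h1
  · exact Or.inr h1
  · exact absurd hw (h.not_within hb hx hz)
  · exact absurd hw (h.symm.not_within hb' hx hz)

/-- No root meets the interval spanned by two siblings that are not roots. -/
theorem Sib.not_root (hB : IsNCFamily B) (hc : c ∈ B) (hc' : c' ∈ B) (h : Sib B c c')
    (hnr : ¬ Root B c) (hd : d ∈ B) {u v y : ℕ} (hu : u ∈ c ∪ c') (hv : v ∈ c ∪ c') (hy : y ∈ d)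
    (huy : u ≤ y) (hyv : y ≤ v) : ¬ Root B d := by
  intro hr
  have hnr' : ¬ Root B c' := fun h' => hnr (h.symm.root h')
  have hdc : d ≠ c := fun h => hnr (h ▸ hr)
  have hdc' : d ≠ c' := fun h => hnr' (h ▸ hr)
  have same : ∀ e ∈ B, d ≠ e → ∀ u ∈ e, ∀ v ∈ e, u ≤ y → y ≤ v → False :=
    fun e he hne u hu v hv h1 h2 => hr e he u hu v hv (hB.within hd he hne hu hv hy h1 h2)
  have hnr2 := hnr
  unfold Root at hnr2
  push Not at hnr2
  obtain ⟨e, he, x, hx, z, hz, hw⟩ := hnr2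
  have hw' := (h e he x hx z hz).mp hw
  have hall : ∀ w ∈ c ∪ c', x < w ∧ w < z := fun w hw0 =>
    (Finset.mem_union.mp hw0).elim (hw w) (hw' w)
  -- The block `e` encloses both siblings, hence also `y`; a root `d` through `y` that differs from
  -- `e` would lie in a gap of `e`.
  have hed : d = e := by
    by_contra hne
    exact same e he hne x hx z hz ((hall u hu).1.le.trans huy) (hyv.trans (hall v hv).2.le)
  subst hed
  -- Now `d` itself encloses both siblings. Its element `y` cannot lie between two elements of `a`,
  -- so `a` is inside the gap from `x` to `y`; the sibling `a'` is then there too, although `v` is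
  -- not below `y`.
  have mixed : ∀ a ∈ B, ∀ a' ∈ B, d ≠ a → Sib B a a' → Within a x z → ∀ u ∈ a, ∀ v ∈ a', u ≤ y →
      y ≤ v → False := by
    intro a ha a' ha' hne hs hwa u hu v hv h1 h2
    have hlt : Within a x y := fun w hw0 => by
      refine ⟨(hwa w hw0).1, ?_⟩
      by_contra h3
      exact same a ha hne u hu w hw0 h1 (not_lt.mp h3)
    exact absurd ((hs d hd x hx y hy).mp hlt v hv).2 (not_lt.mpr h2)
  rcases Finset.mem_union.mp hu with hu | hu <;> rcases Finset.mem_union.mp hv with hv | hv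
  · exact same c hc hdc u hu v hv huy hyv
  · exact mixed c hc c' hc' hdc h hw u hu v hv huy hyv
  · exact mixed c' hc' c hc hdc' h.symm hw' u hu v hv huy hyv
  · exact same c' hc' hdc' u hu v hv huy hyv

theorem Sib.conn_of_roots (hB : IsNCFamily B) (hc : c ∈ B) (hc' : c' ∈ B) (h : Sib B c c')
    (hnr : ¬ Root B c) (hJ : B \ roots B ⊆ J) : Conn B J c c' := fun _ hu _ hv _ hd _ hy huy hyv =>
  hJ (Finset.mem_sdiff.mpr ⟨hd, fun hr =>
    h.not_root hB hc hc' hnr hd hu hv hy huy hyv (mem_roots.mp hr).2⟩)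

theorem isUpper_sdiff_roots (hB : IsNCFamily B) : IsUpper B (B \ roots B) := by
  refine ⟨Finset.sdiff_subset, fun b hb => ?_⟩
  rw [Finset.mem_sdiff, mem_roots] at hb
  exact (Sib.refl B b).conn_of_roots hB hb.1 hb.1 (fun h => hb.2 ⟨hb.1, h⟩) subset_rfl

/-- In a noncrossing family, `b` meets the hull of another block only by lying in one of its gaps.
-/
theorem isUpper_erase_iff (hB : IsNCFamily B) (hb : b ∈ B) : IsUpper B (B.erase b) ↔ Root B b := by
  constructor
  · intro h d hd x hx z hz hw
    obtain ⟨y, hy⟩ := hB.nonempty hb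
    have hdb : d ≠ b := by
      rintro rfl
      exact lt_irrefl x (hw x hx).1
    exact Finset.notMem_erase b B (h.conn d (Finset.mem_erase.mpr ⟨hdb, hd⟩) x
      (Finset.mem_union_left _ hx) z (Finset.mem_union_left _ hz) b hb y hy (hw y hy).1.le
      (hw y hy).2.le)
  · intro h
    refine ⟨Finset.erase_subset _ _, fun c hc x hx z hz d hd y hy hxy hyz => ?_⟩
    rw [Finset.union_self] at hx hz
    rw [Finset.mem_erase] at hc ⊢
    refine ⟨?_, hd⟩
    rintro rfl
    exact h c hc.2 x hx z hz (hB.within hb hc.2 hc.1.symm hx hz hy hxy hyz)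

/-- If a gap of a block `d` contained one block of `C` and not another, `d` would meet the hull of
the two and therefore belong to `C`. -/
theorem sib_comp_iff (hB : IsNCFamily B) (hJ : IsUpper B J) {C : Finset (Finset ℕ)}
    (hC : C ∈ comps B J) (hb : b ∈ C) (hb' : b' ∈ C) : Sib C b b' ↔ Sib B b b' := by
  have hCB : C ⊆ B := ((hJ.isPart hB).sub C hC).trans hJ.sub
  constructor
  · intro h d hd x hx z hz
    by_cases hdC : d ∈ C
    · exact h d hdC x hx z hz
    have key : ∀ a ∈ C, ∀ a' ∈ C, Within a x z → Within a' x z := by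
      intro a ha a' ha' hw y hy
      obtain ⟨w, hwa⟩ := hB.nonempty (hCB ha)
      have hw := hw w hwa
      constructor
      · by_contra hyx
        exact hdC (hJ.mem_comp_of_between hB hC ha ha' hd (Finset.mem_union_right _ hy)
          (Finset.mem_union_left _ hwa) hx (not_lt.mp hyx) hw.1.le)
      · by_contra hyz
        exact hdC (hJ.mem_comp_of_between hB hC ha ha' hd (Finset.mem_union_left _ hwa)
          (Finset.mem_union_right _ hy) hz hw.2.le (not_lt.mp hyz))
    exact ⟨key b hb b' hb', key b' hb' b hb⟩
  · exact fun h d hd => h d (hCB hd)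

end Sib

/-! ### Further rules for products over classes. -/

section Classes

variable {α : Type*} [DecidableEq α] {R : Type*} [CommSemiring R]

theorem prod_classes_union {I J : Finset α} {r : α → α → Prop} (hr : IsEquivOn (I ∪ J) r)
    (hIJ : ∀ a ∈ I, ∀ b ∈ J, ¬ r a b) (f : Finset α → R) :
    ∏ c ∈ classes (I ∪ J) r, f c = (∏ c ∈ classes I r, f c) * ∏ c ∈ classes J r, f c := by
  have hI := hr.mono (Finset.subset_union_left (s₂ := J))
  have hJ := hr.mono (Finset.subset_union_right (s₁ := I))
  have hdisj : ∀ a ∈ I, a ∉ J := fun a ha ha' => hIJ a ha a ha' (hI.refl a ha)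
  rw [← Finset.prod_union]
  · congr 1
    ext c
    rw [Finset.mem_union, mem_classes_iff, mem_classes_iff, mem_classes_iff]
    have hl : ∀ a ∈ I, (∀ b, b ∈ c ↔ b ∈ I ∪ J ∧ r a b) ↔ ∀ b, b ∈ c ↔ b ∈ I ∧ r a b := by
      intro a ha
      refine forall_congr' fun b => ?_
      have := hIJ a ha b
      rw [Finset.mem_union]
      tauto
    have hr' : ∀ a ∈ J, (∀ b, b ∈ c ↔ b ∈ I ∪ J ∧ r a b) ↔ ∀ b, b ∈ c ↔ b ∈ J ∧ r a b := by
      intro a ha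
      refine forall_congr' fun b => ?_
      have h1 : b ∈ I → ¬ r a b := fun hb h => hIJ b hb a ha
        (hr.symm a (Finset.mem_union_right _ ha) b (Finset.mem_union_left _ hb) h)
      rw [Finset.mem_union]
      tauto
    constructor
    · rintro ⟨a, ha, h⟩
      rcases Finset.mem_union.mp ha with ha | ha
      · exact Or.inl ⟨a, ha, (hl a ha).mp h⟩
      · exact Or.inr ⟨a, ha, (hr' a ha).mp h⟩
    · rintro (⟨a, ha, h⟩ | ⟨a, ha, h⟩)
      · exact ⟨a, Finset.mem_union_left _ ha, (hl a ha).mpr h⟩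
      · exact ⟨a, Finset.mem_union_right _ ha, (hr' a ha).mpr h⟩
  · rw [Finset.disjoint_left]
    intro c hc hc'
    obtain ⟨a, ha⟩ := hI.isPart.nonempty c hc
    exact hdisj a (hI.isPart.sub c hc ha) (hJ.isPart.sub c hc' ha)

theorem prod_classes_of_forall {J : Finset α} {r : α → α → Prop} (h : ∀ a ∈ J, ∀ b ∈ J, r a b)
    (f : Finset α → R) (hf : f ∅ = 1) : ∏ c ∈ classes J r, f c = f J := by
  rcases J.eq_empty_or_nonempty with rfl | hJ
  · rw [classes_empty, Finset.prod_empty, hf]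
  · rw [classes_eq_singleton hJ h, Finset.prod_singleton]

theorem IsPart.sum_card {J : Finset α} {P : Finset (Finset α)} (hP : IsPart J P) :
    ∑ c ∈ P, c.card = J.card := by
  have h := hP.biUnion_eq
  rw [← h, Finset.card_biUnion]
  · rfl
  · intro c hc c' hc' hne
    change Disjoint c c'
    rw [Finset.disjoint_left]
    exact fun b hb hb' => hne (hP.eq_of_mem c hc c' hc' b hb hb')

end Classes

/-! ### The Catalan product and the inverse relation. -/

section ClosedFormula

variable (K : Type*) [Field K] {B J : Finset (Finset ℕ)}

/-- The product of the Catalan numbers of the sizes of the classes of siblings, with sign. -/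
noncomputable def sibWeight (B : Finset (Finset ℕ)) : K :=
  (-1) ^ B.card * ∏ c ∈ classes B (Sib B), (catalan c.card : K)

/-- The sibling classes inside the components are the classes of siblings of `B` that are also
connected in `J`. -/
theorem prod_sibWeight_comps (hB : IsNCFamily B) (hJ : IsUpper B J) :
    ∏ C ∈ comps B J, sibWeight K C = (-1) ^ J.card *
      ∏ c ∈ classes J (fun b b' => Sib B b b' ∧ Conn B J b b'), (catalan c.card : K) := by
  have hpart := hJ.isPart hB
  have hr : IsEquivOn J (fun b b' => Sib B b b' ∧ Conn B J b b') := by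
    have h1 := isEquivOn_sib B J
    have h2 := hJ.isEquivOn hB
    exact ⟨fun a ha => ⟨h1.refl a ha, h2.refl a ha⟩,
      fun a ha b hb h => ⟨h.1.symm, h.2.symm⟩,
      fun a ha b hb c hc h h' => ⟨h.1.trans h'.1, h2.trans a ha b hb c hc h.2 h'.2⟩⟩
  simp only [sibWeight]
  rw [Finset.prod_mul_distrib, Finset.prod_pow_eq_pow_sum, hpart.sum_card,
    prod_classes_refine subset_rfl hr (hJ.isEquivOn hB) (fun _ _ _ _ h => h.2)]
  congr 1
  refine Finset.prod_congr rfl fun C hC => ?_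
  have hCJ : J ∩ C = C := Finset.inter_eq_right.mpr (hpart.sub C hC)
  rw [hCJ]
  congr 1
  refine classes_congr fun b hb b' hb' => ?_
  rw [sib_comp_iff hB hJ hC hb hb', and_iff_left]
  exact ((hJ.mem_comps hB hC hb b').mp hb').2

/-- All roots are siblings of each other and of no other block, so they form one class, or none when
there are no roots. -/
theorem prod_classes_sib_eq (f : Finset (Finset ℕ) → K) (hf : f ∅ = 1) :
    ∏ c ∈ classes B (Sib B), f c = (∏ c ∈ classes (B \ roots B) (Sib B), f c) * f (roots B) := by
  have hsub := roots_subset B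
  have hu : B \ roots B ∪ roots B = B := Finset.sdiff_union_of_subset hsub
  have h1 := prod_classes_union (isEquivOn_sib B (B \ roots B ∪ roots B)) (fun a ha b hb h => by
    rw [Finset.mem_sdiff] at ha
    exact ha.2 (mem_roots.mpr ⟨ha.1, h.symm.root (mem_roots.mp hb).2⟩)) f
  rw [hu] at h1
  rw [h1, prod_classes_of_forall (J := roots B) _ f hf]
  exact fun a ha b hb => (mem_roots.mp ha).2.sib (mem_roots.mp hb).2

/-- Siblings that are not roots stay connected once the roots are removed, so only the factor of the
roots has to be taken out. -/
theorem sibWeight_eq_base (hB : IsNCFamily B) : sibWeight K B =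
    (-1) ^ (roots B).card * (catalan (roots B).card : K) *
      ∏ C ∈ comps B (B \ roots B), sibWeight K C := by
  rw [prod_sibWeight_comps K hB (isUpper_sdiff_roots hB), sibWeight,
    prod_classes_sib_eq K (fun c => (catalan c.card : K)) (by simp),
    classes_congr (s := Sib B) (r := fun b b' => Sib B b b' ∧ Conn B (B \ roots B) b b')]
  · have hsub := roots_subset B
    rw [← Finset.card_sdiff_add_card_eq_card hsub, pow_add]
    ring
  · intro b hb b' hb'
    rw [Finset.mem_sdiff, mem_roots] at hb
    rw [and_iff_left_iff_imp]
    exact fun h => h.conn_of_roots hB hb.1 (Finset.mem_sdiff.mp hb').1 (fun h => hb.2 ⟨hb.1, h⟩)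
      subset_rfl

open Classical in
/-- The roots on the left of `b`. -/
noncomputable def rootsBefore (B : Finset (Finset ℕ)) (b : Finset ℕ) : Finset (Finset ℕ) :=
  (roots B).filter fun c => ∀ x ∈ c, ∀ y ∈ b, x < y

open Classical in
/-- The roots on the right of `b`. -/
noncomputable def rootsAfter (B : Finset (Finset ℕ)) (b : Finset ℕ) : Finset (Finset ℕ) :=
  (roots B).filter fun c => ∀ x ∈ c, ∀ y ∈ b, y < x

variable {b : Finset ℕ}

theorem mem_rootsBefore {c : Finset ℕ} :
    c ∈ rootsBefore B b ↔ c ∈ roots B ∧ ∀ x ∈ c, ∀ y ∈ b, x < y := by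
  simp [rootsBefore]

theorem mem_rootsAfter {c : Finset ℕ} :
    c ∈ rootsAfter B b ↔ c ∈ roots B ∧ ∀ x ∈ c, ∀ y ∈ b, y < x := by
  simp [rootsAfter]

theorem roots_erase_eq (hB : IsNCFamily B) (hb : b ∈ roots B) :
    (roots B).erase b = rootsBefore B b ∪ rootsAfter B b := by
  ext c
  rw [Finset.mem_union, mem_rootsBefore, mem_rootsAfter, Finset.mem_erase]
  obtain ⟨hbB, hbr⟩ := mem_roots.mp hb
  obtain ⟨y, hy⟩ := hB.nonempty hbB
  constructor
  · rintro ⟨hne, hc⟩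
    obtain ⟨hcB, hcr⟩ := mem_roots.mp hc
    rcases (hcr.sib hbr).separated hB hcB hbB hne with h | h
    · exact Or.inl ⟨hc, h⟩
    · exact Or.inr ⟨hc, h⟩
  · rintro (⟨hc, h⟩ | ⟨hc, h⟩)
    · refine ⟨?_, hc⟩
      rintro rfl
      exact lt_irrefl y (h y hy y hy)
    · refine ⟨?_, hc⟩
      rintro rfl
      exact lt_irrefl y (h y hy y hy)

theorem disjoint_rootsBefore_rootsAfter (hB : IsNCFamily B) (hb : b ∈ roots B) :
    Disjoint (rootsBefore B b) (rootsAfter B b) := by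
  rw [Finset.disjoint_left]
  intro c hc hc'
  rw [mem_rootsBefore] at hc
  rw [mem_rootsAfter] at hc'
  obtain ⟨y, hy⟩ := hB.nonempty (mem_roots.mp hb).1
  obtain ⟨x, hx⟩ := hB.nonempty (mem_roots.mp hc.1).1
  exact lt_asymm (hc.2 x hx y hy) (hc'.2 x hx y hy)

theorem card_rootsBefore_add_card_rootsAfter (hB : IsNCFamily B) (hb : b ∈ roots B) :
    (rootsBefore B b).card + (rootsAfter B b).card + 1 = (roots B).card := by
  rw [← Finset.card_union_of_disjoint (disjoint_rootsBefore_rootsAfter hB hb),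
    ← roots_erase_eq hB hb, Finset.card_erase_add_one hb]

/-- The roots are lined up from left to right, so the numbers of roots before and after `b` run once
through the pairs with sum one less than their number: this is the Catalan recurrence. -/
theorem sum_catalan_roots (hB : IsNCFamily B) (hne : (roots B).Nonempty) :
    ∑ b ∈ roots B, catalan (rootsBefore B b).card * catalan (rootsAfter B b).card =
      catalan (roots B).card := by
  obtain ⟨n, hn⟩ : ∃ n, (roots B).card = n + 1 :=
    ⟨(roots B).card - 1, by have := hne.card_pos; omega⟩
  have hlt : ∀ b ∈ roots B, ∀ b' ∈ roots B, (∀ x ∈ b, ∀ y ∈ b', x < y) →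
      (rootsBefore B b).card < (rootsBefore B b').card := by
    intro b hb b' hb' h
    obtain ⟨y, hy⟩ := hB.nonempty (mem_roots.mp hb).1
    refine Finset.card_lt_card ((Finset.ssubset_iff_of_subset fun c hc => ?_).mpr
      ⟨b, mem_rootsBefore.mpr ⟨hb, h⟩, fun h' => ?_⟩)
    · rw [mem_rootsBefore] at hc ⊢
      exact ⟨hc.1, fun x hx z hz => (hc.2 x hx y hy).trans (h y hy z hz)⟩
    · exact lt_irrefl y ((mem_rootsBefore.mp h').2 y hy y hy)
  have hinj : Set.InjOn (fun b => ((rootsBefore B b).card, (rootsAfter B b).card))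
      (roots B : Set (Finset ℕ)) := by
    intro b hb b' hb' heq
    by_contra hne
    have heq' : (rootsBefore B b).card = (rootsBefore B b').card := congrArg Prod.fst heq
    obtain ⟨hbB, hbr⟩ := mem_roots.mp hb
    obtain ⟨hbB', hbr'⟩ := mem_roots.mp hb'
    rcases (hbr.sib hbr').separated hB hbB hbB' hne with h | h
    · exact absurd (hlt b hb b' hb' h) (by omega)
    · exact absurd (hlt b' hb' b hb fun x hx y hy => h y hy x hx) (by omega)
  have himage : (roots B).image (fun b => ((rootsBefore B b).card, (rootsAfter B b).card)) =
      Finset.HasAntidiagonal.antidiagonal n := by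
    refine Finset.eq_of_subset_of_card_le ?_ ?_
    · intro p hp
      obtain ⟨b, hb, rfl⟩ := Finset.mem_image.mp hp
      rw [Finset.HasAntidiagonal.mem_antidiagonal]
      have := card_rootsBefore_add_card_rootsAfter hB hb
      simp only
      omega
    · rw [Finset.card_image_of_injOn hinj, Finset.Nat.card_antidiagonal, hn]
  rw [hn, catalan_succ', ← himage, Finset.sum_image hinj]

/-- Without `b`, a root on its left and one on its right are no longer connected, while roots on the
same side are. Siblings that are not roots remain connected, as no root meets the hull of two of
them. An empty side counts as `catalan 0 = 1`. -/
theorem prod_sibWeight_comps_erase (hB : IsNCFamily B) (hb : b ∈ roots B) :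
    ∏ C ∈ comps B (B.erase b), sibWeight K C = (-1) ^ (B.card - 1) *
      ((∏ c ∈ classes (B \ roots B) (Sib B), (catalan c.card : K)) *
        (catalan (rootsBefore B b).card * catalan (rootsAfter B b).card : ℕ)) := by
  obtain ⟨hbB, hbr⟩ := mem_roots.mp hb
  have hU := (isUpper_erase_iff hB hbB).mpr hbr
  obtain ⟨w, hw⟩ := hB.nonempty hbB
  set r : Finset ℕ → Finset ℕ → Prop := fun c c' => Sib B c c' ∧ Conn B (B.erase b) c c' with hr
  have hre : IsEquivOn (B.erase b) r := by
    have h2 := hU.isEquivOn hB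
    exact ⟨fun a ha => ⟨Sib.refl B a, h2.refl a ha⟩,
      fun a ha b hb h => ⟨h.1.symm, h.2.symm⟩,
      fun a ha b hb c hc h h' => ⟨h.1.trans h'.1, h2.trans a ha b hb c hc h.2 h'.2⟩⟩
  have hsplit : B.erase b = B \ roots B ∪ (rootsBefore B b ∪ rootsAfter B b) := by
    rw [← roots_erase_eq hB hb]
    ext c
    have hcB : c ∈ roots B → c ∈ B := fun h => (mem_roots.mp h).1
    have hcb : c = b → c ∈ roots B := fun h => h ▸ hb
    simp only [Finset.mem_erase, Finset.mem_union, Finset.mem_sdiff]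
    tauto
  have hconn : ∀ c ∈ B.erase b, ∀ c' ∈ B.erase b, (∀ x ∈ c ∪ c', ∀ y ∈ b, x < y) ∨
      (∀ x ∈ c ∪ c', ∀ y ∈ b, y < x) → Conn B (B.erase b) c c' := by
    intro c hc c' hc' h u hu v hv d hd y hy huy hyv
    refine Finset.mem_erase.mpr ⟨?_, hd⟩
    rintro rfl
    rcases h with h | h
    · exact absurd (h v hv y hy) (by omega)
    · exact absurd (h u hu y hy) (by omega)
  rw [prod_sibWeight_comps K hB hU, Finset.card_erase_of_mem hbB]
  congr 1
  have h1 := prod_classes_union (I := B \ roots B) (J := rootsBefore B b ∪ rootsAfter B b) (r := r)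
    (hsplit ▸ hre) (fun a ha c hc h => by
      rw [Finset.mem_sdiff] at ha
      rw [← roots_erase_eq hB hb] at hc
      exact ha.2 (mem_roots.mpr
        ⟨ha.1, h.1.symm.root (mem_roots.mp (Finset.mem_of_mem_erase hc)).2⟩))
    (fun c => (catalan c.card : K))
  have hre' : IsEquivOn (rootsBefore B b ∪ rootsAfter B b) r :=
    hre.mono (hsplit ▸ Finset.subset_union_right)
  have h2 := prod_classes_union (I := rootsBefore B b) (J := rootsAfter B b) (r := r) hre'
    (fun a ha c hc h => by
      rw [mem_rootsBefore] at ha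
      rw [mem_rootsAfter] at hc
      obtain ⟨x, hx⟩ := hB.nonempty (mem_roots.mp ha.1).1
      obtain ⟨z, hz⟩ := hB.nonempty (mem_roots.mp hc.1).1
      exact Finset.notMem_erase b B (h.2 x (Finset.mem_union_left _ hx) z
        (Finset.mem_union_right _ hz) b hbB w hw (ha.2 x hx w hw).le (hc.2 z hz w hw).le))
    (fun c => (catalan c.card : K))
  have hmemL : ∀ c ∈ rootsBefore B b, c ∈ B.erase b := fun c hc => by
    rw [hsplit]
    exact Finset.mem_union_right _ (Finset.mem_union_left _ hc)
  have hmemR : ∀ c ∈ rootsAfter B b, c ∈ B.erase b := fun c hc => by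
    rw [hsplit]
    exact Finset.mem_union_right _ (Finset.mem_union_right _ hc)
  rw [← hsplit, h2] at h1
  rw [← hr, h1, prod_classes_of_forall (J := rootsBefore B b) _ (fun c => (catalan c.card : K))
    (by simp), prod_classes_of_forall (J := rootsAfter B b) _ (fun c => (catalan c.card : K))
    (by simp), Nat.cast_mul]
  · congr 2
    refine classes_congr fun c hc c' hc' => ?_
    rw [Finset.mem_sdiff, mem_roots] at hc
    rw [hr, and_iff_left_iff_imp]
    refine fun h => h.conn_of_roots hB hc.1 (Finset.mem_sdiff.mp hc').1
      (fun h => hc.2 ⟨hc.1, h⟩) ?_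
    rw [hsplit]
    exact Finset.subset_union_left
  · intro c hc c' hc'
    have h1 := mem_rootsAfter.mp hc
    have h2 := mem_rootsAfter.mp hc'
    exact ⟨(mem_roots.mp h1.1).2.sib (mem_roots.mp h2.1).2, hconn c (hmemR c hc) c' (hmemR c' hc')
      (Or.inr fun x hx => (Finset.mem_union.mp hx).elim (h1.2 x) (h2.2 x))⟩
  · intro c hc c' hc'
    have h1 := mem_rootsBefore.mp hc
    have h2 := mem_rootsBefore.mp hc'
    exact ⟨(mem_roots.mp h1.1).2.sib (mem_roots.mp h2.1).2, hconn c (hmemL c hc) c' (hmemL c' hc')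
      (Or.inl fun x hx => (Finset.mem_union.mp hx).elim (h1.2 x) (h2.2 x))⟩

/-- A block that contains the smallest element of the support is a root. -/
theorem roots_nonempty (hB : IsNCFamily B) (hne : B.Nonempty) : (roots B).Nonempty := by
  obtain ⟨b, hb⟩ := hne
  obtain ⟨x, hx⟩ := hB.nonempty hb
  have hs : (support B).Nonempty := ⟨x, subset_support hb hx⟩
  obtain ⟨c, hc, hmc⟩ := mem_support.mp ((support B).min'_mem hs)
  refine ⟨c, mem_roots.mpr ⟨hc, fun d hd u hu v hv hw => ?_⟩⟩
  exact absurd (hw _ hmc).1 (not_lt.mpr ((support B).min'_le u (subset_support hd hu)))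

theorem sibWeight_recursion (hB : IsNCFamily B) (hne : B.Nonempty) :
    sibWeight K B + ∑ b ∈ roots B, ∏ C ∈ comps B (B.erase b), sibWeight K C = 0 := by
  rw [Finset.sum_congr rfl fun b hb => prod_sibWeight_comps_erase K hB hb, ← Finset.mul_sum,
    ← Finset.mul_sum, ← Nat.cast_sum, sum_catalan_roots hB (roots_nonempty hB hne), sibWeight,
    prod_classes_sib_eq K (fun c => (catalan c.card : K)) (by simp)]
  obtain ⟨n, hn⟩ : ∃ n, B.card = n + 1 := ⟨B.card - 1, by have := hne.card_pos; omega⟩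
  rw [hn, Nat.add_sub_cancel, pow_succ]
  ring

variable {K}

/-- These are the ideals whose complement is not killed by the counit of `δ`. -/
theorem filter_uppers_card_le_one (hB : IsNCFamily B) :
    (uppers B).filter (fun J => (B \ J).card ≤ 1) = insert B ((roots B).image B.erase) := by
  ext J
  rw [Finset.mem_filter, mem_uppers, Finset.mem_insert, Finset.mem_image]
  constructor
  · rintro ⟨hJ, hc⟩
    rcases Finset.card_le_one_iff_subset_singleton.mp hc with ⟨b, hb⟩
    rcases Finset.subset_singleton_iff.mp hb with h | h
    · exact Or.inl (hJ.sub.antisymm (Finset.sdiff_eq_empty_iff_subset.mp h))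
    · have hbB : b ∈ B := (Finset.mem_sdiff.mp (h.symm ▸ Finset.mem_singleton_self b)).1
      have hJb : B.erase b = J := by
        rw [Finset.erase_eq, ← h, Finset.sdiff_sdiff_eq_self hJ.sub]
      exact Or.inr ⟨b, mem_roots.mpr ⟨hbB, (isUpper_erase_iff hB hbB).mp (hJb ▸ hJ)⟩, hJb⟩
  · rintro (rfl | ⟨b, hb, rfl⟩)
    · exact ⟨IsUpper.univ J, by simp⟩
    · obtain ⟨hbB, hbr⟩ := mem_roots.mp hb
      refine ⟨(isUpper_erase_iff hB hbB).mpr hbr, ?_⟩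
      rw [Finset.sdiff_erase_self hbB, Finset.card_singleton]

/-- The inverse relation expresses the value at `B` through families with fewer blocks, and
`sibWeight` satisfies the same relation. -/
theorem eq_sibWeight_of_sepConv {χ : KNCP K →ₐ[K] K}
    (h : sepConv (extUnit K K) χ = sepUnit K K) (hB : IsNCFamily B) :
    χ (gen K B) = sibWeight K B := by
  induction hc : B.card using Nat.strong_induction_on generalizing B with
  | _ k ih =>
  rcases B.eq_empty_or_nonempty with rfl | hne
  · simp [gen_empty, sibWeight, classes_empty]
  have h1 : χ (gen K B) + ∑ b ∈ roots B, ∏ C ∈ comps B (B.erase b), χ (gen K C) = 0 := by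
    have h2 := DFunLike.congr_fun h (gen K B)
    rw [sepConv_gen _ _ hB, sepUnit_gen hB, if_neg hne.ne_empty, sumSep] at h2
    rw [← h2]
    have h3 : ∀ J ∈ uppers B, extUnit K K (gen K (B \ J)) * ∏ c ∈ comps B J, χ (gen K c) =
        if (B \ J).card ≤ 1 then ∏ c ∈ comps B J, χ (gen K c) else 0 := by
      intro J _
      rw [extUnit_gen (hB.mono Finset.sdiff_subset), ite_mul, one_mul, zero_mul]
    rw [Finset.sum_congr rfl h3, ← Finset.sum_filter, filter_uppers_card_le_one hB,
      Finset.sum_insert, comps_self hne, Finset.prod_singleton, Finset.sum_image]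
    · intro b hb b' hb' heq
      exact (Finset.erase_inj B (mem_roots.mp hb).1).mp heq
    · rw [Finset.mem_image]
      rintro ⟨b, hb, heq⟩
      exact Finset.notMem_erase b B (heq.symm ▸ (mem_roots.mp hb).1)
  have h4 := sibWeight_recursion K hB hne
  have h5 : ∀ b ∈ roots B, ∏ C ∈ comps B (B.erase b), χ (gen K C) =
      ∏ C ∈ comps B (B.erase b), sibWeight K C := by
    intro b hb
    obtain ⟨hbB, hbr⟩ := mem_roots.mp hb
    have hU := (isUpper_erase_iff hB hbB).mpr hbr
    refine Finset.prod_congr rfl fun C hC => ?_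
    have hCB := (hU.isPart hB).sub C hC
    refine ih C.card ?_ (hB.mono (hCB.trans hU.sub)) rfl
    rw [← hc]
    exact (Finset.card_le_card hCB).trans_lt (Finset.card_erase_lt_of_mem hbB)
  rw [Finset.sum_congr rfl h5] at h1
  linear_combination h1 - h4

theorem IsDoubleBialgebraHom.mu_gen {φ : KNCP K →ₐ[K] K[X]} (h : IsDoubleBialgebraHom φ)
    (hB : IsNCFamily B) : mu φ (gen K B) = sibWeight K B := by
  refine eq_sibWeight_of_sepConv ?_ hB
  rw [extUnit_self, sepUnit_self, mu, ← h.ext_counit, ← h.aeval_add, add_neg_cancel, h.sep_counit]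

end ClosedFormula

/-! ### Base, adjacency chains and siblings in a partition of an interval. -/

section Chains

variable {π : NCP} {b b' : Finset ℕ}

theorem base_eq_roots (π : NCP) : base π = roots π.blocks := by
  classical
  have hB := π.isNCFamily
  ext b
  rw [base, Finset.mem_filter, mem_roots]
  refine and_congr_right fun hb => ⟨fun h d hd x hx z hz hw => ?_, fun h d hd hn => ?_⟩
  · have hne := hB.nonempty hd
    have hdb : d = b := by
      refine h d hd ⟨d.min' hne, d.max' hne, d.isLeast_min' hne, d.isGreatest_max' hne,
        fun y hy => ?_⟩
      rw [Finset.mem_Icc]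
      exact ⟨(d.min'_le x hx).trans (hw y hy).1.le, (hw y hy).2.le.trans (d.le_max' z hz)⟩
    subst hdb
    exact lt_irrefl x (hw x hx).1
  · obtain ⟨l, u, hl, hu, hsub⟩ := hn
    obtain ⟨y, hy⟩ := hB.nonempty hb
    by_contra hne
    have hy' := Finset.mem_Icc.mp (hsub hy)
    exact h d hd l hl.1 u hu.1 (hB.within hb hd (Ne.symm hne) hl.1 hu.1 hy hy'.1 hy'.2)

/-- No integer lies between `m` and `m + 1`, so a gap of another block that contains one of the two
contains the other, and then the whole block by noncrossing. -/
theorem Adjacent.sib (h : Adjacent π b b') : Sib π.blocks b b' := by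
  have hB := π.isNCFamily
  obtain ⟨hb, hb', m, hm, hm'⟩ := h
  intro d hd x hx z hz
  constructor
  · intro hw
    obtain ⟨h1, h2⟩ := hw m hm.1
    have hne : b' ≠ d := by
      rintro rfl
      have := hm'.2 hx
      omega
    exact hB.within hb' hd hne hx hz hm'.1 (by omega) (by omega)
  · intro hw
    obtain ⟨h1, h2⟩ := hw (m + 1) hm'.1
    have hne : b ≠ d := by
      rintro rfl
      have := hm.2 hz
      omega
    exact hB.within hb hd hne hx hz hm.1 (by omega) (by omega)

theorem sib_of_reflTransGen (h : Relation.ReflTransGen (Adjacent π) b b') : Sib π.blocks b b' := by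
  induction h with
  | refl => exact Sib.refl _ _
  | tail _ h ih => exact ih.trans h.sib

/-- The block through the successor of `max b` is adjacent to `b`, hence again a sibling of `b'`,
and it is closer to `b'`; induction on the distance to a fixed element `l` of `b'`. -/
theorem Sib.reflTransGen (hb : b ∈ π.blocks) (hb' : b' ∈ π.blocks) (h : Sib π.blocks b b')
    (hlt : ∀ x ∈ b, ∀ y ∈ b', x < y) : Relation.ReflTransGen (Adjacent π) b b' := by
  have hB := π.isNCFamily
  obtain ⟨l, hl⟩ := hB.nonempty hb'
  induction hk : l - b.sup id using Nat.strong_induction_on generalizing b with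
  | _ k ih =>
  have hne := hB.nonempty hb
  have hm := b.isGreatest_max' hne
  have hsup : b.sup id = b.max' hne := (Finset.max'_eq_sup' b hne).symm ▸
    (Finset.sup'_eq_sup hne id).symm
  rw [hsup] at hk
  set m := b.max' hne
  have hml : m < l := hlt m hm.1 l hl
  have hmem : m + 1 ∈ support π.blocks := by
    refine π.mem_support_of_between hb hb' hm.1 hl ?_
    rw [Finset.mem_uIcc']
    omega
  obtain ⟨d, hd, hmd⟩ := mem_support.mp hmem
  have hbd : b ≠ d := by
    rintro rfl
    have := hm.2 hmd
    omega
  -- If `d` started earlier, `b` would lie in a gap of `d` ending at `m + 1`, and so would its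
  -- sibling `b'`, which is impossible as `l > m`.
  have hleast : IsLeast (d : Set ℕ) (m + 1) := by
    refine ⟨hmd, fun w hw => ?_⟩
    by_contra hwm
    have hwit := hB.within hb hd hbd hw hmd hm.1 (by omega) (by omega)
    have := ((h d hd w hw (m + 1) hmd).mp hwit l hl).2
    omega
  have hadj : Adjacent π b d := ⟨hb, hd, m, hm, hleast⟩
  by_cases hdb : d = b'
  · subst hdb
    exact Relation.ReflTransGen.single hadj
  have hs : Sib π.blocks d b' := hadj.sib.symm.trans h
  -- Siblings are separated, and `d` on the right of `b'` would give `l < m + 1`.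
  have hlt' : ∀ x ∈ d, ∀ y ∈ b', x < y := by
    rcases hs.separated hB hd hb' hdb with h1 | h1
    · exact h1
    · have := h1 (m + 1) hmd l hl
      omega
  refine Relation.ReflTransGen.head hadj (ih (l - d.sup id) ?_ hd hs hlt' rfl)
  have : m + 1 ≤ d.sup id := Finset.le_sup (f := id) hmd
  omega

theorem chained_iff_sib (hb : b ∈ π.blocks) (hb' : b' ∈ π.blocks) :
    Chained π b b' ↔ Sib π.blocks b b' := by
  constructor
  · rintro (h | h)
    · exact sib_of_reflTransGen h
    · exact (sib_of_reflTransGen h).symm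
  · intro h
    by_cases hne : b = b'
    · exact hne ▸ Or.inl Relation.ReflTransGen.refl
    rcases h.separated π.isNCFamily hb hb' hne with h1 | h1
    · exact Or.inl (h.reflTransGen hb hb' h1)
    · exact Or.inr (h.symm.reflTransGen hb' hb fun x hx y hy => h1 y hy x hx)

theorem chainClasses_eq (π : NCP) : chainClasses π = classes π.blocks (Sib π.blocks) := by
  rw [← classes_congr (r := Chained π) fun b hb b' hb' => chained_iff_sib hb hb']
  rfl

end Chains

end NCPart

theorem proposition3p5 (K : Type*) [Field K] [CharZero K] :
    (∃! φ : NCPart.KNCP K →ₐ[K] Polynomial K, NCPart.IsDoubleBialgebraHom φ) ∧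
    ∀ φ : NCPart.KNCP K →ₐ[K] Polynomial K, NCPart.IsDoubleBialgebraHom φ →
      -- `S = (μ ⊗ Id) ∘ δ` is the antipode of the Hopf algebra given by `Δ`
      NCPart.IsHopfAlgebra (NCPart.sepComul K) (NCPart.sepCounit K)
        (NCPart.act (NCPart.mu φ)).toLinearMap ∧
      ∀ π : NCPart.NCP,
        -- the antipode on a noncrossing partition
        NCPart.act (NCPart.mu φ) (MvPolynomial.X π) =
          ∑ P ∈ NCPart.contractible π,
            NCPart.mu φ (NCPart.gen K (NCPart.contract P)) • NCPart.extract K P ∧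
        -- the recursion through the base
        NCPart.mu φ (MvPolynomial.X π) =
          (-1) ^ (NCPart.base π).card * (catalan (NCPart.base π).card : K) *
            NCPart.mu φ (NCPart.restrictDot K π (π.blocks \ NCPart.base π)) ∧
        NCPart.IsIdeal π (π.blocks \ NCPart.base π) ∧
        -- the closed formula
        NCPart.mu φ (MvPolynomial.X π) =
          (-1) ^ π.blocks.card * ∏ c ∈ NCPart.chainClasses π, (catalan c.card : K) := by
  refine ⟨NCPart.existsUnique_isDoubleBialgebraHom, fun φ hφ => ⟨hφ.isHopfAlgebra, fun π => ?_⟩⟩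
  have hB := π.isNCFamily
  have hU := NCPart.isUpper_sdiff_roots hB
  have hmu : NCPart.mu φ (MvPolynomial.X π) = NCPart.sibWeight K π.blocks := by
    rw [← NCPart.gen_blocks, hφ.mu_gen hB]
  refine ⟨NCPart.act_X _ π, ?_, ?_, ?_⟩
  · rw [hmu, NCPart.base_eq_roots, NCPart.sibWeight_eq_base K hB, π.restrictDot_eq K hU, map_prod]
    congr 1
    exact Finset.prod_congr rfl fun C hC =>
      (hφ.mu_gen (hB.mono (((hU.isPart hB).sub C hC).trans hU.sub))).symm
  · rw [NCPart.base_eq_roots]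
    exact π.isIdeal_iff.mpr hU
  · rw [hmu, NCPart.chainClasses_eq, NCPart.sibWeight]
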